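/- **Theorem (Pure Complementary Energy Principle, Gao).** *Setting.* Let $\Omega\subset\mathbb R^3$ be a bounded (connected) Lipschitz domain, and let $\Gamma_u,\Gamma_t$ be disjoint relatively open subsets of $\partial\Omega$ that cover $\partial\Omega$ up to a set of surface measure zero, with $\Gamma_u\neq\emptyset$. Let $f$ be a body force on $\Omega$ and $t$ a surface traction on $\Gamma_t$. Write $C^1(\overline\Omega)$ for fields of class $C^1$ up to the boundary, $(\nabla\chi)_{ij}=\partial_j\chi_i$, $(\nabla\cdot\tau)_i=\sum_j\partial_j\tau_{ij}$, $(n\cdot\tau)_i=\sum_j\tau_{ij}n_j$, $A:B=\operatorname{tr}(A^{T}B)$, where $n$ is the outward unit normal, and $\mathbb S^+$ for the symmetric positive definite $3\times3$ matrices. Let $V:\mathbb S^+\to\mathbb R$ be a convex canonical function, i.e. $V$ is convex and differentiable and $C\mapsto\nabla V(C)$ (gradient in the space of symmetric matrices) is one-to-one; let $V^*(S)=C:S-V(C)$ with $S=\nabla V(C)$ be its Legendre transform on $\nabla V(\mathbb S^+)$. The stored energy density is $U(F)=V(F^TF)$, and $$\Pi(\chi)=\int_\Omega U(\nabla\chi)\,d\Omega-\int_\Omega\chi\cdot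 f\,d\Omega-\int_{\Gamma_t}\chi\cdot t\,d\Gamma$$ on the set $\mathcal X_c$ of all $\chi\in C^1(\overline\Omega;\mathbb R^3)$ with $\chi=0$ on $\Gamma_u$, $(\nabla\chi)^T\nabla\chi\in\mathbb S^+$ in $\Omega$ and $\int_\Omega |U(\nabla\chi)|\,d\Omega<\infty$. Let $$\mathcal T_c=\{\tau\in C^1(\overline\Omega;\mathbb R^{3\times3}) : -\nabla\cdot\tau=f\text{ in }\Omega,\ n\cdot\tau=t\text{ a.e. on }\Gamma_t\},$$ and, for $\tau\in\mathcal T_c$, let $\mathcal S_c$ be the set of tensor fields $S$ that are continuous and invertible on $\overline\Omega$, with $S(x)\in\nabla V(\mathbb S^+)$ and $\det(\tau S^{-1})>0$ for $x\in\Omega$, and $\int_\Omega|V^*(S)|\,d\Omega<\infty$. The pure complementary energy is $$\Pi^d(S;\tau)=-\int_\Omega\Big[\tfrac14\operatorname{tr}(\tau S^{-1}\tau^T)+V^*(S)\Big]d\Omega .$$ A pair $(\bar S,\bar\tau)\in\mathcal S_c\times\mathcal T_c$ is *stationary* if $\frac{d}{d\varepsilon}\Pi^d(\bar S+\varepsilon\eta;\bar\tau+\varepsilon\theta)|_{\varepsilon=0}=0$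 for all continuous symmetric $\eta$ with compact support in $\Omega$ and all $\theta\in C^1(\overline\Omega;\mathbb R^{3\times 3})$ with $\nabla\cdot\theta=0$ in $\Omega$ and $n\cdot\theta=0$ a.e. on $\Gamma_t$. *Claim.* Let $(\bar S,\bar\tau)$ be a stationary point of $\Pi^d$ over $\mathcal S_c\times\mathcal T_c$ and let $x_0\in\Gamma_u$. Then: 1. Every $x\in\overline\Omega$ can be joined to $x_0$ in $\overline\Omega$ by a path that is continuous and, off finitely many parameters, differentiable, with integrable velocity; and $$\bar\chi(x)=\tfrac12\int_{x_0}^x\bar\tau\,\bar S^{-1}\,dx$$ has the same value along all such paths. 2. $\bar\chi\in\mathcal X_c$, $\det\nabla\bar\chi>0$ in $\Omega$, and $\bar\chi$ is a critical point of $\Pi$: the first variation $\int_\Omega\nabla_FU(\nabla\bar\chi):\nabla v\,d\Omega-\int_\Omega v\cdot f\,d\Omega-\int_{\Gamma_t}v\cdot t\,d\Gamma$ vanishes for all $v\in C^1(\overline\Omega;\mathbb R^3)$ with $v=0$ on $\Gamma_u$, and $\frac{d}{d\varepsilon}\Pi(\bar\chi+\varepsilon v)|_{\varepsilon=0}=0$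 for every such $v$ whose support in $\overline\Omega$ lies where $(\nabla\bar\chi)^T\nabla\bar\chi\in\mathbb S^+$. 3. $\Pi(\bar\chi)=\Pi^d(\bar S;\bar\tau)$. 4. If $\bar S(x)\succ0$ for all $x\in\Omega$, then $\bar\chi$ is a global minimizer of $\Pi$ over $\mathcal X_c$. 5. If the compatibility condition $\operatorname{curl}(\bar\tau\,\bar S^{-1})=0$ (row-wise, in the sense of distributions) holds in $\Omega$, then $\bar\chi$ solves the mixed boundary-value problem $$-\nabla\cdot\nabla_FU(\nabla\bar\chi)=f\ \text{in }\Omega,\qquad n\cdot\nabla_FU(\nabla\bar\chi)=t\ \text{a.e. on }\Gamma_t,\qquad \bar\chi=0\ \text{on }\Gamma_u ,$$ where $\nabla_FU(\nabla\bar\chi)$ extends from $\Omega$ to a $C^1$ field on $\overline\Omega$. -/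

import Mathlib

open Set Filter Topology MeasureTheory

noncomputable section

namespace Hyperelastic

/-- Three-dimensional Euclidean space. -/
abbrev E3 := EuclideanSpace ℝ (Fin 3)

/-- Second-order tensors (real `3 × 3` matrices). -/
abbrev Tensor := Matrix (Fin 3) (Fin 3) ℝ

/-! ### The body -/

/-- A bounded Lipschitz domain in `ℝ³`: open, connected, bounded and, near every boundary point and
in suitable Cartesian coordinates, the strict epigraph of a Lipschitz function of two variables. -/
structure IsLipschitzDomain (Ω : Set E3) : Prop where
  isOpen : IsOpen Ω
  isConnected : IsConnected Ω
  isBounded : Bornology.IsBounded Ω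
  locally_epigraph : ∀ p ∈ frontier Ω,
    ∃ (R : E3 ≃ₗᵢ[ℝ] E3) (K : NNReal) (φ : EuclideanSpace ℝ (Fin 2) → ℝ), LipschitzWith K φ ∧
      ∀ᶠ x in 𝓝 p, (x ∈ Ω ↔ φ !₂[R x 0, R x 1] < R x 2)

/-- `Γu` and `Γt` are disjoint, relatively open pieces of the boundary of `Ω` which together cover
the boundary up to a set of surface measure zero. -/
structure IsBoundaryDecomposition (Ω Γu Γt : Set E3) : Prop where
  relOpen_left : ∃ O : Set E3, IsOpen O ∧ Γu = O ∩ frontier Ω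
  relOpen_right : ∃ O : Set E3, IsOpen O ∧ Γt = O ∩ frontier Ω
  disjoint : Disjoint Γu Γt
  cover : (μHE[2] : Measure E3) (frontier Ω \ (Γu ∪ Γt)) = 0

/-- `n` is the outward unit normal of `Ω` at the boundary point `p`: the set `Ω` is asymptotic to
the half-space `{x | ⟪x - p, n⟫ < 0}` at `p`. (Such an `n` is unique; for a Lipschitz domain it
exists at almost every boundary point.) -/
def IsOuterNormal (Ω : Set E3) (p n : E3) : Prop :=
  ‖n‖ = 1 ∧ ∀ ε > (0 : ℝ), ∀ᶠ x in 𝓝 p,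
    (inner ℝ (x - p) n < -(ε * ‖x - p‖) → x ∈ Ω) ∧
    (ε * ‖x - p‖ < inner ℝ (x - p) n → x ∉ Ω)

/-! ### Differential operators -/

/-- The `j`-th partial derivative of a scalar field on the closed body `closure Ω`. -/
def partialD (Ω : Set E3) (u : E3 → ℝ) (j : Fin 3) (x : E3) : ℝ :=
  fderivWithin ℝ u (closure Ω) x (EuclideanSpace.single j 1)

/-- The gradient `(∇χ)ᵢⱼ = ∂ⱼχᵢ` of a vector field. -/
def grad (Ω : Set E3) (χ : E3 → E3) (x : E3) : Tensor :=
  Matrix.of fun i j => partialD Ω (fun y => χ y i) j x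

/-- The divergence `(∇·τ)ᵢ = ∑ⱼ ∂ⱼτᵢⱼ` of a tensor field. -/
def div (Ω : Set E3) (τ : E3 → Tensor) (x : E3) : E3 :=
  WithLp.toLp 2 fun i => ∑ j, partialD Ω (fun y => τ y i j) j x

/-- A tensor field of class `C¹` up to the boundary. -/
def IsC1Tensor (Ω : Set E3) (τ : E3 → Tensor) : Prop :=
  ∀ i j, ContDiffOn ℝ 1 (fun x => τ x i j) (closure Ω)

/-- Every row of the tensor field `G` has zero curl in `Ω`, in the sense of distributions (for a
`C¹` field this says `∂ₖGᵢⱼ = ∂ⱼGᵢₖ`). -/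
def CurlFree (Ω : Set E3) (G : E3 → Tensor) : Prop :=
  ∀ φ : E3 → ℝ, ContDiff ℝ (⊤ : ℕ∞) φ → HasCompactSupport φ → tsupport φ ⊆ Ω →
    ∀ i j k : Fin 3,
      ∫ x in Ω, (G x i j * fderiv ℝ φ x (EuclideanSpace.single k 1)
        - G x i k * fderiv ℝ φ x (EuclideanSpace.single j 1)) = 0

/-! ### Stored energy, canonical duality -/

/-- The Frobenius pairing `H ↦ G : H` with a fixed tensor. -/
def pairing (G : Tensor) : Tensor →L[ℝ] ℝ where
  toFun H := (G.transpose * H).trace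
  map_add' H K := by simp [Matrix.mul_add, Matrix.trace_add]
  map_smul' c H := by simp [Matrix.trace_smul]
  cont := by fun_prop

/-- The symmetric positive definite tensors `𝕊⁺`. -/
def SymPos : Set Tensor := {C | C.PosDef}

/-- `S = ∇V(C)` for a function `V` on `𝕊⁺`; the gradient is taken in the space of symmetric
tensors. -/
def HasStrainGradient (V : Tensor → ℝ) (S C : Tensor) : Prop :=
  S.IsSymm ∧ HasFDerivWithinAt V (pairing S) SymPos C

/-- A convex canonical function on `𝕊⁺`: it is convex and differentiable, and its duality mapping
`C ↦ ∇V(C)` is one-to-one (hence a bijection of `𝕊⁺` onto its range). Only the values of `V` on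
`𝕊⁺` matter. -/
structure IsConvexCanonical (V : Tensor → ℝ) : Prop where
  convexOn : ConvexOn ℝ SymPos V
  differentiable : ∀ C ∈ SymPos, ∃ S, HasStrainGradient V S C
  injective : ∀ C ∈ SymPos, ∀ C' ∈ SymPos, ∀ S,
    HasStrainGradient V S C → HasStrainGradient V S C' → C = C'

/-- The range of the duality mapping `∇V : 𝕊⁺ → Sym(3)`. -/
def dualRange (V : Tensor → ℝ) : Set Tensor := {S | ∃ C ∈ SymPos, HasStrainGradient V S C}

/-- The strain `C ∈ 𝕊⁺` with `∇V(C) = S` (meaningful for `S ∈ dualRange V`). -/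
def strainOf (V : Tensor → ℝ) (S : Tensor) : Tensor :=
  Classical.epsilon fun C => C ∈ SymPos ∧ HasStrainGradient V S C

/-- The Legendre transform `V*(S) = C : S - V(C)`, where `S = ∇V(C)`. -/
def legendre (V : Tensor → ℝ) (S : Tensor) : ℝ :=
  pairing S (strainOf V S) - V (strainOf V S)

/-- The stored energy density `U(F) = V(FᵀF)`. -/
def storedEnergy (V : Tensor → ℝ) (F : Tensor) : ℝ := V (F.transpose * F)

/-- The right Cauchy-Green tensor `C(∇χ) = (∇χ)ᵀ(∇χ)`. -/
def cauchyGreen (Ω : Set E3) (χ : E3 → E3) (x : E3) : Tensor :=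
  (grad Ω χ x).transpose * grad Ω χ x

/-! ### The primal problem -/

/-- The external energy `F(χ) = ∫_Ω χ·f dΩ + ∫_{Γt} χ·t dΓ`. -/
def externalEnergy (Ω Γt : Set E3) (f t : E3 → E3) (χ : E3 → E3) : ℝ :=
  (∫ x in Ω, inner ℝ (χ x) (f x)) + ∫ x in Γt, inner ℝ (χ x) (t x) ∂(μHE[2] : Measure E3)

/-- The total potential energy `Π(χ)`. -/
def totalPotential (V : Tensor → ℝ) (Ω Γt : Set E3) (f t : E3 → E3) (χ : E3 → E3) : ℝ :=
  (∫ x in Ω, storedEnergy V (grad Ω χ x)) - externalEnergy Ω Γt f t χ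

/-- Vector fields of class `C¹` up to the boundary which vanish on `Γu`. -/
def VanishingOn (Ω Γu : Set E3) : Set (E3 → E3) :=
  {v | ContDiffOn ℝ 1 v (closure Ω) ∧ ∀ x ∈ Γu, v x = 0}

/-- The kinetically admissible space: `χ ∈ C¹`, `χ = 0` on `Γu`, `C(∇χ) ∈ 𝕊⁺` in `Ω`, and finite
stored energy. (The strain condition is imposed in the open set `Ω` only: the clamping condition
`χ = 0` on `Γu` makes `∇χ` singular there.) -/
def KinAdmissible (V : Tensor → ℝ) (Ω Γu : Set E3) : Set (E3 → E3) :=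
  {χ | χ ∈ VanishingOn Ω Γu ∧ (∀ x ∈ Ω, cauchyGreen Ω χ x ∈ SymPos) ∧
    IntegrableOn (fun x => storedEnergy V (grad Ω χ x)) Ω}

/-- `P` is the first Piola-Kirchhoff stress `∇_F U(∇χ)` in `Ω`. -/
def IsPiolaStress (V : Tensor → ℝ) (Ω : Set E3) (χ : E3 → E3) (P : E3 → Tensor) : Prop :=
  ∀ x ∈ Ω, HasFDerivAt (storedEnergy V) (pairing (P x)) (grad Ω χ x)

/-- `χ` is a critical point of the total potential energy: its first variation
`∫_Ω ∇_F U(∇χ) : ∇v dΩ - F(v)` vanishes for every variation `v`, and `Π` has Gâteaux derivative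
zero at `χ` in the direction of every variation `v` supported in the part of the closed body where
`C(∇χ)` is nondegenerate (so that `χ + ε v` has strains in `𝕊⁺` for small `ε`). -/
structure IsCriticalPoint (V : Tensor → ℝ) (Ω Γu Γt : Set E3) (f t : E3 → E3) (χ : E3 → E3) :
    Prop where
  mem : χ ∈ KinAdmissible V Ω Γu
  firstVariation : ∃ P : E3 → Tensor, IsPiolaStress V Ω χ P ∧
    ∀ v ∈ VanishingOn Ω Γu,
      IntegrableOn (fun x => pairing (P x) (grad Ω v x)) Ω ∧
      (∫ x in Ω, pairing (P x) (grad Ω v x)) - externalEnergy Ω Γt f t v = 0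
  gateaux : ∀ v ∈ VanishingOn Ω Γu,
    (∀ x ∈ tsupport v ∩ closure Ω, cauchyGreen Ω χ x ∈ SymPos) →
      HasDerivAt (fun ε : ℝ => totalPotential V Ω Γt f t (χ + ε • v)) 0 0

/-- The balance equations `-∇·τ = f` in `Ω` and `n·τ = t` (almost everywhere) on `Γt`, for a tensor
field `τ` of class `C¹` up to the boundary: the statically admissible space. -/
def StatAdmissible (Ω Γt : Set E3) (f t : E3 → E3) : Set (E3 → Tensor) :=
  {τ | IsC1Tensor Ω τ ∧ (∀ x ∈ Ω, -div Ω τ x = f x) ∧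
    ∀ᵐ p ∂((μHE[2] : Measure E3).restrict Γt), ∃ n : E3, IsOuterNormal Ω p n ∧
      ∀ i, (∑ j, τ p i j * n j) = t p i}

/-- `χ` solves the mixed boundary-value problem `-∇·∇_F U(∇χ) = f` in `Ω`, `n·∇_F U(∇χ) = t` on
`Γt`, `χ = 0` on `Γu`, in the classical sense: the stress `∇_F U(∇χ)` extends from `Ω` to a field
of class `C¹` up to the boundary, and this field satisfies the equations. -/
def SolvesBVP (V : Tensor → ℝ) (Ω Γu Γt : Set E3) (f t : E3 → E3) (χ : E3 → E3) : Prop :=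
  χ ∈ VanishingOn Ω Γu ∧ ∃ P ∈ StatAdmissible Ω Γt f t, IsPiolaStress V Ω χ P

/-! ### The pure complementary energy -/

/-- The pure complementary energy `Πᵈ(S; τ) = -∫_Ω [¼ tr(τ S⁻¹ τᵀ) + V*(S)] dΩ`. -/
def pureComplementary (V : Tensor → ℝ) (Ω : Set E3) (S τ : E3 → Tensor) : ℝ :=
  -∫ x in Ω, ((1 / 4 : ℝ) * (τ x * (S x)⁻¹ * (τ x).transpose).trace + legendre V (S x))

/-- The domain `S_c` (for a given `τ`): fields `S`, continuous and invertible on the closed body,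
with values in the range of `∇V` and finite complementary energy, such that `det(τ S⁻¹) > 0`
in `Ω`. -/
def DualAdmissible (V : Tensor → ℝ) (Ω : Set E3) (τ : E3 → Tensor) : Set (E3 → Tensor) :=
  {S | ContinuousOn S (closure Ω) ∧ (∀ x ∈ closure Ω, (S x).det ≠ 0) ∧
    (∀ x ∈ Ω, S x ∈ dualRange V) ∧ IntegrableOn (fun x => legendre V (S x)) Ω ∧
    ∀ x ∈ Ω, 0 < (τ x * (S x)⁻¹).det}

/-- `(S, τ)` is a stationary point of `Πᵈ` over `S_c × T_c`: the Gâteaux derivative vanishes in the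
direction of all variations `(η, θ)`, where `η` is a continuous symmetric tensor field with compact
support in `Ω` and `θ` is tangent to the affine space `T_c`. -/
structure IsDualStationary (V : Tensor → ℝ) (Ω Γt : Set E3) (f t : E3 → E3) (S τ : E3 → Tensor) :
    Prop where
  mem_stat : τ ∈ StatAdmissible Ω Γt f t
  mem_dual : S ∈ DualAdmissible V Ω τ
  stationary : ∀ η : E3 → Tensor, Continuous η → HasCompactSupport η → tsupport η ⊆ Ω →
    (∀ x, (η x).IsSymm) → ∀ θ ∈ StatAdmissible Ω Γt 0 0,
      HasDerivAt (fun ε : ℝ => pureComplementary V Ω (S + ε • η) (τ + ε • θ)) 0 0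

/-! ### Line integrals -/

/-- A path in `A` from `a` to `b`, parametrized by `[0, 1]`: continuous, and differentiable with
integrable velocity off finitely many parameters (for instance piecewise `C¹`). -/
structure IsPath (A : Set E3) (a b : E3) (γ : ℝ → E3) : Prop where
  continuousOn : ContinuousOn γ (Icc 0 1)
  mapsTo : MapsTo γ (Icc 0 1) A
  differentiable : ∃ s : Set ℝ, s.Finite ∧ ∀ r ∈ Ioo (0 : ℝ) 1 \ s, DifferentiableAt ℝ γ r
  integrable : IntervalIntegrable (deriv γ) volume 0 1
  source : γ 0 = a
  target : γ 1 = b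

/-- The line integral `∫_γ G dx` of a tensor field, with components `∫ ∑ⱼ Gᵢⱼ dxⱼ`. -/
def lineIntegral (G : E3 → Tensor) (γ : ℝ → E3) : E3 :=
  WithLp.toLp 2 fun i => ∫ r in (0 : ℝ)..1, ∑ j, G (γ r) i j * deriv γ r j

end Hyperelastic

end

/-!
# The pure complementary energy principle

Put `F = ½ τ S⁻¹`. The stationarity of the complementary energy splits into two statements.

* Varying `S` gives the constitutive law: the strain `C` with `∇V(C) = S` is `Fᵀ F`
  (`IsDualStationary.strainOf_eq`). The energy is compared with the one in which the Legendre
  transform is replaced by its affine minorant at `S`; the difference has a minimum at the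
  stationary point, so only the explicit quadratic term has to be differentiated. Since `τ = 2 F S`,
  the tensor `τ` is then the Piola-Kirchhoff stress `∇U(F)`
  (`HasStrainGradient.hasFDerivAt_storedEnergy`).
* Varying `τ` gives compatibility: `F` is orthogonal to the self-equilibrated stresses
  (`IsDualStationary.integral_pairing_eq_zero`), hence each row `g` of `F` annihilates the
  divergence-free fields that vanish on `Γt`.

A continuous field `g` with this property is a gradient, which is shown without a Helmholtz
decomposition. The mollified unit current of a segment from `a` to `b` is a smooth field with
divergence `φₙ(· - a) - φₙ(· - b)`, and its pairing with `g` converges to the line integral of `g`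
along the segment. Two chains of segments with the same ends differ by a divergence-free field, so
the weak line integrals (`WeakIntegral`) depend only on the ends and define a potential in `Ω`
(`exists_isPotential`). In a Lipschitz chart two points of `Ω` are joined by going up, across and
down over a distance comparable to their own; this makes the potential differentiable up to the
boundary with gradient `g` (`IsPotential.hasFDerivWithinAt`). A chain may leave the body through
`Γu`, near whose points the test fields are unconstrained, and bumps at ends outside the closed body
do not meet `Ω`; so the potential is constant on `Γu` (`IsPotential.extendFrom_eq`), although `Γu`
need not be connected. The fundamental theorem of calculus along paths identifies the potential
with the line integral (`IsPath.integral_eq`).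

The remaining claims rest on the principle of virtual work
(`IsLipschitzDomain.integral_pairing_grad`), that is, on the Gauss theorem for a Lipschitz domain
with the Hausdorff measure on its boundary. In a chart the boundary is a Lipschitz graph; the area
formula for graphs (`comap_graphMap`) comes from a countable partition into pieces on which the
graph is nearly flat, and in flattened coordinates the tangential derivatives integrate to zero
while the vertical one is integrated by the fundamental theorem of calculus
(`setIntegral_epigraph_fderiv`). A partition of unity globalizes this
(`IsLipschitzDomain.gaussFormula`).

With `∇χ = F` the first variation of the total potential is the virtual work of `τ` minus that of
the loads, both energies equal the integral of `V(C) - 2 S : C`, and `τ` itself is the `C¹`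
extension of the stress required by the boundary-value problem. If `S` is positive definite,
convexity of `V` and the nonnegative remainder `S : (F' - F)ᵀ (F' - F)` give `U(F') ≥ U(F) + τ : (F'
- F)` (`IsStressState.le_storedEnergy`), whose integral is the minimum property.
-/

noncomputable section

namespace Hyperelastic

section

/-! ### Convex canonical functions -/

-- The entrywise maximum norm, which induces the product topology of the tensors.
attribute [local instance] Matrix.normedAddCommGroup Matrix.normedSpace

/-- The symmetric part of a tensor, as a continuous linear map. -/
def symPart : Tensor →L[ℝ] Tensor where
  toFun A := (1 / 2 : ℝ) • (A + A.transpose)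
  map_add' A B := by simp only [Matrix.transpose_add, ← smul_add]; congr 1; abel
  map_smul' c A := by
    simp only [Matrix.transpose_smul, RingHom.id_apply, ← smul_add, smul_comm c]
  cont := by fun_prop

lemma symPart_apply (A : Tensor) : symPart A = (1 / 2 : ℝ) • (A + A.transpose) := rfl

lemma symPart_isSymm (A : Tensor) : (symPart A).IsSymm := by
  rw [symPart_apply, Matrix.IsSymm]
  simp [add_comm]

lemma symPart_of_isSymm {A : Tensor} (h : A.IsSymm) : symPart A = A := by
  rw [symPart_apply, h.eq, ← two_smul ℝ A, smul_smul]; norm_num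

lemma pairing_apply (G H : Tensor) : pairing G H = ∑ i, ∑ j, G i j * H i j := by
  change (G.transpose * H).trace = _
  simp only [Matrix.trace, Matrix.diag_apply, Matrix.mul_apply, Matrix.transpose_apply]
  exact Finset.sum_comm

lemma pairing_eq_trace (G H : Tensor) : pairing G H = (G.transpose * H).trace := rfl

lemma pairing_comm (G H : Tensor) : pairing G H = pairing H G := by
  simp only [pairing_apply, mul_comm]

lemma pairing_single (G : Tensor) (i j : Fin 3) :
    pairing G (Matrix.single i j 1) = G i j := by
  rw [pairing_eq_trace, Matrix.trace_mul_single]; simp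

lemma pairing_injective : Function.Injective pairing := fun G H h => by
  ext i j
  exact (pairing_single G i j).symm.trans ((congrArg (fun p : Tensor →L[ℝ] ℝ =>
    p (Matrix.single i j 1)) h).trans (pairing_single H i j))

lemma pairing_symPart {S : Tensor} (hS : S.IsSymm) (A : Tensor) :
    pairing S (symPart A) = pairing S A := by
  have : pairing S A.transpose = pairing S A := by
    rw [pairing_eq_trace, pairing_eq_trace, ← Matrix.trace_transpose (S.transpose * A.transpose),
      Matrix.transpose_mul, Matrix.transpose_transpose, Matrix.transpose_transpose,
      Matrix.trace_mul_comm, hS.eq]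
  rw [symPart_apply, map_smul, map_add, this, smul_eq_mul]; ring

lemma isSymm_of_mem_symPos {C : Tensor} (h : C ∈ SymPos) : C.IsSymm := by
  have := h.isHermitian
  rwa [Matrix.IsHermitian, Matrix.conjTranspose_eq_transpose_of_trivial] at this

lemma isSymm_of_mem_dualRange {V : Tensor → ℝ} {S : Tensor} (h : S ∈ dualRange V) : S.IsSymm := by
  obtain ⟨C, -, h, -⟩ := h; exact h

/-- Positive definiteness is an open condition on symmetric tensors; for a general tensor it is
imposed on the symmetric part. -/
lemma isOpen_symPart_preimage : IsOpen (symPart ⁻¹' SymPos) := by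
  rw [isOpen_iff_mem_nhds]
  intro A hA
  have hK : IsCompact (Metric.sphere (0 : Fin 3 → ℝ) 1) := isCompact_sphere _ _
  have hcont : Continuous fun p : Tensor × (Fin 3 → ℝ) => p.2 ⬝ᵥ (symPart p.1).mulVec p.2 := by
    have : Continuous fun p : Tensor × (Fin 3 → ℝ) => symPart p.1 :=
      symPart.continuous.comp continuous_fst
    fun_prop
  have key : ∀ᶠ B in 𝓝 A, ∀ x ∈ Metric.sphere (0 : Fin 3 → ℝ) 1,
      0 < x ⬝ᵥ (symPart B).mulVec x := by
    refine hK.eventually_forall_of_forall_eventually fun x hx => ?_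
    refine hcont.continuousAt.eventually (lt_mem_nhds ?_)
    have hx0 : x ≠ 0 := by rintro rfl; simp at hx
    simpa using (Matrix.PosDef.dotProduct_mulVec_pos (M := symPart A) hA hx0)
  filter_upwards [key] with B hB
  refine Matrix.PosDef.of_dotProduct_mulVec_pos ?_ ?_
  · rw [Matrix.IsHermitian, Matrix.conjTranspose_eq_transpose_of_trivial]; exact symPart_isSymm B
  · intro x hx
    have hn : 0 < ‖x‖ := norm_pos_iff.2 hx
    have := hB (‖x‖⁻¹ • x) (by simp [norm_smul, hn.ne'])
    simp only [Matrix.mulVec_smul, dotProduct_smul, smul_dotProduct, smul_eq_mul] at this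
    simp only [star_trivial]
    have h2 : 0 < ‖x‖⁻¹ := inv_pos.2 hn
    exact (mul_pos_iff_of_pos_left h2).1 ((mul_pos_iff_of_pos_left h2).1 this)

lemma gram_mem_symPos {F : Tensor} (h : F.det ≠ 0) : F.transpose * F ∈ SymPos := by
  rw [← Matrix.conjTranspose_eq_transpose_of_trivial]
  exact Matrix.PosDef.conjTranspose_mul_self _
    (Matrix.mulVec_injective_iff_isUnit.2 ((Matrix.isUnit_iff_isUnit_det _).2 h.isUnit))

lemma det_ne_zero_of_gram_mem {F : Tensor} (h : F.transpose * F ∈ SymPos) : F.det ≠ 0 := by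
  have := ((Matrix.isUnit_iff_isUnit_det _).1 (Matrix.PosDef.isUnit h)).ne_zero
  rw [Matrix.det_mul] at this
  exact right_ne_zero_of_mul this

lemma convex_symPos : Convex ℝ SymPos := by
  intro A hA B hB a b ha hb hab
  rcases ha.eq_or_lt with rfl | ha
  · simpa [show b = 1 by linarith] using hB
  rcases hb.eq_or_lt with rfl | hb
  · simpa [show a = 1 by linarith] using hA
  exact (hA.smul ha).add (hB.smul hb)

variable {V : Tensor → ℝ}

/-- A function on `𝕊⁺` extends to the open set of tensors with positive definite symmetric part by
`A ↦ V (sym A)`; there the strain gradient is an ordinary derivative. -/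
lemma HasStrainGradient.hasFDerivAt_symPart {S C : Tensor} (h : HasStrainGradient V S C)
    (hC : C ∈ SymPos) : HasFDerivAt (fun A => V (symPart A)) (pairing S) C := by
  have hs : symPart C = C := symPart_of_isSymm (isSymm_of_mem_symPos hC)
  have h1 : HasFDerivWithinAt (fun A => V (symPart A)) ((pairing S).comp symPart)
      (symPart ⁻¹' SymPos) C :=
    HasFDerivWithinAt.comp (g := V) (t := SymPos) C (by rw [hs]; exact h.2)
      symPart.hasFDerivAt.hasFDerivWithinAt (mapsTo_preimage _ _)
  have h2 : (pairing S).comp symPart = pairing S := by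
    ext A; exact pairing_symPart h.1 A
  rw [h2] at h1
  exact h1.hasFDerivAt (isOpen_symPart_preimage.mem_nhds (by simpa [hs] using hC))

lemma convexOn_symPart (hV : ConvexOn ℝ SymPos V) :
    ConvexOn ℝ (symPart ⁻¹' SymPos) (fun A => V (symPart A)) :=
  hV.comp_linearMap symPart.toLinearMap

/-- The tangent plane of a convex function lies below its graph. -/
lemma HasStrainGradient.le {S C C' : Tensor} (hV : ConvexOn ℝ SymPos V)
    (h : HasStrainGradient V S C) (hC : C ∈ SymPos) (hC' : C' ∈ SymPos) :
    V C + pairing S (C' - C) ≤ V C' := by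
  have hd : HasDerivAt (fun s : ℝ => V (symPart (C + s • (C' - C)))) (pairing S (C' - C)) 0 := by
    have h1 := h.hasFDerivAt_symPart hC
    have h2 : HasDerivAt (fun s : ℝ => C + s • (C' - C)) ((1 : ℝ) • (C' - C)) 0 :=
      ((hasDerivAt_id (0 : ℝ)).smul_const (C' - C)).const_add C
    rw [one_smul] at h2
    have h3 : C + (0 : ℝ) • (C' - C) = C := by rw [zero_smul, add_zero]
    rw [← h3] at h1
    exact HasFDerivAt.comp_hasDerivAt (l := fun A => V (symPart A)) (0 : ℝ) h1 h2
  have hslope := hd.tendsto_slope_zero_right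
  have hs : symPart C = C := symPart_of_isSymm (isSymm_of_mem_symPos hC)
  have hs' : symPart C' = C' := symPart_of_isSymm (isSymm_of_mem_symPos hC')
  have : pairing S (C' - C) ≤ V C' - V C := by
    refine le_of_tendsto hslope ?_
    filter_upwards [Ioo_mem_nhdsGT (zero_lt_one (α := ℝ))] with s hs01
    have hconv := hV.2 hC hC' (sub_nonneg.2 hs01.2.le) hs01.1.le (by ring)
    have heq : C + s • (C' - C) = (1 - s) • C + s • C' := by module
    have hmem := convex_symPos hC hC' (sub_nonneg.2 hs01.2.le) hs01.1.le (by ring)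
    simp only [zero_add, zero_smul, add_zero, heq, hs,
      symPart_of_isSymm (isSymm_of_mem_symPos hmem), smul_eq_mul] at hconv ⊢
    rw [inv_mul_le_iff₀ hs01.1]
    linarith
  linarith

/-- A symmetric tensor `S` is the gradient of `V` at each minimizer of `V - S : ·` that is local
among symmetric tensors. -/
lemma hasStrainGradient_of_isLocalMin (hV : IsConvexCanonical V) {S C : Tensor} (hS : S.IsSymm)
    (hC : C ∈ SymPos)
    (hmin : ∀ᶠ A in 𝓝 C, V C - pairing S C ≤ V (symPart A) - pairing S (symPart A)) :
    HasStrainGradient V S C := by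
  obtain ⟨S', hS'⟩ := hV.differentiable C hC
  have h1 := (hS'.hasFDerivAt_symPart hC).sub (pairing S).hasFDerivAt
  have hs : symPart C = C := symPart_of_isSymm (isSymm_of_mem_symPos hC)
  have h2 : IsLocalMin ((fun A => V (symPart A)) - ⇑(pairing S)) C := by
    filter_upwards [hmin] with A hA
    simp only [Pi.sub_apply, hs]
    rwa [pairing_symPart hS] at hA
  have h3 := h2.hasFDerivAt_eq_zero h1
  rw [pairing_injective (sub_eq_zero.1 h3)] at hS'
  exact hS'

/-- Injectivity of the gradient makes the convexity strict. -/
lemma HasStrainGradient.lt (hV : IsConvexCanonical V) {S C C' : Tensor}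
    (h : HasStrainGradient V S C) (hC : C ∈ SymPos) (hC' : C' ∈ SymPos) (hne : C' ≠ C) :
    V C + pairing S (C' - C) < V C' := by
  refine lt_of_le_of_ne (h.le hV.convexOn hC hC') fun heq => hne ?_
  refine hV.injective C' hC' C hC S (hasStrainGradient_of_isLocalMin hV h.1 hC' ?_) h
  have hs' : symPart C' = C' := symPart_of_isSymm (isSymm_of_mem_symPos hC')
  filter_upwards [isOpen_symPart_preimage.mem_nhds (show C' ∈ _ by simpa [hs'] using hC')] with A hA
  have := h.le hV.convexOn hC hA
  simp only [map_sub] at this heq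
  linarith

lemma IsConvexCanonical.continuousOn (hV : IsConvexCanonical V) : ContinuousOn V SymPos := by
  intro C hC
  obtain ⟨S, hS⟩ := hV.differentiable C hC
  exact hS.2.continuousWithinAt

lemma strainOf_spec {S : Tensor} (hS : S ∈ dualRange V) :
    strainOf V S ∈ SymPos ∧ HasStrainGradient V S (strainOf V S) :=
  Classical.epsilon_spec (p := fun C => C ∈ SymPos ∧ HasStrainGradient V S C) hS

lemma strainOf_eq (hV : IsConvexCanonical V) {S C : Tensor} (hC : C ∈ SymPos)
    (h : HasStrainGradient V S C) : strainOf V S = C :=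
  have := strainOf_spec ⟨C, hC, h⟩
  hV.injective _ this.1 _ hC S this.2 h

/-- The Fenchel inequality. -/
lemma le_legendre (hV : IsConvexCanonical V) {S C : Tensor} (hS : S ∈ dualRange V)
    (hC : C ∈ SymPos) : pairing S C - V C ≤ legendre V S := by
  obtain ⟨h1, h2⟩ := strainOf_spec hS
  have := h2.le hV.convexOn h1 hC
  simp only [map_sub] at this
  rw [legendre]
  linarith

/-- The duality mapping is open: a symmetric tensor near `∇V(C)` is the gradient of `V` at a strain
near `C`. By strict convexity `V - S : ·` is larger on a small sphere about `C` than at its centre,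
so its minimum over the ball is a critical point. -/
lemma eventually_exists_hasStrainGradient (hV : IsConvexCanonical V) {S₀ C₀ : Tensor}
    (hC₀ : C₀ ∈ SymPos) (h₀ : HasStrainGradient V S₀ C₀) {N : Set Tensor} (hN : N ∈ 𝓝 C₀) :
    ∀ᶠ S in 𝓝 S₀, S.IsSymm → ∃ C ∈ SymPos ∩ N, HasStrainGradient V S C := by
  have hs₀ : symPart C₀ = C₀ := symPart_of_isSymm (isSymm_of_mem_symPos hC₀)
  have hD : symPart ⁻¹' SymPos ∈ 𝓝 C₀ :=
    isOpen_symPart_preimage.mem_nhds (by simpa [hs₀] using hC₀)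
  obtain ⟨r, hr, hball⟩ := Metric.nhds_basis_closedBall.mem_iff.1 (inter_mem hD hN)
  have hclosed : IsClosed {C : Tensor | C.IsSymm} :=
    isClosed_eq (by fun_prop) continuous_id
  have hB : IsCompact (Metric.closedBall C₀ r ∩ {C : Tensor | C.IsSymm}) :=
    (isCompact_closedBall C₀ r).inter_right hclosed
  have hQ : IsCompact (Metric.sphere C₀ r ∩ {C : Tensor | C.IsSymm}) :=
    (isCompact_sphere C₀ r).inter_right hclosed
  have hsub : Metric.closedBall C₀ r ∩ {C : Tensor | C.IsSymm} ⊆ SymPos := fun C hC => by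
    have := (hball hC.1).1
    rwa [mem_preimage, symPart_of_isSymm hC.2] at this
  have hpc : Continuous fun p : Tensor × Tensor => pairing p.1 p.2 := by
    simp only [pairing_apply]; fun_prop
  have key : ∀ᶠ S in 𝓝 S₀, ∀ C ∈ Metric.sphere C₀ r ∩ {C : Tensor | C.IsSymm},
      0 < V (symPart C) - V C₀ - pairing S (C - C₀) := by
    refine hQ.eventually_forall_of_forall_eventually fun C hC => ?_
    have hCB : C ∈ Metric.closedBall C₀ r ∩ {C : Tensor | C.IsSymm} :=
      ⟨Metric.sphere_subset_closedBall hC.1, hC.2⟩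
    have hCpos := hsub hCB
    have hcont : ContinuousAt
        (fun p : Tensor × Tensor => V (symPart p.2) - V C₀ - pairing p.1 (p.2 - C₀)) (S₀, C) := by
      have h1 : ContinuousAt (fun A => V (symPart A)) C := by
        obtain ⟨S', hS'⟩ := hV.differentiable C hCpos
        exact (hS'.hasFDerivAt_symPart hCpos).continuousAt
      have h2 : ContinuousAt (fun p : Tensor × Tensor => V (symPart p.2)) (S₀, C) :=
        ContinuousAt.comp (f := Prod.snd) (x := (S₀, C)) h1 continuousAt_snd
      have h3 : Continuous (fun p : Tensor × Tensor => pairing p.1 (p.2 - C₀)) :=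
        hpc.comp (continuous_fst.prodMk (continuous_snd.sub continuous_const))
      exact (h2.sub continuousAt_const).sub h3.continuousAt
    refine hcont.eventually (lt_mem_nhds ?_)
    have hne : C ≠ C₀ := by
      rintro rfl
      have := hC.1
      simp at this
      exact hr.ne this
    have := h₀.lt hV hC₀ hCpos hne
    simp only [symPart_of_isSymm hC.2]
    linarith
  filter_upwards [key] with S hS hSsymm
  have hcontB : ContinuousOn (fun C => V C - pairing S C)
      (Metric.closedBall C₀ r ∩ {C : Tensor | C.IsSymm}) :=
    (hV.continuousOn.mono hsub).sub (pairing S).continuous.continuousOn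
  have hC₀B : C₀ ∈ Metric.closedBall C₀ r ∩ {C : Tensor | C.IsSymm} :=
    ⟨Metric.mem_closedBall_self hr.le, isSymm_of_mem_symPos hC₀⟩
  obtain ⟨C, hCB, hmin⟩ := hB.exists_isMinOn ⟨C₀, hC₀B⟩ hcontB
  have hCpos := hsub hCB
  have hsC : symPart C = C := symPart_of_isSymm hCB.2
  have hlt : dist C C₀ < r := by
    refine lt_of_le_of_ne hCB.1 fun heq => ?_
    have h1 := hS C ⟨heq, hCB.2⟩
    have h2 := hmin hC₀B
    rw [mem_ofPred_eq] at h2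
    rw [hsC, map_sub] at h1
    linarith
  refine ⟨C, ⟨hCpos, (hball hCB.1).2⟩, hasStrainGradient_of_isLocalMin hV hSsymm hCpos ?_⟩
  have : ∀ᶠ A in 𝓝 C, symPart A ∈ Metric.ball C₀ r :=
    symPart.continuous.continuousAt.eventually
      (Metric.isOpen_ball.mem_nhds (by rw [hsC]; exact hlt))
  filter_upwards [this] with A hA
  exact hmin ⟨Metric.ball_subset_closedBall hA, symPart_isSymm A⟩

lemma eventually_mem_dualRange (hV : IsConvexCanonical V) {S₀ : Tensor} (h : S₀ ∈ dualRange V) :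
    ∀ᶠ S in 𝓝 S₀, S.IsSymm → S ∈ dualRange V := by
  obtain ⟨C₀, hC₀, h₀⟩ := h
  filter_upwards [eventually_exists_hasStrainGradient hV hC₀ h₀ univ_mem] with S hS hsymm
  obtain ⟨C, hC, h⟩ := hS hsymm
  exact ⟨C, hC.1, h⟩

lemma continuousOn_strainOf (hV : IsConvexCanonical V) :
    ContinuousOn (strainOf V) (dualRange V) := by
  intro S₀ hS₀ N hN
  obtain ⟨h1, h2⟩ := strainOf_spec hS₀
  have := eventually_exists_hasStrainGradient hV h1 h2 hN
  rw [mem_map, mem_nhdsWithin_iff_eventually]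
  filter_upwards [this] with S hS hmem
  obtain ⟨C, hC, h⟩ := hS (isSymm_of_mem_dualRange hmem)
  rw [mem_preimage, strainOf_eq hV hC.1 h]
  exact hC.2

lemma continuousOn_legendre (hV : IsConvexCanonical V) :
    ContinuousOn (legendre V) (dualRange V) := by
  have h1 := continuousOn_strainOf hV
  have h2 : ContinuousOn (fun S => V (strainOf V S)) (dualRange V) :=
    hV.continuousOn.comp h1 fun S hS => (strainOf_spec hS).1
  have h3 : Continuous fun p : Tensor × Tensor => pairing p.1 p.2 := by
    simp only [pairing_apply]; fun_prop
  exact (h3.comp_continuousOn (continuousOn_id.prodMk h1)).sub h2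

/-- The stress-strain law: `∇_F U(F) = 2 F ∇V(FᵀF)`. -/
lemma HasStrainGradient.hasFDerivAt_storedEnergy {S F : Tensor}
    (h : HasStrainGradient V S (F.transpose * F)) (hF : F.transpose * F ∈ SymPos) :
    HasFDerivAt (storedEnergy V) (pairing ((2 : ℝ) • (F * S))) F := by
  let T : Tensor →L[ℝ] Tensor :=
    ⟨⟨⟨fun H => H.transpose * F + F.transpose * H, fun A B => by
      simp only [Matrix.transpose_add, Matrix.add_mul, Matrix.mul_add]; abel⟩, fun c A => by
      simp [smul_add]⟩, by simp; fun_prop⟩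
  have h1 : HasFDerivAt (fun F : Tensor => F.transpose * F) T F := by
    refine HasFDerivAt.of_isLittleO ?_
    have : (fun x' : Tensor => x'.transpose * x' - F.transpose * F - T (x' - F)) =
        fun x' => (x' - F).transpose * (x' - F) := by
      funext X
      change X.transpose * X - F.transpose * F -
        ((X - F).transpose * F + F.transpose * (X - F)) = _
      simp only [Matrix.transpose_sub, Matrix.sub_mul, Matrix.mul_sub]
      abel
    refine Asymptotics.IsLittleO.congr_left (f₁ := fun x' : Tensor =>
      (x' - F).transpose * (x' - F)) ?_ (fun X => (congrFun this X).symm)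
    have hO : (fun x' : Tensor => (x' - F).transpose * (x' - F)) =O[𝓝 F]
        fun x' => ‖x' - F‖ ^ 2 := by
      refine Asymptotics.IsBigO.of_bound 3 (Eventually.of_forall fun X => ?_)
      rw [Matrix.norm_le_iff (by positivity)]
      intro i j
      rw [Matrix.mul_apply]
      refine (norm_sum_le _ _).trans ?_
      refine (Finset.sum_le_card_nsmul _ _ (‖X - F‖ ^ 2) fun k _ => ?_).trans (by simp)
      rw [norm_mul, pow_two, Matrix.transpose_apply]
      gcongr <;> exact Matrix.norm_entry_le_entrywise_sup_norm _
    refine hO.trans_isLittleO ?_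
    exact Asymptotics.isLittleO_pow_sub_sub F (by norm_num)
  have h2 := HasFDerivAt.comp (g := fun A => V (symPart A)) (f := fun F : Tensor => F.transpose * F)
    F (h.hasFDerivAt_symPart hF) h1
  have h3 : (fun A => V (symPart A)) ∘ (fun F : Tensor => F.transpose * F) = storedEnergy V := by
    funext A
    rw [Function.comp_apply, storedEnergy, symPart_of_isSymm]
    simp [Matrix.IsSymm, Matrix.transpose_mul]
  have h4 : (pairing S).comp T = pairing ((2 : ℝ) • (F * S)) := by
    ext H
    change pairing S (H.transpose * F + F.transpose * H) = _
    have e1 : pairing S (H.transpose * F) = (S * F.transpose * H).trace := by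
      rw [pairing_eq_trace, h.1.eq, ← Matrix.trace_transpose]
      simp only [Matrix.transpose_mul, Matrix.transpose_transpose, h.1.eq]
      rw [Matrix.trace_mul_comm, Matrix.mul_assoc]
    have e2 : pairing S (F.transpose * H) = (S * F.transpose * H).trace := by
      rw [pairing_eq_trace, h.1.eq, Matrix.mul_assoc]
    rw [map_add, e1, e2, pairing_eq_trace]
    simp only [Matrix.transpose_smul, Matrix.transpose_mul, h.1.eq, Matrix.smul_mul,
      Matrix.trace_smul, smul_eq_mul]
    ring
  rw [h3] at h2
  exact h4 ▸ h2

/-- The gradient of `V` is bounded on compact sets of strains, because a convex function is locally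
Lipschitz. -/
lemma exists_bound_strainGradient (hV : IsConvexCanonical V) {K : Set Tensor} (hK : IsCompact K)
    (hKV : K ⊆ SymPos) :
    ∃ B : ℝ, ∀ C ∈ K, ∀ S, HasStrainGradient V S C → ∀ i j, |S i j| ≤ B := by
  refine hK.induction_on (p := fun K => ∃ B : ℝ, ∀ C ∈ K, C ∈ SymPos → ∀ S,
    HasStrainGradient V S C → ∀ i j, |S i j| ≤ B) ⟨0, by simp⟩ ?_ ?_ ?_ |>.imp
      fun B hB C hC S hS => hB C hC (hKV hC) S hS
  · rintro s t hst ⟨B, hB⟩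
    exact ⟨B, fun C hC => hB C (hst hC)⟩
  · rintro s t ⟨B, hB⟩ ⟨B', hB'⟩
    refine ⟨max B B', fun C hC hp S hS i j => ?_⟩
    rcases hC with hC | hC
    · exact (hB C hC hp S hS i j).trans (le_max_left _ _)
    · exact (hB' C hC hp S hS i j).trans (le_max_right _ _)
  · intro C hC
    have hs : symPart C = C := symPart_of_isSymm (isSymm_of_mem_symPos (hKV hC))
    have hCmem : C ∈ symPart ⁻¹' SymPos := by simpa [hs] using hKV hC
    obtain ⟨L, t, ht, hL⟩ := (convexOn_symPart hV.convexOn).locallyLipschitzOn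
      isOpen_symPart_preimage hCmem
    have ht2 : t ∈ 𝓝 C := by
      obtain ⟨u, hu, hut⟩ := mem_nhdsWithin_iff_exists_mem_nhds_inter.1 ht
      exact mem_of_superset (inter_mem hu (isOpen_symPart_preimage.mem_nhds hCmem)) hut
    obtain ⟨t', ht't, ht'o, hCt'⟩ := mem_nhds_iff.1 ht2
    refine ⟨t', mem_nhdsWithin_of_mem_nhds (ht'o.mem_nhds hCt'),
      L * 1, fun C' hC' hp S hS i j => ?_⟩
    have h1 := (hS.hasFDerivAt_symPart hp).le_of_lipschitzOn
      (mem_of_superset (ht'o.mem_nhds hC') ht't) hL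
    rw [← pairing_single S i j]
    refine ((pairing S).le_opNorm _).trans ?_
    have hn : ‖(Matrix.single i j 1 : Tensor)‖ ≤ 1 := by
      rw [Matrix.norm_le_iff zero_le_one]
      intro a b
      rw [Matrix.single_apply]; split_ifs <;> simp
    gcongr

end

section

/-! ### Cartesian frames and Lipschitz charts -/

/-- The Euclidean plane. -/
abbrev E2 := EuclideanSpace ℝ (Fin 2)

/-- The first two coordinates of a point in the Cartesian frame `R`. -/
def hor (R : E3 ≃ₗᵢ[ℝ] E3) : E3 →L[ℝ] E2 :=
  LinearMap.toContinuousLinearMap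
    { toFun := fun x => !₂[R x 0, R x 1]
      map_add' := fun x y => by ext i; fin_cases i <;> simp
      map_smul' := fun c x => by ext i; fin_cases i <;> simp }

/-- The third coordinate of a point in the Cartesian frame `R`. -/
def ver (R : E3 ≃ₗᵢ[ℝ] E3) : E3 →L[ℝ] ℝ :=
  LinearMap.toContinuousLinearMap
    { toFun := fun x => R x 2
      map_add' := fun x y => by simp
      map_smul' := fun c x => by simp }

/-- The point with given coordinates in the Cartesian frame `R`. -/
def pt (R : E3 ≃ₗᵢ[ℝ] E3) : E2 × ℝ →L[ℝ] E3 :=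
  LinearMap.toContinuousLinearMap
    { toFun := fun z => R.symm !₂[z.1 0, z.1 1, z.2]
      map_add' := fun x y => by
        rw [← map_add]; congr 1; ext i; fin_cases i <;> simp
      map_smul' := fun c x => by
        rw [← map_smul]; congr 1; ext i; fin_cases i <;> simp }

variable (R : E3 ≃ₗᵢ[ℝ] E3)

lemma hor_apply (x : E3) : hor R x = !₂[R x 0, R x 1] := rfl
lemma ver_apply (x : E3) : ver R x = R x 2 := rfl
lemma pt_apply (z : E2 × ℝ) : pt R z = R.symm !₂[z.1 0, z.1 1, z.2] := rfl

@[simp] lemma hor_pt (z : E2 × ℝ) : hor R (pt R z) = z.1 := by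
  rw [hor_apply, pt_apply]; ext i; fin_cases i <;> simp

@[simp] lemma ver_pt (z : E2 × ℝ) : ver R (pt R z) = z.2 := by
  rw [ver_apply, pt_apply]; simp

@[simp] lemma pt_hor_ver (x : E3) : pt R (hor R x, ver R x) = x := by
  rw [pt_apply, LinearIsometryEquiv.symm_apply_eq]
  ext i; fin_cases i <;> simp [hor_apply, ver_apply]

lemma norm_sq_eq_hor_ver (x : E3) : ‖x‖ ^ 2 = ‖hor R x‖ ^ 2 + (ver R x) ^ 2 := by
  rw [← R.norm_map x, EuclideanSpace.norm_sq_eq, EuclideanSpace.norm_sq_eq]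
  simp [Fin.sum_univ_three, hor_apply, ver_apply]

lemma norm_hor_le (x : E3) : ‖hor R x‖ ≤ ‖x‖ :=
  (sq_le_sq₀ (norm_nonneg _) (norm_nonneg _)).1 (by
    rw [norm_sq_eq_hor_ver R x]; nlinarith [sq_nonneg (ver R x)])

lemma norm_pt_zero (s : ℝ) : ‖pt R (0, s)‖ = |s| := by
  have := norm_sq_eq_hor_ver R (pt R (0, s))
  simp only [hor_pt, ver_pt, norm_zero] at this
  rw [← abs_of_nonneg (norm_nonneg (pt R (0, s)))]
  exact (sq_eq_sq_iff_abs_eq_abs _ _).1 (by linarith)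

lemma inner_eq_hor_ver (x y : E3) :
    inner ℝ x y = inner ℝ (hor R x) (hor R y) + ver R x * ver R y := by
  rw [← R.inner_map_map x y]
  simp only [PiLp.inner_apply, Fin.sum_univ_three, Fin.sum_univ_two, hor_apply, ver_apply]
  simp [mul_comm]

lemma measurePreserving_pt : MeasurePreserving (pt R) (volume.prod volume) volume := by
  let e3 : E3 ≃ᵐ (Fin 3 → ℝ) := MeasurableEquiv.toLp 2 (Fin 3 → ℝ) |>.symm
  have h1 : MeasurePreserving (fun z : E2 × ℝ => (WithLp.ofLp z.1, z.2))
      (volume.prod volume) (volume.prod volume) :=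
    (EuclideanSpace.volume_preserving_symm_measurableEquiv_toLp (Fin 2)).prod
      (MeasurePreserving.id volume)
  have h2 := (volume_preserving_piFinSuccAbove (fun _ : Fin 3 => ℝ) 2).symm
  have h3 : MeasurePreserving (Prod.swap : (Fin 2 → ℝ) × ℝ → ℝ × (Fin 2 → ℝ))
      (volume.prod volume) (volume.prod volume) := Measure.measurePreserving_swap
  have h4 := (EuclideanSpace.volume_preserving_symm_measurableEquiv_toLp (Fin 3)).symm
  have h5 := R.symm.measurePreserving
  have h := h5.comp (h4.comp (h2.comp (h3.comp h1)))
  refine (congrArg (fun f : E2 × ℝ → E3 => MeasurePreserving f (volume.prod volume) volume)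
    (funext fun z => ?_)).mp h
  rw [pt_apply]
  simp only [Function.comp_apply]
  congr 1
  ext i
  fin_cases i <;> simp [MeasurableEquiv.piFinSuccAbove, Fin.insertNthEquiv] <;> rfl

variable {R}

/-- The open cone condition of a Lipschitz epigraph. -/
lemma lt_ver_add {K : NNReal} {φ : E2 → ℝ} (hφ : LipschitzWith K φ) {x z : E3}
    (hx : φ (hor R x) ≤ ver R x) (hz : K * ‖hor R z‖ < ver R z) :
    φ (hor R (x + z)) < ver R (x + z) := by
  have := (le_abs_self _).trans (hφ.dist_le_mul (hor R (x + z)) (hor R x))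
  rw [dist_eq_norm, map_add, add_sub_cancel_left] at this
  rw [map_add, map_add]
  linarith

lemma lt_ver_add_pt {K : NNReal} {φ : E2 → ℝ} (hφ : LipschitzWith K φ) {x : E3}
    (hx : φ (hor R x) ≤ ver R x) {s : ℝ} (hs : 0 < s) :
    φ (hor R (x + pt R (0, s))) < ver R (x + pt R (0, s)) :=
  lt_ver_add hφ hx (by simpa using hs)

variable {Ω : Set E3}

/-- `R`, `φ` is a chart of `Ω` in the ball of radius `r` about `p`: there `Ω` is the strict
epigraph of the Lipschitz function `φ` in the frame `R`, its closure is the epigraph and its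
frontier the graph. -/
structure IsChart (Ω : Set E3) (p : E3) (R : E3 ≃ₗᵢ[ℝ] E3) (K : NNReal) (φ : E2 → ℝ) (r : ℝ) :
    Prop where
  lipschitz : LipschitzWith K φ
  pos : 0 < r
  mem_iff : ∀ x ∈ Metric.ball p r, (x ∈ Ω ↔ φ (hor R x) < ver R x)
  mem_closure_iff : ∀ x ∈ Metric.ball p r, (x ∈ closure Ω ↔ φ (hor R x) ≤ ver R x)
  mem_frontier_iff : ∀ x ∈ Metric.ball p r, (x ∈ frontier Ω ↔ φ (hor R x) = ver R x)

lemma IsLipschitzDomain.exists_chart (hΩ : IsLipschitzDomain Ω) {p : E3} (hp : p ∈ frontier Ω) :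
    ∃ R K φ r, IsChart Ω p R K φ r := by
  obtain ⟨R, K, φ, hφ, hev⟩ := hΩ.locally_epigraph p hp
  obtain ⟨r, hr, hball⟩ := Metric.eventually_nhds_iff_ball.1 hev
  have hcl : ∀ x ∈ Metric.ball p r, (x ∈ closure Ω ↔ φ (hor R x) ≤ ver R x) := by
    intro x hx
    constructor
    · intro hxc
      have : x ∈ closure {x | φ (hor R x) ≤ ver R x} := by
        rw [mem_closure_iff_nhds] at hxc ⊢
        intro t ht
        obtain ⟨y, ⟨hy1, hy2⟩, hy3⟩ := hxc _ (inter_mem ht (Metric.isOpen_ball.mem_nhds hx))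
        exact ⟨y, hy1, ((hball y hy2).1 hy3).le⟩
      rwa [IsClosed.closure_eq] at this
      exact isClosed_le (hφ.continuous.comp (hor R).continuous) (ver R).continuous
    · intro hle
      have ht : Tendsto (fun s : ℝ => x + pt R (0, s)) (𝓝[>] 0) (𝓝 x) := by
        have : Continuous fun s : ℝ => x + pt R (0, s) := by fun_prop
        have h0 := this.tendsto 0
        rw [show ((0 : E2), (0 : ℝ)) = 0 from rfl, map_zero, add_zero] at h0
        exact h0.mono_left nhdsWithin_le_nhds
      refine mem_closure_of_tendsto ht ?_
      filter_upwards [ht.eventually (Metric.isOpen_ball.mem_nhds hx), self_mem_nhdsWithin]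
        with s hs hs0
      exact (hball _ hs).2 (lt_ver_add_pt hφ hle hs0)
  refine ⟨R, K, φ, r, hφ, hr, fun x hx => hball x hx, hcl, fun x hx => ?_⟩
  rw [hΩ.isOpen.frontier_eq, Set.mem_sdiff, hcl x hx, hball x hx]
  change _ ∧ ¬ (φ (hor R x) < ver R x) ↔ _
  rw [not_lt]
  exact ⟨fun h => le_antisymm h.1 h.2, fun h => ⟨h.le, h.ge⟩⟩

lemma IsLipschitzDomain.uniqueDiffOn_closure (hΩ : IsLipschitzDomain Ω) :
    UniqueDiffOn ℝ (closure Ω) := by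
  intro p hp
  by_cases hpΩ : p ∈ Ω
  · exact uniqueDiffWithinAt_of_mem_nhds (mem_of_superset (hΩ.isOpen.mem_nhds hpΩ) subset_closure)
  have hpf : p ∈ frontier Ω := by rw [hΩ.isOpen.frontier_eq]; exact ⟨hp, hpΩ⟩
  obtain ⟨R, K, φ, r, hc⟩ := hΩ.exists_chart hpf
  have hpb : p ∈ Metric.ball p r := Metric.mem_ball_self hc.pos
  have hple := (hc.mem_closure_iff p hpb).1 hp
  have hconv : Convex ℝ {x : E3 | K * ‖hor R (x - p)‖ - ver R (x - p) < 0} := by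
    have h1 : ConvexOn ℝ univ fun x : E3 => K * ‖hor R (x - p)‖ - ver R (x - p) := by
      refine ⟨convex_univ, fun x _ y _ a b ha hb hab => ?_⟩
      have e : a • x + b • y - p = a • (x - p) + b • (y - p) := by
        have : p = a • p + b • p := by rw [← add_smul, hab, one_smul]
        nth_rewrite 1 [this]
        module
      have h2 := norm_add_le (a • hor R (x - p)) (b • hor R (y - p))
      rw [norm_smul, norm_smul, Real.norm_of_nonneg ha, Real.norm_of_nonneg hb] at h2
      have h3 := mul_le_mul_of_nonneg_left h2 K.coe_nonneg
      simp only [e]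
      rw [map_add, map_add, map_smul, map_smul, map_smul, map_smul]
      simp only [smul_eq_mul]
      linarith
    simpa using h1.convex_lt 0
  have hopen : IsOpen {x : E3 | K * ‖hor R (x - p)‖ - ver R (x - p) < 0} :=
    isOpen_lt (by fun_prop) continuous_const
  have hmem : ∀ s : ℝ, 0 < s → p + pt R (0, s) ∈
      {x : E3 | K * ‖hor R (x - p)‖ - ver R (x - p) < 0} := fun s hs => by simpa using hs
  have ht : Tendsto (fun s : ℝ => p + pt R (0, s)) (𝓝[>] 0) (𝓝 p) := by
    have : Continuous fun s : ℝ => p + pt R (0, s) := by fun_prop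
    have h0 := this.tendsto 0
    rw [show ((0 : E2), (0 : ℝ)) = 0 from rfl, map_zero, add_zero] at h0
    exact h0.mono_left nhdsWithin_le_nhds
  have hev : ∀ᶠ s in 𝓝[>] (0 : ℝ), p + pt R (0, s) ∈
      {x : E3 | K * ‖hor R (x - p)‖ - ver R (x - p) < 0} ∩ Metric.ball p r := by
    filter_upwards [ht.eventually (Metric.isOpen_ball.mem_nhds hpb), self_mem_nhdsWithin]
      with s hs hs0
    exact ⟨hmem s hs0, hs⟩
  refine (uniqueDiffWithinAt_convex (hconv.inter (convex_ball p r)) ?_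
    (mem_closure_of_tendsto ht hev)).mono ?_
  · rw [(hopen.inter Metric.isOpen_ball).interior_eq]
    obtain ⟨s, hs⟩ := hev.exists
    exact ⟨_, hs⟩
  · rintro x ⟨hx1, hx2⟩
    rw [hc.mem_closure_iff x hx2]
    have : φ (hor R (p + (x - p))) < ver R (p + (x - p)) :=
      lt_ver_add hc.lipschitz hple (by simpa using hx1)
    rw [add_sub_cancel] at this
    exact this.le

lemma IsLipschitzDomain.isCompact_closure (hΩ : IsLipschitzDomain Ω) : IsCompact (closure Ω) :=
  hΩ.isBounded.isCompact_closure

/-! ### Fields of class `C¹` up to the boundary -/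

lemma IsLipschitzDomain.continuousOn_partialD (hΩ : IsLipschitzDomain Ω) {u : E3 → ℝ}
    (hu : ContDiffOn ℝ 1 u (closure Ω)) (j : Fin 3) :
    ContinuousOn (partialD Ω u j) (closure Ω) :=
  (hu.continuousOn_fderivWithin hΩ.uniqueDiffOn_closure le_rfl).clm_apply continuousOn_const

lemma contDiffOn_apply {χ : E3 → E3} {s : Set E3} (h : ContDiffOn ℝ 1 χ s) (i : Fin 3) :
    ContDiffOn ℝ 1 (fun y => χ y i) s := by
  have := contDiffOn_euclidean.1 h i
  exact this

lemma IsLipschitzDomain.continuousOn_grad (hΩ : IsLipschitzDomain Ω) {χ : E3 → E3}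
    (hχ : ContDiffOn ℝ 1 χ (closure Ω)) : ContinuousOn (grad Ω χ) (closure Ω) := by
  refine continuousOn_pi.2 fun i => continuousOn_pi.2 fun j => ?_
  exact hΩ.continuousOn_partialD (contDiffOn_apply hχ i) j

lemma fderivWithin_closure_eq (hΩ : IsOpen Ω) (u : E3 → ℝ) {x : E3} (hx : x ∈ Ω) :
    fderivWithin ℝ u (closure Ω) x = fderiv ℝ u x :=
  fderivWithin_of_mem_nhds (mem_of_superset (hΩ.mem_nhds hx) subset_closure)

lemma partialD_eq_fderiv (hΩ : IsOpen Ω) (u : E3 → ℝ) (j : Fin 3) {x : E3} (hx : x ∈ Ω) :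
    partialD Ω u j x = fderiv ℝ u x (EuclideanSpace.single j 1) := by
  rw [partialD, fderivWithin_closure_eq hΩ u hx]

lemma IsLipschitzDomain.partialD_eq (hΩ : IsLipschitzDomain Ω) {u : E3 → ℝ} {u' : E3 →L[ℝ] ℝ}
    {x : E3} (hx : x ∈ closure Ω) (h : HasFDerivWithinAt u u' (closure Ω) x) (j : Fin 3) :
    partialD Ω u j x = u' (EuclideanSpace.single j 1) := by
  rw [partialD, h.fderivWithin (hΩ.uniqueDiffOn_closure x hx)]

lemma differentiableWithinAt_of_contDiffOn {u : E3 → ℝ} (hu : ContDiffOn ℝ 1 u (closure Ω)) {x : E3}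
    (hx : x ∈ closure Ω) : DifferentiableWithinAt ℝ u (closure Ω) x :=
  hu.differentiableOn one_ne_zero x hx

lemma IsLipschitzDomain.grad_add_smul (hΩ : IsLipschitzDomain Ω) {χ v : E3 → E3}
    (hχ : ContDiffOn ℝ 1 χ (closure Ω)) (hv : ContDiffOn ℝ 1 v (closure Ω)) (c : ℝ) {x : E3}
    (hx : x ∈ closure Ω) : grad Ω (χ + c • v) x = grad Ω χ x + c • grad Ω v x := by
  ext i j
  have h1 := (differentiableWithinAt_of_contDiffOn (contDiffOn_apply hχ i) hx).hasFDerivWithinAt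
  have h2 := (differentiableWithinAt_of_contDiffOn (contDiffOn_apply hv i) hx).hasFDerivWithinAt
  have h3 := hΩ.partialD_eq hx (h1.add (h2.const_smul c)) j
  simp only [Matrix.add_apply, Matrix.smul_apply]
  exact h3

/-- Continuous functions on the closed body are integrable on the body. -/
lemma IsLipschitzDomain.integrableOn (hΩ : IsLipschitzDomain Ω) {u : E3 → ℝ}
    (hu : ContinuousOn u (closure Ω)) : IntegrableOn u Ω :=
  (hu.integrableOn_compact hΩ.isCompact_closure).mono_set subset_closure

end

section

/-! ### Continuity of tensor operations and integrals with a parameter -/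

lemma continuousOn_inv {X : Type*} [TopologicalSpace X] {s : Set X} {A : X → Tensor}
    (hA : ContinuousOn A s) (hdet : ∀ x ∈ s, (A x).det ≠ 0) :
    ContinuousOn (fun x => (A x)⁻¹) s := by
  simp only [Matrix.inv_def, Ring.inverse_eq_inv']
  have h1 : Continuous fun M : Tensor => M.det := continuous_id.matrix_det
  have h2 : Continuous fun M : Tensor => M.adjugate := continuous_id.matrix_adjugate
  exact ((h1.comp_continuousOn hA).inv₀ hdet).smul (h2.comp_continuousOn hA)

lemma continuousOn_mul {X : Type*} [TopologicalSpace X] {s : Set X} {A B : X → Tensor}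
    (hA : ContinuousOn A s) (hB : ContinuousOn B s) : ContinuousOn (fun x => A x * B x) s := by
  have : Continuous fun p : Tensor × Tensor => p.1 * p.2 := by fun_prop
  exact this.comp_continuousOn (hA.prodMk hB)

lemma continuousOn_pairing {X : Type*} [TopologicalSpace X] {s : Set X} {A B : X → Tensor}
    (hA : ContinuousOn A s) (hB : ContinuousOn B s) :
    ContinuousOn (fun x => pairing (A x) (B x)) s := by
  have : Continuous fun p : Tensor × Tensor => pairing p.1 p.2 := by
    simp only [pairing_apply]; fun_prop
  exact Continuous.comp_continuousOn (g := fun p : Tensor × Tensor => pairing p.1 p.2)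
    (f := fun x => (A x, B x)) this (hA.prodMk hB)

lemma continuousOn_trace_conj {X : Type*} [TopologicalSpace X] {s : Set X} {A B C : X → Tensor}
    (hA : ContinuousOn A s) (hB : ContinuousOn B s) (hC : ContinuousOn C s) :
    ContinuousOn (fun x => (A x * B x * (C x).transpose).trace) s := by
  have : Continuous fun p : Tensor × Tensor × Tensor =>
      (p.1 * p.2.1 * p.2.2.transpose).trace := by fun_prop
  exact Continuous.comp_continuousOn (g := fun p : Tensor × Tensor × Tensor =>
      (p.1 * p.2.1 * p.2.2.transpose).trace) (f := fun x => (A x, B x, C x)) this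
    (hA.prodMk (hB.prodMk hC))

lemma IsC1Tensor.continuousOn {Ω : Set E3} {τ : E3 → Tensor} (h : IsC1Tensor Ω τ) :
    ContinuousOn τ (closure Ω) :=
  continuousOn_pi.2 fun i => continuousOn_pi.2 fun j => (h i j).continuousOn

lemma eventually_forall_mem_of_continuousOn {X : Type*} [TopologicalSpace X] {K : Set E3}
    (hK : IsCompact K) {A B : E3 → Tensor} (hA : ContinuousOn A K) (hB : ContinuousOn B K)
    {g : Tensor → X} (hg : Continuous g) {U : Set X}
    (h : ∀ x ∈ K, U ∈ 𝓝 (g (A x))) :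
    ∀ᶠ ε in 𝓝 (0 : ℝ), ∀ x ∈ K, g (A x + ε • B x) ∈ U := by
  have : CompactSpace K := isCompact_iff_compactSpace.1 hK
  have : ∀ᶠ ε in 𝓝 (0 : ℝ), ∀ x ∈ (univ : Set K), g (A x + ε • B x) ∈ U := by
    refine isCompact_univ.eventually_forall_of_forall_eventually fun x _ => ?_
    have hc : Continuous fun p : ℝ × K => g (A p.2 + p.1 • B p.2) := by
      have h1 : Continuous fun x : K => A x := continuousOn_iff_continuous_domRestrict.1 hA
      have h2 : Continuous fun x : K => B x := continuousOn_iff_continuous_domRestrict.1 hB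
      exact hg.comp ((h1.comp continuous_snd).add (continuous_fst.smul (h2.comp continuous_snd)))
    refine hc.continuousAt.eventually ?_
    simpa using h x x.2
  filter_upwards [this] with ε hε x hx
  exact hε ⟨x, hx⟩ trivial

/-- Differentiation under the integral sign over a bounded domain. -/
lemma IsLipschitzDomain.hasDerivAt_integral {Ω : Set E3} (hΩ : IsLipschitzDomain Ω)
    {F F' : ℝ → E3 → ℝ} {δ B : ℝ} (hδ : 0 < δ)
    (hF : ∀ ε ∈ Metric.ball (0 : ℝ) δ, AEStronglyMeasurable (F ε) (volume.restrict Ω))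
    (hF0 : IntegrableOn (F 0) Ω) (hF' : AEStronglyMeasurable (F' 0) (volume.restrict Ω))
    (hd : ∀ x ∈ Ω, ∀ ε ∈ Metric.ball (0 : ℝ) δ, HasDerivAt (fun e => F e x) (F' ε x) ε)
    (hB : ∀ x ∈ Ω, ∀ ε ∈ Metric.ball (0 : ℝ) δ, |F' ε x| ≤ B) :
    HasDerivAt (fun ε => ∫ x in Ω, F ε x) (∫ x in Ω, F' 0 x) 0 := by
  have hball : Metric.ball (0 : ℝ) δ ∈ 𝓝 0 := Metric.ball_mem_nhds _ hδ
  refine (hasDerivAt_integral_of_dominated_loc_of_deriv_le (bound := fun _ => B)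
    hball (eventually_of_mem hball hF) hF0 hF' ?_ ?_ ?_).2
  · exact (ae_restrict_mem hΩ.isOpen.measurableSet).mono hB
  · exact hΩ.integrableOn continuousOn_const
  · exact (ae_restrict_mem hΩ.isOpen.measurableSet).mono hd

/-! ### Consequences of stationarity -/

variable {Ω Γu Γt : Set E3} {f t : E3 → E3} {V : Tensor → ℝ} {S τ : E3 → Tensor}

/-- A divergence-free field that vanishes on `Γt` is tangent to the statically admissible space;
the outer normals it needs almost everywhere on `Γt` come from any statically admissible field. -/
lemma mem_statAdmissible_zero (hτ : τ ∈ StatAdmissible Ω Γt f t)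
    (hΓt : ∃ O : Set E3, IsOpen O ∧ Γt = O ∩ frontier Ω) {θ : E3 → Tensor}
    (hθ : IsC1Tensor Ω θ) (hdiv : ∀ x ∈ Ω, div Ω θ x = 0) (h0 : ∀ x ∈ Γt, θ x = 0) :
    θ ∈ StatAdmissible Ω Γt 0 0 := by
  refine ⟨hθ, fun x hx => by simp [hdiv x hx], ?_⟩
  have hm : MeasurableSet Γt := by
    obtain ⟨O, hO, rfl⟩ := hΓt
    exact hO.measurableSet.inter isClosed_frontier.measurableSet
  filter_upwards [hτ.2.2, ae_restrict_mem hm] with p ⟨n, hn, _⟩ hp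
  exact ⟨n, hn, fun i => by simp [h0 p hp]⟩

/-- Stationarity with respect to the stress: `τ S⁻¹` is orthogonal to all self-equilibrated stress
variations. -/
lemma IsDualStationary.integral_pairing_eq_zero (hΩ : IsLipschitzDomain Ω)
    (h : IsDualStationary V Ω Γt f t S τ) {θ : E3 → Tensor} (hθ : θ ∈ StatAdmissible Ω Γt 0 0) :
    ∫ x in Ω, pairing (τ x * (S x)⁻¹) (θ x) = 0 := by
  have hS := h.mem_dual.1
  have hSi : ContinuousOn (fun x => (S x)⁻¹) (closure Ω) := continuousOn_inv hS h.mem_dual.2.1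
  have hτ := h.mem_stat.1.continuousOn
  have hθc := hθ.1.continuousOn
  have hd := h.stationary 0 continuous_const HasCompactSupport.zero (by simp [tsupport])
    (fun x => by simp [Matrix.IsSymm]) θ hθ
  set q := fun A B : E3 → Tensor => fun x => (A x * (S x)⁻¹ * (B x).transpose).trace with hq
  have hint : ∀ A B : E3 → Tensor, ContinuousOn A (closure Ω) → ContinuousOn B (closure Ω) →
      IntegrableOn (q A B) Ω := fun A B hA hB =>
    hΩ.integrableOn (continuousOn_trace_conj hA hSi hB)
  have hexp : ∀ ε : ℝ, pureComplementary V Ω (S + ε • 0) (τ + ε • θ) =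
      -((∫ x in Ω, ((1 / 4 : ℝ) * q τ τ x + legendre V (S x))) + ε * ((1 / 2) * ∫ x in Ω, q τ θ x)
        + ε ^ 2 * ((1 / 4) * ∫ x in Ω, q θ θ x)) := by
    intro ε
    have i1 : IntegrableOn (fun x => (1 / 4 : ℝ) * q τ τ x + legendre V (S x)) Ω :=
      ((hint τ τ hτ hτ).const_mul _).add h.mem_dual.2.2.2.1
    have i2 : IntegrableOn (fun x => ε * ((1 / 2) * q τ θ x)) Ω :=
      ((hint τ θ hτ hθc).const_mul _).const_mul _
    have i12 : IntegrableOn (fun x => (1 / 4 : ℝ) * q τ τ x + legendre V (S x)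
      + ε * ((1 / 2) * q τ θ x)) Ω := i1.add i2
    have i3 : IntegrableOn (fun x => ε ^ 2 * ((1 / 4) * q θ θ x)) Ω :=
      ((hint θ θ hθc hθc).const_mul _).const_mul _
    rw [pureComplementary]
    congr 1
    rw [← integral_const_mul, ← integral_const_mul, ← integral_const_mul, ← integral_const_mul,
      ← integral_add i1 i2, ← integral_add i12 i3]
    · refine setIntegral_congr_fun hΩ.isOpen.measurableSet fun x hx => ?_
      have hsymm := isSymm_of_mem_dualRange (h.mem_dual.2.2.1 x hx)
      have hinv : ((S x)⁻¹).transpose = (S x)⁻¹ := by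
        rw [Matrix.transpose_nonsing_inv, hsymm.eq]
      have hcomm : (θ x * (S x)⁻¹ * (τ x).transpose).trace =
          (τ x * (S x)⁻¹ * (θ x).transpose).trace := by
        rw [← Matrix.trace_transpose]
        simp only [Matrix.transpose_mul, Matrix.transpose_transpose, hinv, Matrix.mul_assoc]
      simp only [hq, Pi.add_apply, Pi.smul_apply, smul_zero, add_zero, Pi.zero_apply,
        Matrix.transpose_add, Matrix.transpose_smul, Matrix.add_mul, Matrix.mul_add,
        Matrix.smul_mul, Matrix.mul_smul, Matrix.trace_add, Matrix.trace_smul, smul_eq_mul, hcomm]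
      ring
  rw [funext hexp] at hd
  have hpoly : ∀ a b c : ℝ, HasDerivAt (fun ε : ℝ => -(a + ε * b + ε ^ 2 * c)) (-b) 0 := by
    intro a b c
    have := ((((hasDerivAt_id (0 : ℝ)).mul_const b).const_add a).add
      (((hasDerivAt_id (0 : ℝ)).pow 2).mul_const c)).neg
    refine (this.congr_deriv (by simp)).congr_of_eventuallyEq (Eventually.of_forall fun ε => ?_)
    simp
  have := hd.unique (hpoly _ _ _)
  have hz : ∫ x in Ω, q τ θ x = 0 := by linarith
  rw [← hz]
  congr 1 with x
  rw [pairing_comm, pairing_eq_trace, Matrix.trace_mul_comm]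

lemma pairing_self_eq_zero {A : Tensor} (h : pairing A A = 0) : A = 0 := by
  rw [pairing_apply] at h
  ext i j
  have h1 := (Finset.sum_eq_zero_iff_of_nonneg fun i _ =>
    Finset.sum_nonneg fun j _ => mul_self_nonneg (A i j)).1 h i (Finset.mem_univ i)
  have h2 := (Finset.sum_eq_zero_iff_of_nonneg fun j _ => mul_self_nonneg (A i j)).1 h1 j
    (Finset.mem_univ j)
  simpa using h2

lemma hasDerivAt_trace_inv {T A H : Tensor} {ε : ℝ}
    (hdet : ∀ᶠ e in 𝓝 ε, (A + e • H).det ≠ 0) :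
    HasDerivAt (fun e : ℝ => (T * (A + e • H)⁻¹ * T.transpose).trace)
      (-(T * ((A + ε • H)⁻¹ * H * (A + ε • H)⁻¹) * T.transpose).trace) ε := by
  rw [hasDerivAt_iff_tendsto_slope]
  have hε := hdet.self_of_nhds
  have hc : ContinuousAt (fun e : ℝ => (A + e • H)⁻¹) ε := by
    obtain ⟨u, hu, huo, hεu⟩ := mem_nhds_iff.1 hdet
    have h1 : Continuous fun e : ℝ => A + e • H := by fun_prop
    exact (continuousOn_inv h1.continuousOn fun e he => hu he).continuousAt (huo.mem_nhds hεu)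
  have hc2 : ContinuousAt (fun e : ℝ =>
      -(T * ((A + e • H)⁻¹ * H * (A + ε • H)⁻¹) * T.transpose).trace) ε := by
    have : Continuous fun B : Tensor =>
      -(T * (B * H * (A + ε • H)⁻¹) * T.transpose).trace := by fun_prop
    exact ContinuousAt.comp (f := fun e : ℝ => (A + e • H)⁻¹) this.continuousAt hc
  refine (hc2.tendsto.mono_left nhdsWithin_le_nhds).congr' ?_
  filter_upwards [nhdsWithin_le_nhds hdet, self_mem_nhdsWithin] with e he hne
  have hne' : e - ε ≠ 0 := sub_ne_zero.2 hne
  have hdiff : (A + e • H)⁻¹ - (A + ε • H)⁻¹ =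
      (-(e - ε)) • ((A + e • H)⁻¹ * H * (A + ε • H)⁻¹) := by
    have e1 : (A + e • H)⁻¹ * (A + e • H) = 1 := Matrix.nonsing_inv_mul _ he.isUnit
    have e2 : (A + ε • H) * (A + ε • H)⁻¹ = 1 := Matrix.mul_nonsing_inv _ hε.isUnit
    have e3 : (A + e • H)⁻¹ - (A + ε • H)⁻¹ =
        (A + e • H)⁻¹ * ((A + ε • H) - (A + e • H)) * (A + ε • H)⁻¹ := by
      rw [Matrix.mul_sub, Matrix.sub_mul, e1, Matrix.mul_assoc, e2, Matrix.mul_one, Matrix.one_mul]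
    have e4 : (A + ε • H) - (A + e • H) = (-(e - ε)) • H := by module
    rw [e3, e4, Matrix.mul_smul, Matrix.smul_mul]
  rw [slope_def_field, ← Matrix.trace_sub, ← Matrix.sub_mul, ← Matrix.mul_sub, hdiff]
  simp only [Matrix.mul_smul, Matrix.smul_mul, Matrix.trace_smul, smul_eq_mul]
  field_simp

/-- Stationarity with respect to `S`: the strain dual to `S` is the Cauchy-Green tensor of
`½ τ S⁻¹`. The comparison function `h` replaces the Legendre transform by its affine minorant at
`S`, which touches it at `ε = 0`; so the Legendre transform need not be differentiated. -/
lemma IsDualStationary.strainOf_eq (hΩ : IsLipschitzDomain Ω) (hV : IsConvexCanonical V)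
    (hΓt : ∃ O : Set E3, IsOpen O ∧ Γt = O ∩ frontier Ω)
    (h : IsDualStationary V Ω Γt f t S τ) {x : E3} (hx : x ∈ Ω) :
    strainOf V (S x) =
      ((1 / 2 : ℝ) • (τ x * (S x)⁻¹)).transpose * ((1 / 2 : ℝ) • (τ x * (S x)⁻¹)) := by
  have hS := h.mem_dual.1
  have hdet := h.mem_dual.2.1
  have hrange := h.mem_dual.2.2.1
  have hSi : ContinuousOn (fun x => (S x)⁻¹) (closure Ω) := continuousOn_inv hS hdet
  have hτ := h.mem_stat.1.continuousOn
  have hC : ContinuousOn (fun x => strainOf V (S x)) Ω :=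
    (continuousOn_strainOf hV).comp (hS.mono subset_closure) hrange
  have hinv : ∀ x ∈ Ω, ((S x)⁻¹).transpose = (S x)⁻¹ := fun x hx => by
    rw [Matrix.transpose_nonsing_inv, (isSymm_of_mem_dualRange (hrange x hx)).eq]
  have hmeas := hΩ.isOpen.measurableSet
  -- the first variation, as a function of the direction `H`
  set q : Tensor → E3 → ℝ := fun H x =>
    (1 / 4 : ℝ) * (τ x * ((S x)⁻¹ * H * (S x)⁻¹) * (τ x).transpose).trace
      - pairing H (strainOf V (S x)) with hq
  have hqc : ∀ H, ContinuousOn (q H) Ω := fun H => by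
    refine (ContinuousOn.const_smul (continuousOn_trace_conj hτ (continuousOn_mul (continuousOn_mul
      hSi continuousOn_const) hSi) hτ) (1 / 4 : ℝ) |>.mono subset_closure).sub
      (continuousOn_pairing continuousOn_const hC)
  have hweak : ∀ H : Tensor, H.IsSymm → ∀ φ : E3 → ℝ, ContDiff ℝ (⊤ : ℕ∞) φ →
      HasCompactSupport φ → tsupport φ ⊆ Ω → ∫ x, φ x • q H x = 0 := by
    intro H hH φ hφ hφc hφΩ
    set η : E3 → Tensor := fun x => φ x • H with hη
    have hηc : Continuous η := hφ.continuous.smul continuous_const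
    have hη0 : ∀ x, x ∉ tsupport φ → η x = 0 := fun x hx => by
      simp [hη, image_eq_zero_of_notMem_tsupport hx]
    have hηsupp : tsupport η ⊆ tsupport φ := closure_minimal (fun x hx => by
      by_contra hc; exact hx (hη0 x hc)) (isClosed_tsupport φ)
    have hstat := h.stationary η hηc (hφc.of_isClosed_subset (isClosed_tsupport _) hηsupp)
      (hηsupp.trans hφΩ) (fun x => by simp [hη, Matrix.IsSymm, hH.eq]) 0
      (mem_statAdmissible_zero h.mem_stat hΓt (fun i j => contDiffOn_const)
        (fun x _ => by ext i; simp [div, partialD]) (fun _ _ => rfl))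
    -- for small `ε` the varied field is invertible and in the range of the duality mapping
    have hev1 : ∀ᶠ ε in 𝓝 (0 : ℝ), ∀ x ∈ closure Ω, (S x + ε • η x).det ∈ ({0}ᶜ : Set ℝ) :=
      eventually_forall_mem_of_continuousOn hΩ.isCompact_closure hS hηc.continuousOn
        (g := Matrix.det) continuous_id.matrix_det
        fun x hx => isOpen_compl_singleton.mem_nhds (hdet x hx)
    have hev2 : ∀ᶠ ε in 𝓝 (0 : ℝ), ∀ x ∈ tsupport φ, S x + ε • η x ∈
        {A : Tensor | A.IsSymm → A ∈ dualRange V} :=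
      eventually_forall_mem_of_continuousOn hφc (hS.mono (hφΩ.trans subset_closure))
        hηc.continuousOn continuous_id
        fun x hx => eventually_mem_dualRange hV (hrange x (hφΩ hx))
    have hev2' : ∀ᶠ ε in 𝓝 (0 : ℝ), ∀ x ∈ Ω, S x + ε • η x ∈ dualRange V := by
      filter_upwards [hev2] with ε hε x hx
      by_cases hxs : x ∈ tsupport φ
      · refine hε x hxs ?_
        simp [hη, Matrix.IsSymm, hH.eq, (isSymm_of_mem_dualRange (hrange x hx)).eq]
      · rw [hη0 x hxs, smul_zero, add_zero]; exact hrange x hx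
    obtain ⟨δ', hδ', hball⟩ := Metric.eventually_nhds_iff_ball.1 (hev1.and hev2')
    set δ := δ' / 2 with hδdef
    have hδ : 0 < δ := by positivity
    have hcb : ∀ ε ∈ Icc (-δ) δ, ε ∈ Metric.ball (0 : ℝ) δ' := fun ε hε => by
      rw [Metric.mem_ball, dist_zero_right, Real.norm_eq_abs]
      exact (abs_le.2 hε).trans_lt (by rw [hδdef]; linarith)
    have hbi : ∀ ε ∈ Metric.ball (0 : ℝ) δ, ε ∈ Icc (-δ) δ := fun ε hε => by
      rw [Metric.mem_ball, dist_zero_right, Real.norm_eq_abs] at hε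
      exact abs_le.1 hε.le
    have hSη : ∀ ε : ℝ, ContinuousOn (fun x => S x + ε • η x) (closure Ω) := fun ε => by
      have : Continuous fun x => ε • η x := by fun_prop
      exact hS.add this.continuousOn
    -- the quadratic term and its derivative
    set F : ℝ → E3 → ℝ := fun ε x => (τ x * (S x + ε • η x)⁻¹ * (τ x).transpose).trace with hF
    set F' : ℝ → E3 → ℝ := fun ε x =>
      -(τ x * ((S x + ε • η x)⁻¹ * η x * (S x + ε • η x)⁻¹) * (τ x).transpose).trace with hF'
    have hFc : ∀ ε ∈ Metric.ball (0 : ℝ) δ', ContinuousOn (F ε) (closure Ω) := fun ε hε =>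
      continuousOn_trace_conj hτ (continuousOn_inv (hSη ε) (hball ε hε).1) hτ
    have hF'c : ContinuousOn (fun p : ℝ × E3 => F' p.1 p.2) (Icc (-δ) δ ×ˢ closure Ω) := by
      have hA : ContinuousOn (fun p : ℝ × E3 => S p.2 + p.1 • η p.2) (Icc (-δ) δ ×ˢ closure Ω) :=
        (hS.comp continuousOn_snd fun p hp => hp.2).add
          (continuousOn_fst.smul (hηc.comp_continuousOn continuousOn_snd))
      have hAi := continuousOn_inv hA fun p hp => (hball p.1 (hcb _ hp.1)).1 p.2 hp.2
      have hτ' : ContinuousOn (fun p : ℝ × E3 => τ p.2) (Icc (-δ) δ ×ˢ closure Ω) :=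
        hτ.comp continuousOn_snd fun p hp => hp.2
      exact (continuousOn_trace_conj hτ' (continuousOn_mul (continuousOn_mul hAi
        (hηc.comp_continuousOn continuousOn_snd)) hAi) hτ').neg
    obtain ⟨B, hB⟩ := (isCompact_Icc.prod hΩ.isCompact_closure).exists_bound_of_continuousOn hF'c
    have hδδ' : δ < δ' := by rw [hδdef]; linarith
    have hderF : HasDerivAt (fun ε => ∫ x in Ω, F ε x) (∫ x in Ω, F' 0 x) 0 := by
      refine hΩ.hasDerivAt_integral (B := B) hδ (fun ε hε => ?_) ?_ ?_ ?_ ?_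
      · exact (hΩ.integrableOn (hFc ε (Metric.ball_subset_ball hδδ'.le hε))).aestronglyMeasurable
      · exact hΩ.integrableOn (hFc 0 (Metric.mem_ball_self hδ'))
      · refine (hΩ.integrableOn ?_).aestronglyMeasurable
        exact hF'c.comp (f := fun x => ((0 : ℝ), x)) (by fun_prop)
          fun x hx => ⟨⟨by linarith, hδ.le⟩, hx⟩
      · intro x hx ε hε
        refine hasDerivAt_trace_inv ?_
        filter_upwards [Metric.isOpen_ball.mem_nhds (Metric.ball_subset_ball hδδ'.le hε)] with e he
        exact (hball e he).1 x (subset_closure hx)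
      · exact fun x hx ε hε => hB (ε, x) ⟨hbi ε hε, subset_closure hx⟩
    -- the affine minorant of the Legendre transform
    set ℓ : E3 → ℝ := fun x => pairing (η x) (strainOf V (S x)) with hℓ
    have hℓc : ContinuousOn ℓ Ω := continuousOn_pairing hηc.continuousOn hC
    have hℓi : IntegrableOn ℓ Ω := by
      have h1 : IntegrableOn ℓ (tsupport φ) := (hℓc.mono hφΩ).integrableOn_compact hφc
      refine IntegrableOn.of_forall_sdiff_eq_zero h1 hmeas fun x hx => ?_
      simp [hℓ, hη0 x hx.2, pairing_apply]
    have hLi := h.mem_dual.2.2.2.1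
    have hFi : ∀ ε ∈ Metric.ball (0 : ℝ) δ', IntegrableOn (F ε) Ω := fun ε hε =>
      hΩ.integrableOn (hFc ε hε)
    set hfun : ℝ → ℝ := fun ε => -((1 / 4) * (∫ x in Ω, F ε x) + (∫ x in Ω, legendre V (S x))
      + ε * ∫ x in Ω, ℓ x) with hhfun
    have hder : HasDerivAt hfun (-((1 / 4) * (∫ x in Ω, F' 0 x) + ∫ x in Ω, ℓ x)) 0 := by
      have := (((hderF.const_mul (1 / 4)).add_const (∫ x in Ω, legendre V (S x))).add
        ((hasDerivAt_id (0 : ℝ)).mul_const (∫ x in Ω, ℓ x))).neg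
      rw [one_mul] at this
      exact this
    have hpc : ∀ ε, pureComplementary V Ω (S + ε • η) (τ + ε • 0) =
        -∫ x in Ω, ((1 / 4 : ℝ) * F ε x + legendre V (S x + ε • η x)) := fun ε => by
      rw [pureComplementary]
      simp only [hF, Pi.add_apply, Pi.smul_apply, smul_zero, add_zero, Pi.zero_apply]
    have hLεi : ∀ ε ∈ Metric.ball (0 : ℝ) δ',
        IntegrableOn (fun x => legendre V (S x + ε • η x)) Ω := fun ε hε => by
      have hc : ContinuousOn (fun x => legendre V (S x + ε • η x)) Ω :=
        (continuousOn_legendre hV).comp ((hSη ε).mono subset_closure) (hball ε hε).2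
      have hc0 : ContinuousOn (fun x => legendre V (S x)) Ω :=
        (continuousOn_legendre hV).comp (hS.mono subset_closure) hrange
      have h1 : IntegrableOn (fun x => legendre V (S x + ε • η x) - legendre V (S x))
          (tsupport φ) := ((hc.sub hc0).mono hφΩ).integrableOn_compact hφc
      have h2 := IntegrableOn.of_forall_sdiff_eq_zero h1 hmeas fun x hx => by
        simp [hη0 x hx.2]
      refine (h2.add hLi).congr_fun (fun x _ => ?_) hmeas
      simp
    have hle : ∀ ε ∈ Metric.ball (0 : ℝ) δ',
        pureComplementary V Ω (S + ε • η) (τ + ε • 0) ≤ hfun ε := by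
      intro ε hε
      rw [hpc, hhfun]
      simp only
      rw [← integral_const_mul, ← integral_const_mul, ← integral_add, ← integral_add]
      · refine neg_le_neg (setIntegral_mono_on ?_ ?_ hmeas fun x hx => ?_)
        · exact (((hFi ε hε).const_mul _).add hLi).add (hℓi.const_mul _)
        · exact ((hFi ε hε).const_mul _).add (hLεi ε hε)
        · have h1 := le_legendre hV ((hball ε hε).2 x hx) (strainOf_spec (hrange x hx)).1
          have h2 : pairing (S x + ε • η x) (strainOf V (S x)) =
              pairing (S x) (strainOf V (S x)) + ε * ℓ x := by
            rw [pairing_comm, map_add, map_smul, pairing_comm _ (S x), pairing_comm _ (η x)]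
            rfl
          have h3 : legendre V (S x) = pairing (S x) (strainOf V (S x)) - V (strainOf V (S x)) :=
            rfl
          linarith
      · exact ((hFi ε hε).const_mul _).add hLi
      · exact hℓi.const_mul _
      · exact (hFi ε hε).const_mul _
      · exact hLi
    have heq : pureComplementary V Ω (S + (0 : ℝ) • η) (τ + (0 : ℝ) • 0) = hfun 0 := by
      rw [hpc, hhfun]
      simp only [zero_smul, add_zero, zero_mul]
      rw [← integral_const_mul, ← integral_add]
      · exact (hFi 0 (Metric.mem_ball_self hδ')).const_mul _
      · exact hLi
    have hmin : IsLocalMin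
        (hfun - fun ε : ℝ => pureComplementary V Ω (S + ε • η) (τ + ε • 0)) 0 := by
      filter_upwards [Metric.ball_mem_nhds (0 : ℝ) hδ'] with ε hε
      simp only [Pi.sub_apply]
      rw [heq, sub_self]
      exact sub_nonneg.2 (hle ε hε)
    have hz := hmin.hasDerivAt_eq_zero (hder.sub hstat)
    have hF'i : IntegrableOn (F' 0) Ω := hΩ.integrableOn
      (hF'c.comp (f := fun x => ((0 : ℝ), x)) (by fun_prop)
          fun x hx => ⟨⟨by linarith, hδ.le⟩, hx⟩)
    rw [sub_zero, ← integral_const_mul, ← integral_add (hF'i.const_mul _) hℓi,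
      ← integral_neg] at hz
    rw [← hz, ← setIntegral_eq_integral_of_forall_compl_eq_zero (s := Ω)]
    · refine setIntegral_congr_fun hmeas fun x hx => ?_
      simp only [hq, hF', hℓ, hη, zero_smul, add_zero, Matrix.mul_smul, Matrix.smul_mul,
        Matrix.trace_smul, smul_eq_mul]
      rw [pairing_comm (φ x • H), map_smul, pairing_comm _ H, smul_eq_mul]
      ring
    · intro x hx
      rw [image_eq_zero_of_notMem_tsupport fun hxs => hx (hφΩ hxs), zero_smul]
  have hzero : ∀ H : Tensor, H.IsSymm → ∀ x ∈ Ω, q H x = 0 := by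
    intro H hH
    have hae := hΩ.isOpen.ae_eq_zero_of_integral_contDiff_smul_eq_zero
      ((hqc H).locallyIntegrableOn hmeas)
      (fun φ h1 h2 h3 => hweak H hH φ h1 h2 h3)
    have hae' : q H =ᵐ[volume.restrict Ω] fun _ => (0 : ℝ) :=
      (ae_restrict_iff' hmeas).2 hae
    exact Measure.eqOn_open_of_ae_eq hae' hΩ.isOpen (hqc H) continuousOn_const
  set G := τ x * (S x)⁻¹ with hG
  have hGt : (S x)⁻¹ * (τ x).transpose = G.transpose := by
    rw [hG, Matrix.transpose_mul, hinv x hx]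
  have hrhs : ((1 / 2 : ℝ) • G).transpose * ((1 / 2 : ℝ) • G) =
      (1 / 4 : ℝ) • (G.transpose * G) := by
    rw [Matrix.transpose_smul, Matrix.smul_mul, Matrix.mul_smul, smul_smul]; norm_num
  rw [hrhs, ← sub_eq_zero]
  set D := strainOf V (S x) - (1 / 4 : ℝ) • (G.transpose * G) with hD
  have hDs : D.IsSymm := by
    have := isSymm_of_mem_symPos (strainOf_spec (hrange x hx)).1
    simp [hD, Matrix.IsSymm, Matrix.transpose_mul, this.eq]
  refine pairing_self_eq_zero ?_
  have h0 := hzero D hDs x hx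
  have h1 : (τ x * ((S x)⁻¹ * D * (S x)⁻¹) * (τ x).transpose).trace =
      pairing D (G.transpose * G) := by
    rw [pairing_eq_trace, hDs.eq]
    have : τ x * ((S x)⁻¹ * D * (S x)⁻¹) * (τ x).transpose = G * (D * G.transpose) := by
      rw [hG, ← hGt]; simp only [Matrix.mul_assoc]
    rw [this, Matrix.trace_mul_comm, Matrix.mul_assoc]
  simp only [hq] at h0
  rw [h1] at h0
  have : pairing D D = pairing D (strainOf V (S x)) - (1 / 4) * pairing D (G.transpose * G) := by
    conv_lhs => rw [hD, map_sub, map_smul, ← hD, smul_eq_mul]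
  linarith

end

section

/-! ### Mollified segments -/

/-- A sequence of smooth bumps at the origin with supports shrinking to a point. -/
def bump (n : ℕ) : ContDiffBump (0 : E3) where
  rIn := 1 / (2 * (n + 1))
  rOut := 1 / (n + 1)
  rIn_pos := by positivity
  rIn_lt_rOut := by
    apply one_div_lt_one_div_of_lt <;> [positivity; linarith [n.cast_nonneg (α := ℝ)]]

/-- The mollifiers: the bumps normalized to have integral one. -/
def mollifier (n : ℕ) : E3 → ℝ := (bump n).normed volume

lemma tendsto_bump_rOut : Tendsto (fun n => (bump n).rOut) atTop (𝓝 0) :=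
  tendsto_one_div_add_atTop_nhds_zero_nat

lemma contDiff_mollifier (n : ℕ) : ContDiff ℝ 1 (mollifier n) := (bump n).contDiff_normed (n := 1)

lemma mollifier_neg (n : ℕ) (x : E3) : mollifier n (-x) = mollifier n x := (bump n).normed_neg x

lemma mollifier_sub_comm (n : ℕ) (x y : E3) : mollifier n (x - y) = mollifier n (y - x) := by
  rw [← mollifier_neg, neg_sub]

lemma hasCompactSupport_mollifier (n : ℕ) : HasCompactSupport (mollifier n) :=
  (bump n).hasCompactSupport_normed

lemma mollifier_eq_zero {n : ℕ} {x : E3} (h : (bump n).rOut ≤ ‖x‖) : mollifier n x = 0 := by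
  by_contra hne
  have : x ∈ Function.support (mollifier n) := hne
  rw [mollifier, ContDiffBump.support_normed_eq, Metric.mem_ball, dist_zero_right] at this
  exact absurd this (not_lt.2 h)

/-- The mollification of the arc length current of the segment from `a` to `a + d`: the smooth
function `x ↦ ∫₀¹ φₙ(x - (a + s d)) ds`. -/
def segField (n : ℕ) (a d x : E3) : ℝ :=
  ∫ s in (0 : ℝ)..1, mollifier n (x - (a + s • d))

/-- The uniform measure on the segment from `a` to `a + d`. -/
def segMeasure (a d : E3) : Measure E3 :=
  (volume.restrict (Ioc (0 : ℝ) 1)).map fun s => a + s • d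

lemma integral_segMeasure (a d : E3) {h : E3 → ℝ} (hh : Continuous h) :
    ∫ y, h y ∂(segMeasure a d) = ∫ s in (0 : ℝ)..1, h (a + s • d) := by
  rw [segMeasure, integral_map (by fun_prop) hh.aestronglyMeasurable,
    intervalIntegral.integral_of_le zero_le_one]

instance (a d : E3) : IsFiniteMeasure (segMeasure a d) := by
  unfold segMeasure; infer_instance

open ContinuousLinearMap in
lemma segField_eq_convolution (n : ℕ) (a d : E3) : segField n a d =
    convolution (fun _ => (1 : ℝ)) (mollifier n) (lsmul ℝ ℝ) (segMeasure a d) := by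
  funext x
  rw [convolution_def, segField, integral_segMeasure]
  · simp
  · have := (contDiff_mollifier n).continuous
    simp only [lsmul_apply, one_smul]
    fun_prop

lemma contDiff_segField (n : ℕ) (a d : E3) : ContDiff ℝ 1 (segField n a d) := by
  rw [segField_eq_convolution]
  exact (hasCompactSupport_mollifier n).contDiff_convolution_right (n := 1) _
    (locallyIntegrable_const _) (contDiff_mollifier n)

/-- The boundary of a segment: its mollified current has divergence `φₙ(· - a) - φₙ(· - b)`. -/
lemma fderiv_segField (n : ℕ) (a d x : E3) :
    fderiv ℝ (segField n a d) x d = mollifier n (x - a) - mollifier n (x - (a + d)) := by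
  set ψ : ℝ → ℝ := fun s => mollifier n (x - (a + s • d)) with hψ
  have hψc : Continuous ψ := by
    have := (contDiff_mollifier n).continuous
    fun_prop
  have h1 : ∀ r : ℝ, segField n a d (x + r • d) =
      (∫ s in (0 : ℝ)..(1 - r), ψ s) - ∫ s in (0 : ℝ)..(0 - r), ψ s := by
    intro r
    rw [intervalIntegral.integral_interval_sub_left (hψc.intervalIntegrable _ _)
      (hψc.intervalIntegrable _ _), ← intervalIntegral.integral_comp_sub_right, segField]
    refine intervalIntegral.integral_congr fun s _ => ?_
    simp only [hψ]
    congr 1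
    module
  have hΨ : ∀ t : ℝ, HasDerivAt (fun r : ℝ => ∫ s in (0 : ℝ)..(t - r), ψ s) (-ψ t) 0 := by
    intro t
    have h2 := (hψc.integral_hasStrictDerivAt 0 (t - 0)).hasDerivAt
    have h3 := h2.comp (0 : ℝ) ((hasDerivAt_id (0 : ℝ)).const_sub t)
    refine h3.congr_deriv ?_
    simp
  have h2 := ((hΨ 1).sub (hΨ 0)).congr_of_eventuallyEq (Eventually.of_forall h1)
  have h3 : HasDerivAt (fun r : ℝ => x + r • d) ((1 : ℝ) • d) 0 :=
    ((hasDerivAt_id (0 : ℝ)).smul_const d).const_add x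
  have h4 := ((contDiff_segField n a d).differentiable one_ne_zero
    (x + (0 : ℝ) • d)).hasFDerivAt.comp_hasDerivAt (0 : ℝ) h3
  have h5 := h4.unique h2
  simp only [zero_smul, add_zero, one_smul] at h5
  rw [h5]
  simp [hψ]
  ring

lemma segField_eq_zero {n : ℕ} {a d x : E3}
    (h : ∀ s ∈ Icc (0 : ℝ) 1, (bump n).rOut ≤ ‖x - (a + s • d)‖) : segField n a d x = 0 := by
  rw [segField, intervalIntegral.integral_congr (g := fun _ => 0)]
  · simp
  · intro s hs
    rw [uIcc_of_le zero_le_one] at hs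
    exact mollifier_eq_zero (h s hs)

/-- Testing a bounded function `w` against mollified segments yields, in the limit, its integral
along the segment, if `w` is continuous at almost every point of the segment. -/
lemma tendsto_integral_segField {w : E3 → ℝ} {M : ℝ} (hwi : Integrable w) (hM : ∀ x, |w x| ≤ M)
    (a d : E3) (hc : ∀ᵐ s ∂(volume.restrict (Ioc (0 : ℝ) 1)), ContinuousAt w (a + s • d)) :
    Tendsto (fun n => ∫ x, segField n a d x * w x) atTop
      (𝓝 (∫ s in (0 : ℝ)..1, w (a + s • d))) := by
  have hswap : ∀ n, ∫ x, segField n a d x * w x =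
      ∫ s in Ioc (0 : ℝ) 1, ∫ x, mollifier n (x - (a + s • d)) * w x := by
    intro n
    have hcont := (contDiff_mollifier n).continuous
    rw [integral_integral_swap]
    · congr 1 with x
      rw [segField, intervalIntegral.integral_of_le zero_le_one, ← integral_mul_const]
    · obtain ⟨C, hC⟩ := hcont.bounded_above_of_compact_support (hasCompactSupport_mollifier n)
      have h1 : Integrable (fun p : ℝ × E3 => w p.2)
          ((volume.restrict (Ioc (0 : ℝ) 1)).prod volume) := hwi.comp_snd _
      refine h1.bdd_mul (c := C) ?_ (Eventually.of_forall fun p => hC _)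
      have : Continuous fun p : ℝ × E3 => mollifier n (p.2 - (a + p.1 • d)) := by fun_prop
      exact this.aestronglyMeasurable
  simp only [hswap]
  rw [intervalIntegral.integral_of_le zero_le_one]
  have hconv : ∀ n y, ∫ x, mollifier n (x - y) * w x =
      convolution (mollifier n) w (ContinuousLinearMap.lsmul ℝ ℝ) volume y := by
    intro n y
    rw [convolution_eq_swap]
    simp only [ContinuousLinearMap.lsmul_apply, smul_eq_mul, mollifier_sub_comm n y]
  refine tendsto_integral_of_dominated_convergence (fun _ => M) ?_ (by simp) ?_ ?_
  · intro n
    have hcont := (contDiff_mollifier n).continuous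
    have : Continuous fun s : ℝ => ∫ x, mollifier n (x - (a + s • d)) * w x := by
      simp only [hconv]
      exact ((hasCompactSupport_mollifier n).continuous_convolution_left _ hcont
        hwi.locallyIntegrable).comp (by fun_prop)
    exact this.aestronglyMeasurable
  · intro n
    refine Eventually.of_forall fun s => ?_
    have h1 : ∀ x, ‖mollifier n (x - (a + s • d)) * w x‖ ≤
        M * mollifier n (x - (a + s • d)) := fun x => by
      have hp : 0 ≤ mollifier n (x - (a + s • d)) := (bump n).nonneg_normed _
      rw [norm_mul, Real.norm_of_nonneg hp, mul_comm]
      exact mul_le_mul_of_nonneg_right (hM x) hp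
    refine (norm_integral_le_of_norm_le
      (((bump n).integrable_normed.comp_sub_right (a + s • d)).const_mul M)
      (Eventually.of_forall h1)).trans ?_
    have : ∫ x, mollifier n (x - (a + s • d)) = 1 := by
      rw [integral_sub_right_eq_self (mollifier n)]
      exact (bump n).integral_normed
    rw [integral_const_mul]
    exact (le_of_eq (by rw [← mul_one M]; congr 1; rw [mul_one]))
  · filter_upwards [hc] with s hs
    simp only [hconv]
    exact ContDiffBump.convolution_tendsto_right (φ := bump) (g := fun _ => w)
      (k := fun _ => a + s • d) tendsto_bump_rOut
      (Eventually.of_forall fun _ => hwi.aestronglyMeasurable)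
      (hs.tendsto.comp tendsto_snd) tendsto_const_nhds

/-! ### Weak line integrals -/

/-- The divergence of a vector field on the whole space. -/
def vdiv (θ : E3 → E3) (x : E3) : ℝ := ∑ j, fderiv ℝ θ x (EuclideanSpace.single j 1) j

lemma vdiv_add {θ θ' : E3 → E3} {x : E3} (h : DifferentiableAt ℝ θ x)
    (h' : DifferentiableAt ℝ θ' x) : vdiv (θ + θ') x = vdiv θ x + vdiv θ' x := by
  simp [vdiv, fderiv_add h h', Finset.sum_add_distrib]

lemma vdiv_neg {θ : E3 → E3} {x : E3} : vdiv (-θ) x = -vdiv θ x := by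
  simp [vdiv, fderiv_neg]

lemma vdiv_smul_const {m : E3 → ℝ} (d : E3) {x : E3} (h : DifferentiableAt ℝ m x) :
    vdiv (fun y => m y • d) x = fderiv ℝ m x d := by
  have h1 : fderiv ℝ (fun y => m y • d) x = (fderiv ℝ m x).smulRight d :=
    (h.hasFDerivAt.smul_const d).fderiv
  rw [vdiv, h1]
  conv_rhs => rw [show d = ∑ j, d j • EuclideanSpace.single j (1 : ℝ) from by
    ext i; simp [Finset.sum_apply, Pi.single_apply]]
  rw [map_sum]
  refine Finset.sum_congr rfl fun j _ => ?_
  simp [mul_comm]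

/-- The vector field `g` annihilates the divergence-free fields that vanish on `Γt`. -/
def AnnihilatesSolenoidal (Ω Γt : Set E3) (g : E3 → E3) : Prop :=
  ∀ θ : E3 → E3, ContDiff ℝ 1 θ → (∀ x ∈ Ω, vdiv θ x = 0) → (∀ x ∈ Γt, θ x = 0) →
    ∫ x in Ω, inner ℝ (g x) (θ x) = 0

/-- `I` is a weak line integral of `g` from `a` to `b`: the limit of the pairings of `g` with smooth
fields that vanish on `Γt` and whose divergence in `Ω` is the difference of two bumps concentrating
at `a` and `b`. The points `a` and `b` need not lie in `Ω`. -/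
def WeakIntegral (Ω Γt : Set E3) (g : E3 → E3) (a b : E3) (I : ℝ) : Prop :=
  ∃ θ : ℕ → E3 → E3, (∀ᶠ n in atTop, ContDiff ℝ 1 (θ n) ∧
    (∀ x ∈ Ω, vdiv (θ n) x = mollifier n (x - a) - mollifier n (x - b)) ∧ ∀ x ∈ Γt, θ n x = 0) ∧
    Tendsto (fun n => ∫ x in Ω, inner ℝ (g x) (θ n x)) atTop (𝓝 I)

variable {Ω Γt : Set E3} {g : E3 → E3} {a b c : E3} {I J : ℝ}

lemma IsLipschitzDomain.integrableOn_inner (hΩ : IsLipschitzDomain Ω)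
    (hg : ContinuousOn g (closure Ω)) {θ : E3 → E3} (hθ : ContinuousOn θ (closure Ω)) :
    IntegrableOn (fun x => inner ℝ (g x) (θ x)) Ω :=
  hΩ.integrableOn (hg.inner hθ)

lemma WeakIntegral.trans (hΩ : IsLipschitzDomain Ω) (hg : ContinuousOn g (closure Ω))
    (h : WeakIntegral Ω Γt g a b I) (h' : WeakIntegral Ω Γt g b c J) :
    WeakIntegral Ω Γt g a c (I + J) := by
  obtain ⟨θ, h1, h2⟩ := h
  obtain ⟨θ', h1', h2'⟩ := h'
  refine ⟨θ + θ', ?_, (h2.add h2').congr' ?_⟩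
  · filter_upwards [h1, h1'] with n ⟨hn1, hn2, hn3⟩ ⟨hn1', hn2', hn3'⟩
    refine ⟨hn1.add hn1', fun x hx => ?_, fun x hx => by simp [hn3 x hx, hn3' x hx]⟩
    rw [Pi.add_apply, vdiv_add (hn1.differentiable one_ne_zero x)
      (hn1'.differentiable one_ne_zero x), hn2 x hx, hn2' x hx]
    ring
  · filter_upwards [h1, h1'] with n hn hn'
    rw [← integral_add (hΩ.integrableOn_inner hg hn.1.continuous.continuousOn)
      (hΩ.integrableOn_inner hg hn'.1.continuous.continuousOn)]
    simp [inner_add_right]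

lemma WeakIntegral.symm (h : WeakIntegral Ω Γt g a b I) : WeakIntegral Ω Γt g b a (-I) := by
  obtain ⟨θ, h1, h2⟩ := h
  refine ⟨-θ, ?_, h2.neg.congr fun n => ?_⟩
  · filter_upwards [h1] with n ⟨hn1, hn2, hn3⟩
    refine ⟨hn1.neg, fun x hx => ?_, fun x hx => by simp [hn3 x hx]⟩
    rw [Pi.neg_apply, vdiv_neg, hn2 x hx]; ring
  · simp [integral_neg]

lemma WeakIntegral.eq_zero (hg : AnnihilatesSolenoidal Ω Γt g) (h : WeakIntegral Ω Γt g a b I)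
    (hab : ∀ᶠ n in atTop, ∀ x ∈ Ω, mollifier n (x - a) = mollifier n (x - b)) : I = 0 := by
  obtain ⟨θ, h1, h2⟩ := h
  refine tendsto_nhds_unique h2 (tendsto_const_nhds.congr' ?_)
  filter_upwards [h1, hab] with n ⟨hn1, hn2, hn3⟩ hn
  exact (hg _ hn1 (fun x hx => by rw [hn2 x hx, hn x hx, sub_self]) hn3).symm

lemma eventually_mollifier_eq_zero (ha : a ∉ closure Ω) :
    ∀ᶠ n in atTop, ∀ x ∈ Ω, mollifier n (x - a) = 0 := by
  obtain ⟨ε, hε, hball⟩ := Metric.isOpen_iff.1 isClosed_closure.isOpen_compl a ha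
  filter_upwards [tendsto_bump_rOut.eventually (gt_mem_nhds hε)] with n hn x hx
  refine mollifier_eq_zero (hn.le.trans ?_)
  by_contra hlt
  exact hball (by rw [Metric.mem_ball, dist_eq_norm]; exact not_le.1 hlt) (subset_closure hx)

/-- Weak line integrals between two points outside the closed body vanish. -/
lemma WeakIntegral.eq_zero_of_notMem (hg : AnnihilatesSolenoidal Ω Γt g)
    (h : WeakIntegral Ω Γt g a b I) (ha : a ∉ closure Ω) (hb : b ∉ closure Ω) : I = 0 := by
  refine h.eq_zero hg ?_
  filter_upwards [eventually_mollifier_eq_zero ha, eventually_mollifier_eq_zero hb]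
    with n h1 h2 x hx
  rw [h1 x hx, h2 x hx]

lemma WeakIntegral.unique (hΩ : IsLipschitzDomain Ω) (hgc : ContinuousOn g (closure Ω))
    (hg : AnnihilatesSolenoidal Ω Γt g)
    (h : WeakIntegral Ω Γt g a b I) (h' : WeakIntegral Ω Γt g a b J) : I = J := by
  have := (h.trans hΩ hgc h'.symm).eq_zero hg (Eventually.of_forall fun n x _ => rfl)
  linarith

/-- The integral of `g` along the part in `Ω` of a segment is a weak line integral, if the segment
stays away from `Γt` and meets the boundary in a set of length zero. -/
lemma weakIntegral_segment (hΩ : IsLipschitzDomain Ω) (hg : ContinuousOn g (closure Ω))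
    {O : Set E3} (hO : IsOpen O) (hOΓ : Disjoint O Γt) (d : E3)
    (hseg : ∀ s ∈ Icc (0 : ℝ) 1, a + s • d ∈ O)
    (hfr : ∀ᵐ s ∂(volume.restrict (Ioc (0 : ℝ) 1)), a + s • d ∉ frontier Ω) :
    WeakIntegral Ω Γt g a (a + d)
      (∫ s in (0 : ℝ)..1, Ω.indicator (fun x => inner ℝ (g x) d) (a + s • d)) := by
  have hmeas := hΩ.isOpen.measurableSet
  set w := Ω.indicator (fun x => inner ℝ (g x) d) with hw
  have hgd : ContinuousOn (fun x => inner ℝ (g x) d) (closure Ω) := hg.inner continuousOn_const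
  obtain ⟨M, hM⟩ := hΩ.isCompact_closure.exists_bound_of_continuousOn hgd
  have hM0 : ∀ x, |w x| ≤ max M 0 := fun x => by
    by_cases hx : x ∈ Ω
    · rw [hw, indicator_of_mem hx]
      exact (hM x (subset_closure hx)).trans (le_max_left _ _)
    · rw [hw, indicator_of_notMem hx]; simp
  have hwi : Integrable w := (integrable_indicator_iff hmeas).2 (hΩ.integrableOn hgd)
  have hwc : ∀ x, x ∉ frontier Ω → ContinuousAt w x := by
    intro x hx
    by_cases hxΩ : x ∈ Ω
    · refine ((hgd.mono subset_closure).continuousAt (hΩ.isOpen.mem_nhds hxΩ)).congr ?_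
      filter_upwards [hΩ.isOpen.mem_nhds hxΩ] with y hy
      rw [hw, indicator_of_mem hy]
    · have hxc : x ∈ (closure Ω)ᶜ := fun hxc => hx (by
        rw [hΩ.isOpen.frontier_eq]; exact ⟨hxc, hxΩ⟩)
      refine (continuousAt_const (y := (0 : ℝ))).congr ?_
      filter_upwards [isClosed_closure.isOpen_compl.mem_nhds hxc] with y hy
      rw [hw, indicator_of_notMem fun h => hy (subset_closure h)]
  refine ⟨fun n x => segField n a d x • d, ?_, ?_⟩
  · have hcomp : IsCompact ((fun s : ℝ => a + s • d) '' Icc 0 1) :=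
      isCompact_Icc.image (by fun_prop)
    obtain ⟨δ, hδ, hδO⟩ := hcomp.exists_thickening_subset_open hO (by
      rintro _ ⟨s, hs, rfl⟩; exact hseg s hs)
    filter_upwards [tendsto_bump_rOut.eventually (gt_mem_nhds hδ)] with n hn
    refine ⟨(contDiff_segField n a d).smul contDiff_const, fun x _ => ?_, fun x hx => ?_⟩
    · rw [vdiv_smul_const d ((contDiff_segField n a d).differentiable one_ne_zero x),
        fderiv_segField]
    · rw [segField_eq_zero, zero_smul]
      intro s hs
      by_contra hlt
      refine hOΓ.le_bot ⟨hδO (Metric.mem_thickening_iff.2 ⟨_, mem_image_of_mem _ hs, ?_⟩), hx⟩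
      rw [dist_eq_norm]
      exact (not_le.1 hlt).trans hn
  · refine (tendsto_integral_segField hwi hM0 a d (hfr.mono fun s hs => hwc _ hs)).congr fun n => ?_
    rw [← setIntegral_eq_integral_of_forall_compl_eq_zero (s := Ω)]
    · refine setIntegral_congr_fun hmeas fun x hx => ?_
      simp only [hw, indicator_of_mem hx, inner_smul_right]
    · intro x hx
      rw [hw, indicator_of_notMem hx, mul_zero]

end

section

/-! ### The potential of an annihilating field -/

variable {Ω Γu Γt : Set E3} {g : E3 → E3} {u : E3 → ℝ}

/-- `u` is a potential of `g` in `Ω`, in integrated form along segments. -/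
def IsPotential (Ω : Set E3) (g : E3 → E3) (u : E3 → ℝ) : Prop :=
  ∀ x d : E3, (∀ s ∈ Icc (0 : ℝ) 1, x + s • d ∈ Ω) →
    u (x + d) - u x = ∫ s in (0 : ℝ)..1, inner ℝ (g (x + s • d)) d

lemma weakIntegral_segment_of_subset (hΩ : IsLipschitzDomain Ω) (hg : ContinuousOn g (closure Ω))
    (hΓt : Γt ⊆ frontier Ω) {x d : E3} (hseg : ∀ s ∈ Icc (0 : ℝ) 1, x + s • d ∈ Ω) :
    WeakIntegral Ω Γt g x (x + d) (∫ s in (0 : ℝ)..1, inner ℝ (g (x + s • d)) d) := by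
  have hdisj : Disjoint Ω (frontier Ω) := by
    rw [hΩ.isOpen.frontier_eq]; exact disjoint_sdiff_right
  have h := weakIntegral_segment hΩ hg hΩ.isOpen (hdisj.mono_right hΓt) d hseg
    ((ae_restrict_mem measurableSet_Ioc).mono fun s hs =>
      disjoint_left.1 hdisj (hseg s ⟨hs.1.le, hs.2⟩))
  convert h using 1
  refine intervalIntegral.integral_congr fun s hs => ?_
  rw [uIcc_of_le zero_le_one] at hs
  simp only [indicator_of_mem (hseg s hs)]

lemma segment_mem_ball {p x y : E3} {r : ℝ} (hx : x ∈ Metric.ball p r) (hy : y ∈ Metric.ball p r)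
    {s : ℝ} (hs : s ∈ Icc (0 : ℝ) 1) : x + s • (y - x) ∈ Metric.ball p r :=
  (convex_ball p r).add_smul_sub_mem hx hy hs

/-- A field that annihilates the solenoidal fields has a potential in `Ω`, because its weak line
integrals depend only on the end points; they exist because `Ω` is connected. The difference of
two values of the potential is the weak line integral between the points. -/
lemma exists_isPotential (hΩ : IsLipschitzDomain Ω) (hgc : ContinuousOn g (closure Ω))
    (hΓt : Γt ⊆ frontier Ω) (hg : AnnihilatesSolenoidal Ω Γt g) :
    ∃ u : E3 → ℝ, IsPotential Ω g u ∧
      ∀ x ∈ Ω, ∀ y ∈ Ω, WeakIntegral Ω Γt g x y (u y - u x) := by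
  obtain ⟨x₁, hx₁⟩ := hΩ.isConnected.nonempty
  have hex : ∀ x ∈ Ω, ∀ y ∈ Ω, ∃ I, WeakIntegral Ω Γt g x y I := by
    intro x hx y hy
    refine hΩ.isConnected.isPreconnected.induction₂ (fun x y => ∃ I, WeakIntegral Ω Γt g x y I)
      ?_ ?_ ?_ hx hy
    · intro x hx
      obtain ⟨r, hr, hball⟩ := Metric.isOpen_iff.1 hΩ.isOpen x hx
      filter_upwards [mem_nhdsWithin_of_mem_nhds (Metric.ball_mem_nhds x hr)] with y hy
      have := weakIntegral_segment_of_subset (Γt := Γt) hΩ hgc hΓt (x := x) (d := y - x)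
        fun s hs => hball (segment_mem_ball (Metric.mem_ball_self hr) hy hs)
      rw [add_sub_cancel] at this
      exact ⟨_, this⟩
    · rintro x y z - - - ⟨I, hI⟩ ⟨J, hJ⟩
      exact ⟨_, hI.trans hΩ hgc hJ⟩
    · rintro x y - - ⟨I, hI⟩
      exact ⟨_, hI.symm⟩
  choose! v hv using hex x₁ hx₁
  have hdiff : ∀ x ∈ Ω, ∀ y ∈ Ω, WeakIntegral Ω Γt g x y (v y - v x) := fun x hx y hy => by
    have := (hv x hx).symm.trans hΩ hgc (hv y hy)
    rwa [neg_add_eq_sub] at this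
  refine ⟨v, fun x d hseg => ?_, hdiff⟩
  have hx : x ∈ Ω := by simpa using hseg 0 (by simp)
  have hy : x + d ∈ Ω := by simpa using hseg 1 (by simp)
  exact (hdiff x hx _ hy).unique hΩ hgc hg (weakIntegral_segment_of_subset hΩ hgc hΓt hseg)

lemma IsPotential.abs_sub_le (hu : IsPotential Ω g u) (hgc : ContinuousOn g (closure Ω))
    {x d c : E3} {ε : ℝ}
    (hseg : ∀ s ∈ Icc (0 : ℝ) 1, x + s • d ∈ Ω)
    (hε : ∀ s ∈ Icc (0 : ℝ) 1, ‖g (x + s • d) - c‖ ≤ ε) :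
    |u (x + d) - u x - inner ℝ c d| ≤ ε * ‖d‖ := by
  have hc : ContinuousOn (fun s : ℝ => inner ℝ (g (x + s • d)) d) (uIcc 0 1) := by
    rw [uIcc_of_le zero_le_one]
    exact (hgc.comp (by fun_prop) fun s hs => subset_closure (hseg s hs)).inner continuousOn_const
  have h1 : u (x + d) - u x - inner ℝ c d =
      ∫ s in (0 : ℝ)..1, inner ℝ (g (x + s • d) - c) d := by
    simp only [inner_sub_left]
    rw [intervalIntegral.integral_sub hc.intervalIntegrable (by simp), ← hu x d hseg]
    simp
  rw [h1]
  have := intervalIntegral.norm_integral_le_of_norm_le_const (a := (0 : ℝ)) (b := 1)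
    (f := fun s : ℝ => inner ℝ (g (x + s • d) - c) d) (C := ε * ‖d‖) fun s hs => by
      rw [uIoc_of_le zero_le_one] at hs
      exact (norm_inner_le_norm _ _).trans (by gcongr; exact hε s ⟨hs.1.le, hs.2⟩)
  simpa using this

/-- A potential is strictly differentiable at every point of the closed body. Near a boundary point,
two points of the epigraph are joined within it by going up, across and down. -/
lemma IsPotential.strict (hΩ : IsLipschitzDomain Ω) (hgc : ContinuousOn g (closure Ω))
    (hu : IsPotential Ω g u) {p : E3} (hp : p ∈ closure Ω) {ε : ℝ} (hε : 0 < ε) :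
    ∃ δ > 0, ∀ x ∈ Ω ∩ Metric.ball p δ, ∀ y ∈ Ω ∩ Metric.ball p δ,
      |u y - u x - inner ℝ (g p) (y - x)| ≤ ε * ‖y - x‖ := by
  have hgp : ∀ ε' > 0, ∃ ρ > 0, ∀ x ∈ Ω ∩ Metric.ball p ρ, ‖g x - g p‖ ≤ ε' := by
    intro ε' hε'
    obtain ⟨ρ, hρ, h⟩ := Metric.continuousWithinAt_iff.1 (hgc p hp) ε' hε'
    exact ⟨ρ, hρ, fun x hx => by
      rw [← dist_eq_norm]; exact (h (subset_closure hx.1) hx.2).le⟩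
  by_cases hpΩ : p ∈ Ω
  · obtain ⟨r, hr, hball⟩ := Metric.isOpen_iff.1 hΩ.isOpen p hpΩ
    obtain ⟨ρ, hρ, h⟩ := hgp ε hε
    refine ⟨min r ρ, lt_min hr hρ, fun x hx y hy => ?_⟩
    have hmem : ∀ s ∈ Icc (0 : ℝ) 1, x + s • (y - x) ∈ Metric.ball p (min r ρ) :=
      fun s hs => segment_mem_ball hx.2 hy.2 hs
    have hmemΩ : ∀ s ∈ Icc (0 : ℝ) 1, x + s • (y - x) ∈ Ω :=
      fun s hs => hball (Metric.ball_subset_ball (min_le_left _ _) (hmem s hs))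
    have := hu.abs_sub_le hgc hmemΩ (c := g p) (ε := ε) fun s hs =>
      h _ ⟨hmemΩ s hs, Metric.ball_subset_ball (min_le_right _ _) (hmem s hs)⟩
    rwa [add_sub_cancel] at this
  have hpf : p ∈ frontier Ω := by rw [hΩ.isOpen.frontier_eq]; exact ⟨hp, hpΩ⟩
  obtain ⟨R, K, φ, r, hc⟩ := hΩ.exists_chart hpf
  have hK := K.coe_nonneg
  obtain ⟨ρ, hρ, h⟩ := hgp (ε / (2 * K + 1)) (by positivity)
  set ρ' := min r ρ with hρ'
  have hρ'0 : 0 < ρ' := lt_min hc.pos hρ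
  refine ⟨ρ' / (2 * K + 1), by positivity, fun x hx y hy => ?_⟩
  set δ := ρ' / (2 * K + 1) with hδ
  have hδρ : δ * (2 * K + 1) = ρ' := by rw [hδ]; field_simp
  set k := K * ‖y - x‖ with hk
  set v := pt R (0, k) with hv
  have hk0 : 0 ≤ k := by positivity
  have hvn : ‖v‖ = k := by rw [hv, norm_pt_zero, abs_of_nonneg hk0]
  have hxy : ‖y - x‖ < 2 * δ := by
    have h1 := hx.2; have h2 := hy.2
    rw [Metric.mem_ball] at h1 h2
    rw [← dist_eq_norm]
    linarith [dist_triangle_right y x p]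
  have hbig : ∀ z ∈ Metric.ball p δ, ∀ s ∈ Icc (0 : ℝ) 1, z + s • v ∈ Metric.ball p ρ' := by
    intro z hz s hs
    rw [Metric.mem_ball, dist_eq_norm] at hz ⊢
    have h1 : ‖s • v‖ ≤ k := by
      rw [norm_smul, hvn, Real.norm_of_nonneg hs.1]
      exact mul_le_of_le_one_left hk0 hs.2
    have h2 : k ≤ K * (2 * δ) := mul_le_mul_of_nonneg_left hxy.le hK
    calc ‖z + s • v - p‖ = ‖(z - p) + s • v‖ := by congr 1; abel
      _ ≤ ‖z - p‖ + ‖s • v‖ := norm_add_le _ _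
      _ < ρ' := by nlinarith
  have hepi : ∀ z ∈ Ω ∩ Metric.ball p δ, φ (hor R z) < ver R z := fun z hz =>
    (hc.mem_iff z (Metric.ball_subset_ball (min_le_left r ρ)
      (by simpa only [zero_smul, add_zero] using hbig z hz.2 0 (by simp)))).1 hz.1
  have hin : ∀ z ∈ Metric.ball p ρ', φ (hor R z) < ver R z → z ∈ Ω := fun z hz hlt =>
    (hc.mem_iff z (Metric.ball_subset_ball (min_le_left _ _) hz)).2 hlt
  have hhv : hor R v = 0 := by rw [hv, hor_pt]
  have hvv : ver R v = k := by rw [hv, ver_pt]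
  have hup : ∀ z ∈ Ω ∩ Metric.ball p δ, ∀ s ∈ Icc (0 : ℝ) 1, z + s • v ∈ Ω := by
    intro z hz s hs
    refine hin _ (hbig z hz.2 s hs) ?_
    rw [map_add, map_add, map_smul, map_smul, hhv, hvv, smul_zero, add_zero, smul_eq_mul]
    have := hepi z hz
    nlinarith [hs.1]
  have hacross_ball : ∀ s ∈ Icc (0 : ℝ) 1, x + v + s • (y - x) ∈ Metric.ball p ρ' := by
    intro s hs
    have h1 := hbig _ (segment_mem_ball hx.2 hy.2 hs) 1 (by simp)
    convert h1 using 1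
    rw [one_smul]; abel
  have hacross : ∀ s ∈ Icc (0 : ℝ) 1, x + v + s • (y - x) ∈ Ω := by
    intro s hs
    refine hin _ (hacross_ball s hs) ?_
    have e1 : hor R (x + v + s • (y - x)) = hor R x + s • (hor R y - hor R x) := by
      rw [map_add, map_add, hhv, add_zero, map_smul, map_sub]
    have e2 : ver R (x + v + s • (y - x)) = (1 - s) * ver R x + s * ver R y + k := by
      rw [map_add, map_add, hvv, map_smul, map_sub, smul_eq_mul]; ring
    rw [e1, e2]
    set D := ‖hor R y - hor R x‖ with hD
    have hDle : D ≤ ‖y - x‖ := by rw [hD, ← map_sub]; exact norm_hor_le R _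
    have l1 : φ (hor R x + s • (hor R y - hor R x)) ≤ φ (hor R x) + K * (s * D) := by
      have := (le_abs_self _).trans
        (hc.lipschitz.dist_le_mul (hor R x + s • (hor R y - hor R x)) (hor R x))
      rw [dist_eq_norm, add_sub_cancel_left, norm_smul, Real.norm_of_nonneg hs.1] at this
      linarith
    have l2 : φ (hor R x + s • (hor R y - hor R x)) ≤ φ (hor R y) + K * ((1 - s) * D) := by
      have := (le_abs_self _).trans
        (hc.lipschitz.dist_le_mul (hor R x + s • (hor R y - hor R x)) (hor R y))
      have e : hor R x + s • (hor R y - hor R x) - hor R y =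
          -((1 - s) • (hor R y - hor R x)) := by module
      rw [dist_eq_norm, e, norm_neg, norm_smul,
        Real.norm_of_nonneg (sub_nonneg.2 hs.2)] at this
      linarith
    have l3 := hepi x hx
    have l4 := hepi y hy
    have hD0 : 0 ≤ D := norm_nonneg _
    have hs1 : 0 ≤ 1 - s := sub_nonneg.2 hs.2
    have m1 := mul_le_mul_of_nonneg_left l1 hs1
    have m2 := mul_le_mul_of_nonneg_left l2 hs.1
    have m3 := mul_le_mul_of_nonneg_left l3.le hs1
    have m4 := mul_le_mul_of_nonneg_left l4.le hs.1
    have hss : 2 * (s * (1 - s)) ≤ 1 := by nlinarith [sq_nonneg (2 * s - 1)]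
    have hKD : K * D ≤ k := mul_le_mul_of_nonneg_left hDle hK
    have hKD0 : 0 ≤ K * D := mul_nonneg hK hD0
    have m5 : 2 * (s * (1 - s)) * (K * D) ≤ k := (mul_le_of_le_one_left hKD0 hss).trans hKD
    rcases hs.1.eq_or_lt with h0 | h0
    · rw [← h0] at *; simp at *; linarith
    · have m4' := mul_lt_mul_of_pos_left l4 h0
      nlinarith
  have hest : ∀ z ∈ Ω ∩ Metric.ball p δ, |u (z + v) - u z - inner ℝ (g p) v| ≤
      ε / (2 * K + 1) * k := fun z hz => by
    have := hu.abs_sub_le hgc (hup z hz) (c := g p) (ε := ε / (2 * K + 1)) fun s hs =>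
      h _ ⟨hup z hz s hs, Metric.ball_subset_ball (min_le_right _ _) (hbig z hz.2 s hs)⟩
    rwa [hvn] at this
  have h1 := hest x hx
  have h2 := hest y hy
  have h3 := hu.abs_sub_le hgc hacross (c := g p) (ε := ε / (2 * K + 1)) fun s hs =>
    h _ ⟨hacross s hs, Metric.ball_subset_ball (min_le_right _ _) (hacross_ball s hs)⟩
  rw [show x + v + (y - x) = y + v by abel] at h3
  have hsum : ε / (2 * K + 1) * k + ε / (2 * K + 1) * ‖y - x‖ + ε / (2 * K + 1) * k =
      ε * ‖y - x‖ := by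
    rw [hk]; field_simp; ring
  rw [← hsum]
  rw [abs_le] at *
  constructor <;> linarith [h1.1, h1.2, h2.1, h2.2, h3.1, h3.2]

lemma IsPotential.exists_tendsto (hΩ : IsLipschitzDomain Ω) (hgc : ContinuousOn g (closure Ω))
    (hu : IsPotential Ω g u) {p : E3} (hp : p ∈ closure Ω) : ∃ l, Tendsto u (𝓝[Ω] p) (𝓝 l) := by
  obtain ⟨δ, hδ, h⟩ := hu.strict hΩ hgc hp one_pos
  have hlip : LipschitzOnWith (1 + ‖g p‖₊) u (Ω ∩ Metric.ball p δ) := by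
    refine LipschitzOnWith.of_dist_le_mul fun y hy x hx => ?_
    have h1 := h x hx y hy
    have h2 := norm_inner_le_norm (𝕜 := ℝ) (g p) (y - x)
    rw [Real.dist_eq, dist_eq_norm]
    rw [Real.norm_eq_abs] at h2
    push_cast
    calc |u y - u x| = |(u y - u x - inner ℝ (g p) (y - x)) + inner ℝ (g p) (y - x)| := by
          congr 1; ring
      _ ≤ _ := (abs_add_le _ _).trans (by rw [add_mul]; exact add_le_add h1 h2)
  obtain ⟨w, hw, hwe⟩ := hlip.extend_real
  refine ⟨w p, (hw.continuous.continuousAt.tendsto.mono_left nhdsWithin_le_nhds).congr' ?_⟩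
  filter_upwards [inter_mem self_mem_nhdsWithin
    (mem_nhdsWithin_of_mem_nhds (Metric.ball_mem_nhds p hδ))] with x hx
  exact (hwe hx).symm

/-- The continuous extension of a potential to the closed body has derivative `g` there, also at
boundary points. -/
lemma IsPotential.hasFDerivWithinAt (hΩ : IsLipschitzDomain Ω) (hgc : ContinuousOn g (closure Ω))
    (hu : IsPotential Ω g u) {p : E3} (hp : p ∈ closure Ω) :
    HasFDerivWithinAt (extendFrom Ω u) (innerSL ℝ (g p)) (closure Ω) p := by
  refine HasFDerivWithinAt.of_isLittleO (Asymptotics.isLittleO_iff.2 fun ε hε => ?_)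
  obtain ⟨δ, hδ, h⟩ := hu.strict hΩ hgc hp hε
  filter_upwards [inter_mem self_mem_nhdsWithin
    (mem_nhdsWithin_of_mem_nhds (Metric.ball_mem_nhds p hδ))] with y hy
  have htx := tendsto_extendFrom (hu.exists_tendsto hΩ hgc hp)
  have hty := tendsto_extendFrom (hu.exists_tendsto hΩ hgc hy.1)
  have : (𝓝[Ω] p).NeBot := mem_closure_iff_nhdsWithin_neBot.1 hp
  have : (𝓝[Ω] y).NeBot := mem_closure_iff_nhdsWithin_neBot.1 hy.1
  have hx' : Tendsto (fun z : E3 × E3 => z.1) (𝓝[Ω] p ×ˢ 𝓝[Ω] y) (𝓝 p) :=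
    (tendsto_id.mono_left nhdsWithin_le_nhds).comp tendsto_fst
  have hy' : Tendsto (fun z : E3 × E3 => z.2) (𝓝[Ω] p ×ˢ 𝓝[Ω] y) (𝓝 y) :=
    (tendsto_id.mono_left nhdsWithin_le_nhds).comp tendsto_snd
  have hl := (((hty.comp tendsto_snd).sub (htx.comp tendsto_fst)).sub
    ((tendsto_const_nhds (x := g p)).inner (hy'.sub hx'))).abs
  have hr := (hy'.sub hx').norm.const_mul ε
  refine le_of_tendsto_of_tendsto hl hr ?_
  have e1 : Ω ∩ Metric.ball p δ ∈ 𝓝[Ω] p :=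
    inter_mem self_mem_nhdsWithin (mem_nhdsWithin_of_mem_nhds (Metric.ball_mem_nhds p hδ))
  have e2 : Ω ∩ Metric.ball p δ ∈ 𝓝[Ω] y := inter_mem self_mem_nhdsWithin
    (mem_nhdsWithin_of_mem_nhds (Metric.isOpen_ball.mem_nhds hy.2))
  filter_upwards [prod_mem_prod e1 e2] with z hz
  exact h z.1 hz.1 z.2 hz.2

/-- The potential takes the same value at all points of `Γu`: two such points are joined by a path
that crosses the boundary vertically at the two points and has its ends outside the closed body, so
the weak line integral along it vanishes. -/
lemma IsPotential.extendFrom_eq (hΩ : IsLipschitzDomain Ω) (hΓ : IsBoundaryDecomposition Ω Γu Γt)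
    (hgc : ContinuousOn g (closure Ω)) (hg : AnnihilatesSolenoidal Ω Γt g)
    (hu : IsPotential Ω g u) (huW : ∀ x ∈ Ω, ∀ y ∈ Ω, WeakIntegral Ω Γt g x y (u y - u x))
    {p q : E3} (hp : p ∈ Γu) (hq : q ∈ Γu) : extendFrom Ω u p = extendFrom Ω u q := by
  obtain ⟨O, hO, hΓu⟩ := hΓ.relOpen_left
  obtain ⟨O', -, hΓt⟩ := hΓ.relOpen_right
  have hΓtf : Γt ⊆ frontier Ω := hΓt ▸ inter_subset_right
  have hOt : Disjoint O Γt := disjoint_left.2 fun x hxO hxt =>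
    disjoint_left.1 hΓ.disjoint (hΓu ▸ ⟨hxO, hΓtf hxt⟩) hxt
  obtain ⟨M, hM⟩ := hΩ.isCompact_closure.exists_bound_of_continuousOn hgc
  -- the vertical crossing at a point of `Γu`
  have hcross : ∀ p ∈ Γu, ∃ e : ℝ → E3, Tendsto e (𝓝[>] 0) (𝓝[Ω] p) ∧ ∀ᶠ k in 𝓝[>] (0 : ℝ),
      ∃ a ∉ closure Ω, ∃ I, WeakIntegral Ω Γt g a (e k) I ∧ |I| ≤ max M 0 * (2 * k) := by
    intro p hp
    have hpO : p ∈ O ∩ frontier Ω := hΓu ▸ hp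
    obtain ⟨R, K, φ, r, hc⟩ := hΩ.exists_chart hpO.2
    have hpb : p ∈ Metric.ball p r := Metric.mem_ball_self hc.pos
    have hφp := (hc.mem_frontier_iff p hpb).1 hpO.2
    obtain ⟨ρ, hρ, hball⟩ := Metric.isOpen_iff.1 (hO.inter Metric.isOpen_ball) p ⟨hpO.1, hpb⟩
    have hmem : ∀ k : ℝ, |k| < ρ → p + pt R (0, k) ∈ O ∩ Metric.ball p r := fun k hk =>
      hball (by rw [Metric.mem_ball, dist_eq_norm, add_sub_cancel_left, norm_pt_zero]; exact hk)
    have hhor : ∀ k : ℝ, hor R (p + pt R (0, k)) = hor R p := fun k => by simp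
    have hver : ∀ k : ℝ, ver R (p + pt R (0, k)) = ver R p + k := fun k => by simp
    have hinΩ : ∀ k : ℝ, 0 < k → |k| < ρ → p + pt R (0, k) ∈ Ω := fun k hk hkρ => by
      rw [hc.mem_iff _ (hmem k hkρ).2, hhor, hver, hφp]; linarith
    have hsmall : ∀ᶠ k in 𝓝[>] (0 : ℝ), 0 < k ∧ |k| < ρ := by
      filter_upwards [Ioo_mem_nhdsGT hρ] with k hk
      exact ⟨hk.1, by rw [abs_of_pos hk.1]; exact hk.2⟩
    refine ⟨fun k => p + pt R (0, k), tendsto_nhdsWithin_iff.2 ⟨?_, ?_⟩, ?_⟩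
    · have : Continuous fun s : ℝ => p + pt R (0, s) := by fun_prop
      have h0 := this.tendsto 0
      rw [show ((0 : E2), (0 : ℝ)) = 0 from rfl, map_zero, add_zero] at h0
      exact h0.mono_left nhdsWithin_le_nhds
    · exact hsmall.mono fun k hk => hinΩ k hk.1 hk.2
    filter_upwards [hsmall] with k hk
    have hline : ∀ s : ℝ, p + pt R (0, -k) + s • pt R (0, 2 * k) =
        p + pt R (0, (2 * s - 1) * k) := fun s => by
      rw [← map_smul, add_assoc, ← map_add]
      congr 2
      ext
      · simp
      · simp; ring
    have habs : ∀ s ∈ Icc (0 : ℝ) 1, |(2 * s - 1) * k| < ρ := fun s hs => by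
      rw [abs_mul]
      refine lt_of_le_of_lt (mul_le_of_le_one_left (abs_nonneg _) ?_) hk.2
      rw [abs_le]; constructor <;> linarith [hs.1, hs.2]
    have hseg := weakIntegral_segment (a := p + pt R (0, -k)) hΩ hgc hO hOt (pt R (0, 2 * k))
      (fun s hs => by rw [hline]; exact (hmem _ (habs s hs)).1) (by
        have hne : ∀ᵐ s ∂(volume.restrict (Ioc (0 : ℝ) 1)), s ≠ 1 / 2 :=
          ae_restrict_of_ae (by simp [ae_iff])
        filter_upwards [hne, ae_restrict_mem measurableSet_Ioc] with s hs hs01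
        rw [hline, hc.mem_frontier_iff _ (hmem _ (habs s ⟨hs01.1.le, hs01.2⟩)).2, hhor, hver, hφp]
        intro heq
        have : (2 * s - 1) * k = 0 := by linarith
        rcases mul_eq_zero.1 this with h | h
        · exact hs (by linarith)
        · exact hk.1.ne' h)
    have hend : p + pt R (0, -k) + pt R (0, 2 * k) = p + pt R (0, k) := by
      have := hline 1
      rw [one_smul] at this
      rw [this]; congr 3; ring
    rw [hend] at hseg
    refine ⟨_, ?_, _, hseg, ?_⟩
    · rw [hc.mem_closure_iff _ (hmem _ (by rw [abs_neg]; exact hk.2)).2, hhor, hver, hφp]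
      linarith [hk.1]
    · have hb := intervalIntegral.norm_integral_le_of_norm_le_const (a := (0 : ℝ)) (b := 1)
        (f := fun s : ℝ => Ω.indicator (fun x => inner ℝ (g x) (pt R (0, 2 * k)))
          (p + pt R (0, -k) + s • pt R (0, 2 * k))) (C := max M 0 * (2 * k)) fun s hs => by
          have hn : ‖pt R (0, 2 * k)‖ = 2 * k := by
            rw [norm_pt_zero, abs_of_pos (by linarith [hk.1])]
          by_cases hx : p + pt R (0, -k) + s • pt R (0, 2 * k) ∈ Ω
          · simp only [indicator_of_mem hx]
            refine (norm_inner_le_norm _ _).trans ?_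
            rw [hn]
            exact mul_le_mul_of_nonneg_right
              ((hM _ (subset_closure hx)).trans (le_max_left _ _)) (by linarith [hk.1])
          · simp only [indicator_of_notMem hx, norm_zero]
            exact mul_nonneg (le_max_right _ _) (by linarith [hk.1])
      simpa using hb
  obtain ⟨e, he, hcp⟩ := hcross p hp
  obtain ⟨e', he', hcq⟩ := hcross q hq
  have hfc : ∀ p ∈ Γu, p ∈ closure Ω := fun p hp =>
    frontier_subset_closure ((hΓu ▸ hp : p ∈ O ∩ frontier Ω)).2
  have h1 := (tendsto_extendFrom (hu.exists_tendsto hΩ hgc (hfc p hp))).comp he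
  have h2 := (tendsto_extendFrom (hu.exists_tendsto hΩ hgc (hfc q hq))).comp he'
  have h3 : Tendsto (fun k : ℝ => max M 0 * (2 * k) + max M 0 * (2 * k)) (𝓝[>] 0) (𝓝 0) := by
    have : Continuous fun k : ℝ => max M 0 * (2 * k) + max M 0 * (2 * k) := by fun_prop
    have h0 := this.tendsto 0
    simp only [mul_zero, add_zero] at h0
    exact h0.mono_left nhdsWithin_le_nhds
  have h4 := (h2.sub h1).abs
  have h5 : |extendFrom Ω u q - extendFrom Ω u p| ≤ 0 := by
    refine le_of_tendsto_of_tendsto h4 h3 ?_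
    filter_upwards [hcp, hcq, he.eventually self_mem_nhdsWithin,
      he'.eventually self_mem_nhdsWithin] with k ⟨a, ha, I, hI, hIb⟩ ⟨b, hb, J, hJ, hJb⟩ hk hk'
    have := ((hI.trans hΩ hgc (huW _ hk _ hk')).trans hΩ hgc hJ.symm).eq_zero_of_notMem hg ha hb
    have e : u (e' k) - u (e k) = J - I := by linarith
    simp only [Function.comp_apply]
    rw [e]
    exact (abs_sub _ _).trans (by linarith)
  exact (sub_eq_zero.1 (abs_nonpos_iff.1 h5)).symm

end

section

/-! ### Paths in the closed body and line integrals -/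

variable {A Ω : Set E3} {a b c : E3} {γ γ' : ℝ → E3}

lemma isPath_segment (h : ∀ s ∈ Icc (0 : ℝ) 1, a + s • (b - a) ∈ A) :
    IsPath A a b (fun s => a + s • (b - a)) := by
  have hd : ∀ s : ℝ, HasDerivAt (fun s : ℝ => a + s • (b - a)) (b - a) s := fun s => by
    have := ((hasDerivAt_id s).smul_const (b - a)).const_add a
    rw [one_smul] at this
    exact this
  refine ⟨by fun_prop, h, ⟨∅, finite_empty, fun r _ => (hd r).differentiableAt⟩, ?_, by simp,
    by simp⟩
  rw [show deriv (fun s : ℝ => a + s • (b - a)) = fun _ => b - a from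
    funext fun s => (hd s).deriv]
  simp

lemma IsPath.symm (h : IsPath A a b γ) : IsPath A b a (fun s => γ (1 - s)) := by
  have hm : ∀ s ∈ Icc (0 : ℝ) 1, 1 - s ∈ Icc (0 : ℝ) 1 := fun s hs =>
    ⟨by linarith [hs.2], by linarith [hs.1]⟩
  obtain ⟨s, hs, hd⟩ := h.differentiable
  refine ⟨h.continuousOn.comp (by fun_prop) hm, fun s hs => h.mapsTo (hm s hs),
    ⟨(fun r => 1 - r) ⁻¹' s, ?_, ?_⟩, ?_, by simpa using h.target, by simpa using h.source⟩
  · exact hs.preimage (sub_right_injective.injOn)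
  · intro r hr
    have := hd (1 - r) ⟨⟨by linarith [hr.1.2], by linarith [hr.1.1]⟩, hr.2⟩
    exact this.comp r ((differentiableAt_const _).sub differentiableAt_id)
  · have h1 := (h.integrable.comp_sub_left 1).symm.neg
    simp only [sub_zero, sub_self] at h1
    exact h1.congr fun x _ => by simp [deriv_comp_const_sub]

lemma IsPath.trans (h : IsPath A a b γ) (h' : IsPath A b c γ') :
    IsPath A a c (fun s => if s ≤ 1 / 2 then γ (2 * s) else γ' (2 * s - 1)) := by
  obtain ⟨s, hs, hd⟩ := h.differentiable
  obtain ⟨s', hs', hd'⟩ := h'.differentiable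
  set δ : ℝ → E3 := fun s => if s ≤ 1 / 2 then γ (2 * s) else γ' (2 * s - 1) with hδ
  have e1 : ∀ r < (1 / 2 : ℝ), δ =ᶠ[𝓝 r] fun s => γ (2 * s) := fun r hr => by
    filter_upwards [Iio_mem_nhds hr] with x hx
    rw [hδ]; simp only; rw [if_pos (le_of_lt hx)]
  have e2 : ∀ r > (1 / 2 : ℝ), δ =ᶠ[𝓝 r] fun s => γ' (2 * s - 1) := fun r hr => by
    filter_upwards [Ioi_mem_nhds hr] with x hx
    rw [hδ]; simp only; rw [if_neg (not_le.2 hx)]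
  have d1 : ∀ r < (1 / 2 : ℝ), deriv δ r = (2 : ℝ) • deriv γ (2 * r) := fun r hr => by
    rw [(e1 r hr).deriv_eq, deriv_comp_mul_left]
  have d2 : ∀ r > (1 / 2 : ℝ), deriv δ r = (2 : ℝ) • deriv γ' (2 * r - 1) := fun r hr => by
    rw [(e2 r hr).deriv_eq]
    have := deriv_comp_mul_left (2 : ℝ) (fun s => γ' (s - 1)) r
    rw [this, deriv_comp_sub_const]
  refine ⟨?_, ?_, ⟨(fun r => 2 * r) ⁻¹' s ∪ (fun r => 2 * r - 1) ⁻¹' s' ∪ {1 / 2}, ?_, ?_⟩, ?_, ?_,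
    ?_⟩
  · refine ContinuousOn.if' ?_ ?_ ?_ ?_
    · rintro x ⟨hx, hxf⟩
      have hx2 : x = 1 / 2 := by
        have := frontier_le_subset_eq continuous_id continuous_const hxf
        simpa using this
      have hlim : ContinuousWithinAt (fun s => γ (2 * s)) (Icc 0 1 ∩ {a | a ≤ 1 / 2}) x := by
        refine ContinuousWithinAt.comp (t := Icc 0 1) ?_ (by fun_prop) ?_
        · exact h.continuousOn _ (by rw [hx2]; norm_num)
        · intro y hy
          have := hy.2; have := hy.1.1
          simp only [mem_ofPred_eq] at *
          constructor <;> linarith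
      have := hlim.tendsto
      simp only [hx2] at this ⊢
      norm_num at this ⊢
      exact this
    · rintro x ⟨hx, hxf⟩
      have hx2 : x = 1 / 2 := by
        have := frontier_le_subset_eq continuous_id continuous_const hxf
        simpa using this
      have hlim : ContinuousWithinAt (fun s => γ' (2 * s - 1)) (Icc 0 1 ∩ {a | ¬ a ≤ 1 / 2}) x := by
        refine ContinuousWithinAt.comp (t := Icc 0 1) ?_ (by fun_prop) ?_
        · exact h'.continuousOn _ (by rw [hx2]; norm_num)
        · intro y hy
          have := hy.2; have := hy.1.2
          simp only [mem_ofPred_eq] at *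
          constructor <;> linarith
      have := hlim.tendsto
      simp only [hx2] at this ⊢
      norm_num at this ⊢
      rw [h.target, ← h'.source]
      exact this
    · refine h.continuousOn.comp (by fun_prop) fun y hy => ?_
      have := hy.2; have := hy.1.1
      simp only [mem_ofPred_eq] at *
      constructor <;> linarith
    · refine h'.continuousOn.comp (by fun_prop) fun y hy => ?_
      have := hy.2; have := hy.1.2
      simp only [mem_ofPred_eq] at *
      constructor <;> linarith
  · intro r hr
    rw [hδ]
    simp only
    split_ifs with hr2
    · exact h.mapsTo ⟨by linarith [hr.1], by linarith⟩
    · exact h'.mapsTo ⟨by linarith [not_le.1 hr2], by linarith [hr.2]⟩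
  · refine ((hs.preimage ?_).union (hs'.preimage ?_)).union (finite_singleton _)
    · exact fun x _ y _ hxy => by simpa using hxy
    · exact fun x _ y _ hxy => by simpa using hxy
  · rintro r ⟨hr, hrs⟩
    simp only [mem_union, not_or] at hrs
    obtain ⟨⟨hrs1, hrs2⟩, hrs3⟩ := hrs
    rcases lt_or_gt_of_ne (show r ≠ 1 / 2 from hrs3) with hlt | hgt
    · refine DifferentiableAt.congr_of_eventuallyEq ?_ (e1 r hlt)
      have := hd (2 * r) ⟨⟨by linarith [hr.1], by linarith⟩, hrs1⟩
      exact DifferentiableAt.comp (g := γ) r this (by fun_prop)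
    · refine DifferentiableAt.congr_of_eventuallyEq ?_ (e2 r hgt)
      have := hd' (2 * r - 1) ⟨⟨by linarith, by linarith [hr.2]⟩, hrs2⟩
      exact DifferentiableAt.comp (g := γ') r this (by fun_prop)
  · refine IntervalIntegrable.trans (b := 1 / 2) ?_ ?_
    · have h1 := (h.integrable.comp_mul_left (c := 2)).smul (2 : ℝ)
      simp only [zero_div] at h1
      refine h1.congr_ae ?_
      rw [uIoc_of_le (by norm_num)]
      have hne : ∀ᵐ s ∂(volume.restrict (Ioc (0 : ℝ) (1 / 2))), s ≠ 1 / 2 :=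
          ae_restrict_of_ae (by simp [ae_iff])
      filter_upwards [hne, ae_restrict_mem measurableSet_Ioc] with s hs hs2
      simp [d1 s (lt_of_le_of_ne hs2.2 hs)]
    · have h1 := ((h'.integrable.comp_sub_right 1).comp_mul_left (c := 2)).smul (2 : ℝ)
      have e : ((0 : ℝ) + 1) / 2 = 1 / 2 ∧ ((1 : ℝ) + 1) / 2 = 1 := by norm_num
      rw [e.1, e.2] at h1
      refine h1.congr_ae ?_
      rw [uIoc_of_le (by norm_num)]
      filter_upwards [ae_restrict_mem measurableSet_Ioc] with s hs2
      simp [d2 s hs2.1]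
  · rw [hδ]; simp only; rw [if_pos (by norm_num), mul_zero, h.source]
  · rw [hδ]; simp only; rw [if_neg (by norm_num)]; norm_num; exact h'.target

/-- Any two points of the closed body are joined by a path in it. -/
lemma IsLipschitzDomain.exists_isPath (hΩ : IsLipschitzDomain Ω) (ha : a ∈ closure Ω)
    (hb : b ∈ closure Ω) : ∃ γ, IsPath (closure Ω) a b γ := by
  have hin : ∀ x ∈ Ω, ∀ y ∈ Ω, ∃ γ, IsPath (closure Ω) x y γ := by
    intro x hx y hy
    refine hΩ.isConnected.isPreconnected.induction₂ (fun x y => ∃ γ, IsPath (closure Ω) x y γ)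
      ?_ ?_ ?_ hx hy
    · intro x hx
      obtain ⟨r, hr, hball⟩ := Metric.isOpen_iff.1 hΩ.isOpen x hx
      filter_upwards [mem_nhdsWithin_of_mem_nhds (Metric.ball_mem_nhds x hr)] with y hy
      exact ⟨_, isPath_segment fun s hs =>
        subset_closure (hball (segment_mem_ball (Metric.mem_ball_self hr) hy hs))⟩
    · rintro x y z - - - ⟨γ, hγ⟩ ⟨γ', hγ'⟩
      exact ⟨_, hγ.trans hγ'⟩
    · rintro x y - - ⟨γ, hγ⟩
      exact ⟨_, hγ.symm⟩
  have hbd : ∀ x ∈ closure Ω, ∃ y ∈ Ω, ∃ γ, IsPath (closure Ω) x y γ := by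
    intro x hx
    by_cases hxΩ : x ∈ Ω
    · exact ⟨x, hxΩ, hin x hxΩ x hxΩ⟩
    have hxf : x ∈ frontier Ω := by rw [hΩ.isOpen.frontier_eq]; exact ⟨hx, hxΩ⟩
    obtain ⟨R, K, φ, r, hc⟩ := hΩ.exists_chart hxf
    have hr := hc.pos
    have hφ := (hc.mem_frontier_iff x (Metric.mem_ball_self hr)).1 hxf
    have hmem : ∀ s ∈ Icc (0 : ℝ) 1, x + s • (x + pt R (0, r / 2) - x) ∈ Metric.ball x r := by
      intro s hs
      refine segment_mem_ball (Metric.mem_ball_self hr) ?_ hs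
      rw [Metric.mem_ball, dist_eq_norm, add_sub_cancel_left, norm_pt_zero,
        abs_of_pos (by positivity)]
      linarith
    refine ⟨x + pt R (0, r / 2), ?_, _, isPath_segment fun s hs => ?_⟩
    · have h1 := hmem 1 (by simp)
      rw [one_smul, add_sub_cancel] at h1
      rw [hc.mem_iff _ h1]
      exact lt_ver_add_pt hc.lipschitz hφ.le (by positivity)
    · rw [hc.mem_closure_iff _ (hmem s hs), add_sub_cancel_left]
      simp only [map_add, map_smul, hor_pt, ver_pt, smul_zero, add_zero, smul_eq_mul, hφ]
      have := hs.1
      nlinarith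
  obtain ⟨a', ha', γ, hγ⟩ := hbd a ha
  obtain ⟨b', hb', γ', hγ'⟩ := hbd b hb
  obtain ⟨γ'', hγ''⟩ := hin a' ha' b' hb'
  exact ⟨_, (hγ.trans hγ'').trans hγ'.symm⟩

/-- The fundamental theorem of calculus along a path in the closed body. -/
lemma IsPath.integral_eq {g : E3 → E3} {w : E3 → ℝ} (hγ : IsPath (closure Ω) a b γ)
    (hg : ContinuousOn g (closure Ω))
    (hw : ∀ x ∈ closure Ω, HasFDerivWithinAt w (innerSL ℝ (g x)) (closure Ω) x) :
    ∫ r in (0 : ℝ)..1, inner ℝ (g (γ r)) (deriv γ r) = w b - w a := by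
  obtain ⟨s, hs, hd⟩ := hγ.differentiable
  have hwc : ContinuousOn w (closure Ω) := fun x hx => (hw x hx).continuousWithinAt
  rw [← hγ.source, ← hγ.target]
  refine integral_eq_of_hasDerivAt_off_countable_of_le (w ∘ γ) _ zero_le_one
    hs.countable (hwc.comp hγ.continuousOn hγ.mapsTo) ?_ ?_
  · intro r hr
    have hrI : Icc (0 : ℝ) 1 ∈ 𝓝 r := Icc_mem_nhds hr.1.1 hr.1.2
    have h1 := (hd r hr).hasDerivAt.hasDerivWithinAt (s := Icc 0 1)
    have h2 := (hw (γ r) (hγ.mapsTo (mem_of_mem_nhds hrI))).comp_hasDerivWithinAt r h1 hγ.mapsTo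
    exact h2.hasDerivAt hrI
  · have hgc : ContinuousOn (fun r => g (γ r)) (uIcc 0 1) := by
      rw [uIcc_of_le zero_le_one]; exact hg.comp hγ.continuousOn hγ.mapsTo
    have hi := hγ.integrable
    have : ∀ r, inner ℝ (g (γ r)) (deriv γ r) = ∑ j, g (γ r) j * deriv γ r j := fun r => by
      simp [PiLp.inner_apply, mul_comm]
    simp only [this]
    have hj : ∀ j ∈ (Finset.univ : Finset (Fin 3)),
        IntervalIntegrable (fun r => g (γ r) j * deriv γ r j) volume 0 1 := fun j _ => by
      refine IntervalIntegrable.continuousOn_mul ?_ ?_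
      · exact ⟨(EuclideanSpace.proj (𝕜 := ℝ) j).integrable_comp hi.1,
          (EuclideanSpace.proj (𝕜 := ℝ) j).integrable_comp hi.2⟩
      · exact (EuclideanSpace.proj (𝕜 := ℝ) j).continuous.comp_continuousOn hgc
    have := IntervalIntegrable.sum _ hj
    exact this.congr fun r _ => by simp

end

section

/-! ### The area of a Lipschitz graph -/

open scoped NNReal ENNReal

variable (R : E3 ≃ₗᵢ[ℝ] E3) {φ : E2 → ℝ} {K : ℝ≥0}

/-- The parametrization of the graph of `φ` in the frame `R`. -/
def graphMap (R : E3 ≃ₗᵢ[ℝ] E3) (φ : E2 → ℝ) (y : E2) : E3 := pt R (y, φ y)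

/-- The area density of a graph whose height has derivative `L`. -/
def areaDensity (L : E2 →L[ℝ] ℝ) : ℝ := √(1 + ‖L‖ ^ 2)

lemma one_le_areaDensity (L : E2 →L[ℝ] ℝ) : 1 ≤ areaDensity L :=
  Real.one_le_sqrt.2 (by nlinarith [sq_nonneg ‖L‖])

lemma areaDensity_sq (L : E2 →L[ℝ] ℝ) : areaDensity L ^ 2 = 1 + ‖L‖ ^ 2 :=
  Real.sq_sqrt (by positivity)

lemma areaDensity_le {L L' : E2 →L[ℝ] ℝ} {δ : ℝ} (h : ‖L - L'‖ ≤ δ) :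
    areaDensity L ≤ (1 + δ) * areaDensity L' := by
  have hδ : 0 ≤ δ := (norm_nonneg _).trans h
  have h1 := one_le_areaDensity L'
  have h2 := areaDensity_sq L'
  have h3 : ‖L‖ ≤ ‖L'‖ + δ := by linarith [norm_sub_norm_le L L']
  have h4 : ‖L'‖ ≤ areaDensity L' := Real.le_sqrt_of_sq_le (by linarith)
  refine Real.sqrt_le_iff.2 ⟨by positivity, ?_⟩
  have h5 := norm_nonneg L
  have h6 := norm_nonneg L'
  have h7 : ‖L‖ ^ 2 ≤ (‖L'‖ + δ) ^ 2 := pow_le_pow_left₀ h5 h3 2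
  have h8 : δ * ‖L'‖ ≤ δ * areaDensity L' ^ 2 := by
    refine mul_le_mul_of_nonneg_left (h4.trans ?_) hδ
    nlinarith
  have h9 : δ ^ 2 * 1 ≤ δ ^ 2 * areaDensity L' ^ 2 :=
    mul_le_mul_of_nonneg_left (by nlinarith) (sq_nonneg δ)
  nlinarith

@[simp] lemma hor_graphMap (y : E2) : hor R (graphMap R φ y) = y := hor_pt R _

lemma continuous_graphMap (hφ : Continuous φ) : Continuous (graphMap R φ) :=
  (pt R).continuous.comp (continuous_id.prodMk hφ)

lemma measurableEmbedding_graphMap (hφ : Continuous φ) : MeasurableEmbedding (graphMap R φ) :=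
  (Function.LeftInverse.isClosedEmbedding (f := hor R) (hor_graphMap R) (hor R).continuous
    (continuous_graphMap R hφ)).measurableEmbedding

lemma euclideanHausdorffMeasure_image_le {X Y : Type*} [MetricSpace X] [MeasurableSpace X]
    [BorelSpace X] [MetricSpace Y] [MeasurableSpace Y] [BorelSpace Y] {f : X → Y} {s : Set X}
    {k : ℝ≥0} (h : LipschitzOnWith k f s) :
    (μHE[2] : Measure Y) (f '' s) ≤ (k : ℝ≥0∞) ^ 2 * (μHE[2] : Measure X) s := by
  simp only [Measure.euclideanHausdorffMeasure_def, Measure.smul_apply, Measure.nnreal_smul_coe_apply]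
  have := h.hausdorffMeasure_image_le (d := ((2 : ℕ) : ℝ)) (by positivity)
  rw [ENNReal.rpow_natCast] at this
  rw [mul_left_comm]
  exact mul_le_mul_right this _

/-- The linear parametrization of the plane that is the graph of `L`. -/
def planeMap (R : E3 ≃ₗᵢ[ℝ] E3) (L : E2 →L[ℝ] ℝ) : E2 →ₗ[ℝ] E3 :=
  (pt R).toLinearMap ∘ₗ (LinearMap.id.prod L.toLinearMap)

lemma planeMap_apply (L : E2 →L[ℝ] ℝ) (y : E2) : planeMap R L y = pt R (y, L y) := rfl

lemma inner_planeMap (L : E2 →L[ℝ] ℝ) (x y : E2) :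
    inner ℝ (planeMap R L x) (planeMap R L y) = inner ℝ x y + L x * L y := by
  rw [inner_eq_hor_ver R]; simp [planeMap_apply]

lemma norm_le_norm_planeMap (L : E2 →L[ℝ] ℝ) (x : E2) : ‖x‖ ≤ ‖planeMap R L x‖ := by
  have := norm_hor_le R (planeMap R L x)
  rwa [planeMap_apply, hor_pt] at this

lemma normDet_planeMap (L : E2 →L[ℝ] ℝ) : (planeMap R L).normDet = areaDensity L := by
  have h1 := (planeMap R L).normDet_sq_eq_det_gram (EuclideanSpace.basisFun (Fin 2) ℝ)
  have h2 : ‖L‖ ^ 2 = L (EuclideanSpace.single 0 1) ^ 2 + L (EuclideanSpace.single 1 1) ^ 2 := by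
    obtain ⟨v, rfl⟩ := (InnerProductSpace.toDual ℝ E2).surjective L
    rw [LinearIsometryEquiv.norm_map, EuclideanSpace.norm_sq_eq]
    simp [Fin.sum_univ_two, InnerProductSpace.toDual_apply_apply, EuclideanSpace.inner_single_right]
  have h3 : (planeMap R L).normDet ^ 2 = areaDensity L ^ 2 := by
    rw [areaDensity_sq, h2]
    refine h1.trans ?_
    rw [Matrix.det_fin_two]
    simp only [Matrix.gram_apply, inner_planeMap, EuclideanSpace.basisFun_apply]
    simp [EuclideanSpace.inner_single_right]
    ring
  exact (sq_eq_sq₀ (planeMap R L).normDet_nonneg (Real.sqrt_nonneg _)).1 h3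

lemma measure_planeMap_image (L : E2 →L[ℝ] ℝ) (s : Set E2) :
    (μHE[2] : Measure E3) (planeMap R L '' s) = ENNReal.ofReal (areaDensity L) * volume s := by
  have := (planeMap R L).euclideanHausdorffMeasure_image_eq_normDet_mul_volume s
  rw [normDet_planeMap] at this
  simpa using this

section Piece

variable {L : E2 →L[ℝ] ℝ} {s : Set E2} {δ : ℝ≥0}

lemma dist_graphMap_sub_le (h : ApproximatesLinearOn φ L s δ) {x y : E2} (hx : x ∈ s) (hy : y ∈ s) :
    ‖(graphMap R φ x - graphMap R φ y) - (planeMap R L x - planeMap R L y)‖ ≤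
      δ * ‖planeMap R L x - planeMap R L y‖ := by
  have e : (graphMap R φ x - graphMap R φ y) - (planeMap R L x - planeMap R L y) =
      pt R (0, φ x - φ y - L (x - y)) := by
    rw [graphMap, graphMap, planeMap_apply, planeMap_apply, ← map_sub, ← map_sub, ← map_sub]
    congr 1
    ext <;> simp
  rw [e, norm_pt_zero, ← map_sub]
  exact (h x hx y hy).trans (mul_le_mul_of_nonneg_left (norm_le_norm_planeMap R L _) δ.coe_nonneg)

/-- Where `φ` is close to a linear function, its graph has nearly the area of a plane piece. -/
lemma measure_graphMap_image_le (h : ApproximatesLinearOn φ L s δ) :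
    (μHE[2] : Measure E3) (graphMap R φ '' s) ≤
      (1 + δ) ^ 2 * (ENNReal.ofReal (areaDensity L) * volume s) := by
  have hl : LipschitzOnWith (1 + δ) (graphMap R φ ∘ hor R) (planeMap R L '' s) := by
    refine LipschitzOnWith.of_dist_le_mul ?_
    rintro _ ⟨x, hx, rfl⟩ _ ⟨y, hy, rfl⟩
    simp only [Function.comp_apply, planeMap_apply, hor_pt]
    simp only [← planeMap_apply, dist_eq_norm]
    have := dist_graphMap_sub_le R h hx hy
    have h2 := norm_le_norm_add_norm_sub' (graphMap R φ x - graphMap R φ y)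
      (planeMap R L x - planeMap R L y)
    push_cast
    linarith
  have := euclideanHausdorffMeasure_image_le hl
  rw [image_image, measure_planeMap_image] at this
  simpa [planeMap_apply] using this

lemma measure_plane_le (hδ : δ < 1) (h : ApproximatesLinearOn φ L s δ) :
    ENNReal.ofReal (areaDensity L) * volume s ≤
      ((1 - δ)⁻¹ : ℝ≥0) ^ 2 * (μHE[2] : Measure E3) (graphMap R φ '' s) := by
  have hl : LipschitzOnWith (1 - δ)⁻¹ (planeMap R L ∘ hor R) (graphMap R φ '' s) := by
    refine LipschitzOnWith.of_dist_le_mul ?_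
    rintro _ ⟨x, hx, rfl⟩ _ ⟨y, hy, rfl⟩
    simp only [Function.comp_apply, hor_graphMap, dist_eq_norm]
    have := dist_graphMap_sub_le R h hx hy
    have h2 := norm_le_norm_add_norm_sub' (planeMap R L x - planeMap R L y)
      (graphMap R φ x - graphMap R φ y)
    rw [norm_sub_rev (planeMap R L x - planeMap R L y)] at h2
    have hpos : (0 : ℝ) < 1 - δ := sub_pos.2 hδ
    rw [NNReal.coe_inv, NNReal.coe_sub hδ.le, NNReal.coe_one, inv_mul_eq_div, le_div_iff₀ hpos]
    linarith
  have := euclideanHausdorffMeasure_image_le hl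
  rw [image_image] at this
  simp only [Function.comp_apply, hor_graphMap] at this
  rwa [measure_planeMap_image] at this

lemma ae_norm_fderiv_sub_le (hs : MeasurableSet s) (hd : ∀ x ∈ s, DifferentiableAt ℝ φ x)
    (h : ApproximatesLinearOn φ L s δ) :
    ∀ᵐ x ∂(volume.restrict s), ‖fderiv ℝ φ x - L‖ ≤ δ := by
  set w : E2 := EuclideanSpace.single 0 1 with hw
  have hwn : ‖w‖ = 1 := by simp [hw]
  have h1 : ApproximatesLinearOn (fun x => φ x • w) (L.smulRight w) s δ := fun x hx y hy => by
    rw [ContinuousLinearMap.smulRight_apply, ← sub_smul, ← sub_smul, norm_smul, hwn, mul_one]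
    exact h x hx y hy
  have h2 := h1.norm_fderiv_sub_le (μ := volume) hs (fun x => (fderiv ℝ φ x).smulRight w)
    fun x hx => ((hd x hx).hasFDerivAt.smul_const w).hasFDerivWithinAt
  filter_upwards [h2] with x hx
  have e : (fderiv ℝ φ x).smulRight w - L.smulRight w = (fderiv ℝ φ x - L).smulRight w := by
    ext1 v; simp [sub_smul]
  rw [e] at hx
  have h3 : ‖(fderiv ℝ φ x - L).smulRight w‖ ≤ δ := hx
  rwa [ContinuousLinearMap.norm_smulRight_apply, hwn, mul_one] at h3

end Piece

/-- The area formula for a Lipschitz graph: the pull-back of the surface measure is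
`√(1 + |∇φ|²) dy`. On the pieces of a countable partition `φ` is nearly linear. -/
lemma comap_graphMap (hφ : LipschitzWith K φ) :
    (μHE[2] : Measure E3).comap (graphMap R φ) =
      volume.withDensity fun y => ENNReal.ofReal (areaDensity (fderiv ℝ φ y)) := by
  have hemb := measurableEmbedding_graphMap R hφ.continuous
  set ν := (μHE[2] : Measure E3).comap (graphMap R φ) with hν
  set m := volume.withDensity fun y => ENNReal.ofReal (areaDensity (fderiv ℝ φ y)) with hm
  have hνs : ∀ s, ν s = (μHE[2] : Measure E3) (graphMap R φ '' s) := fun s => hemb.comap_apply _ s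
  have hms : ∀ s, MeasurableSet s → m s =
      ∫⁻ y in s, ENNReal.ofReal (areaDensity (fderiv ℝ φ y)) := fun s hs =>
    withDensity_apply _ hs
  have hmeasD : MeasurableSet {y | DifferentiableAt ℝ φ y} := measurableSet_of_differentiableAt ℝ φ
  have hac : ν ≪ volume := by
    refine Measure.AbsolutelyContinuous.mk fun s _ h0 => ?_
    obtain ⟨K', hK'⟩ : ∃ K', LipschitzWith K' (graphMap R φ) :=
      ⟨_, (pt R).lipschitz.comp (LipschitzWith.id.prodMk hφ)⟩
    have := euclideanHausdorffMeasure_image_le (hK'.lipschitzOnWith (s := s))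
    rw [EuclideanSpace.euclideanHausdorffMeasure_eq_volume, h0, mul_zero] at this
    rw [hνs]
    exact le_antisymm this bot_le
  have hdae := hφ.ae_differentiableAt (μ := volume)
  -- comparison of the two measures on sets of differentiability points, up to a factor near one
  have key : ∀ δ : ℝ≥0, 0 < δ → δ < 1 → ∀ s, MeasurableSet s → (∀ x ∈ s, DifferentiableAt ℝ φ x) →
      ν s ≤ (1 + δ : ℝ≥0) ^ 3 * m s ∧
      m s ≤ ((1 + δ) * ((1 - δ)⁻¹) ^ 2 : ℝ≥0) * ν s := by
    intro δ hδ0 hδ1 s hs hd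
    obtain ⟨t, A, hdisj, htm, hst, happ, -⟩ :=
      exists_partition_approximatesLinearOn_of_hasFDerivWithinAt φ s (fderiv ℝ φ)
        (fun x hx => (hd x hx).hasFDerivAt.hasFDerivWithinAt) (fun _ => δ) (fun _ => hδ0.ne')
    have hsum : ∀ μ : Measure E2, μ s = ∑' n, μ (s ∩ t n) := fun μ => by
      rw [← measure_iUnion (fun i j hij => (hdisj hij).mono inter_subset_right inter_subset_right)
        (fun n => hs.inter (htm n)), ← inter_iUnion, inter_eq_left.2 hst]
    have hae : ∀ n, ∀ᵐ x ∂(volume.restrict (s ∩ t n)), ‖fderiv ℝ φ x - A n‖ ≤ δ := fun n =>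
      ae_norm_fderiv_sub_le (hs.inter (htm n)) (fun x hx => hd x hx.1) (happ n)
    have hofReal : ENNReal.ofReal (1 + δ) = ((1 + δ : ℝ≥0) : ℝ≥0∞) := by
      rw [← ENNReal.ofReal_coe_nnreal]; simp
    have hup : ∀ n, ENNReal.ofReal (areaDensity (A n)) * volume (s ∩ t n) ≤
        (1 + δ : ℝ≥0) * m (s ∩ t n) := fun n => by
      rw [hms _ (hs.inter (htm n)), ← lintegral_const_mul' _ _ ENNReal.coe_ne_top,
        ← setLIntegral_const]
      refine lintegral_mono_ae ((hae n).mono fun x hx => ?_)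
      rw [← hofReal, ← ENNReal.ofReal_mul (by positivity)]
      exact ENNReal.ofReal_le_ofReal (areaDensity_le (by rwa [norm_sub_rev]))
    have hlo : ∀ n, m (s ∩ t n) ≤
        (1 + δ : ℝ≥0) * (ENNReal.ofReal (areaDensity (A n)) * volume (s ∩ t n)) := fun n => by
      rw [hms _ (hs.inter (htm n)), ← mul_assoc, ← setLIntegral_const]
      refine lintegral_mono_ae ((hae n).mono fun x hx => ?_)
      rw [← hofReal, ← ENNReal.ofReal_mul (by positivity)]
      exact ENNReal.ofReal_le_ofReal (areaDensity_le hx)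
    rw [hsum ν, hsum m, ← ENNReal.tsum_mul_left, ← ENNReal.tsum_mul_left]
    refine ⟨ENNReal.tsum_le_tsum fun n => ?_, ENNReal.tsum_le_tsum fun n => ?_⟩
    · rw [hνs]
      refine (measure_graphMap_image_le R (happ n)).trans ?_
      refine (mul_le_mul_right (hup n) _).trans (le_of_eq ?_)
      push_cast; ring
    · rw [hνs]
      refine (hlo n).trans ?_
      refine (mul_le_mul_right (measure_plane_le R hδ1 (happ n)) _).trans (le_of_eq ?_)
      push_cast; ring
  have hev : ∀ᶠ δ in 𝓝[>] (0 : ℝ≥0), 0 < δ ∧ δ < 1 := Ioo_mem_nhdsGT one_pos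
  have hdiff : ∀ s, MeasurableSet s → (∀ x ∈ s, DifferentiableAt ℝ φ x) → ν s = m s := by
    intro s hs hd
    refine le_antisymm ?_ ?_
    · have ht : Tendsto (fun δ : ℝ≥0 => ((1 + δ : ℝ≥0) : ℝ≥0∞) ^ 3 * m s) (𝓝[>] 0)
          (𝓝 (1 * m s)) := by
        refine ENNReal.Tendsto.mul_const ?_ (Or.inl one_ne_zero)
        have : Continuous fun δ : ℝ≥0 => (((1 + δ) ^ 3 : ℝ≥0) : ℝ≥0∞) := by fun_prop
        have h0 := this.tendsto 0
        simp only [add_zero, one_pow, ENNReal.coe_one, ENNReal.coe_pow] at h0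
        exact h0.mono_left nhdsWithin_le_nhds
      rw [one_mul] at ht
      exact ge_of_tendsto ht (hev.mono fun δ hδ => (key δ hδ.1 hδ.2 s hs hd).1)
    · have ht : Tendsto (fun δ : ℝ≥0 => (((1 + δ) * ((1 - δ)⁻¹) ^ 2 : ℝ≥0) : ℝ≥0∞) * ν s) (𝓝[>] 0)
          (𝓝 (1 * ν s)) := by
        refine ENNReal.Tendsto.mul_const ?_ (Or.inl one_ne_zero)
        have h1 : ContinuousAt (fun δ : ℝ≥0 => (1 + δ) * ((1 - δ)⁻¹) ^ 2) 0 := by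
          refine ContinuousAt.mul (by fun_prop) (ContinuousAt.pow (ContinuousAt.inv₀ ?_ ?_) 2)
          · exact (continuous_const.sub continuous_id).continuousAt
          · simp
        have h0 := (ENNReal.continuous_coe.continuousAt.comp h1).tendsto
        simp only [Function.comp_apply, add_zero, tsub_zero, inv_one, one_pow, mul_one,
          ENNReal.coe_one] at h0
        exact h0.mono_left nhdsWithin_le_nhds
      rw [one_mul] at ht
      exact ge_of_tendsto ht (hev.mono fun δ hδ => (key δ hδ.1 hδ.2 s hs hd).2)
  refine Measure.ext fun s hs => ?_
  have hnull : volume {y | DifferentiableAt ℝ φ y}ᶜ = 0 := hdae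
  have hmac : m ≪ volume := withDensity_absolutelyContinuous _ _
  have h1 : ν s = ν (s ∩ {y | DifferentiableAt ℝ φ y}) :=
    (measure_inter_conull (hac hnull)).symm
  have h2 : m s = m (s ∩ {y | DifferentiableAt ℝ φ y}) :=
    (measure_inter_conull (hmac hnull)).symm
  rw [h1, h2]
  exact hdiff _ (hs.inter hmeasD) fun x hx => hx.2

/-- Surface integrals over a Lipschitz graph. -/
lemma setIntegral_graph (hφ : LipschitzWith K φ) (h : E3 → ℝ) :
    ∫ x in range (graphMap R φ), h x ∂(μHE[2] : Measure E3) =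
      ∫ y, areaDensity (fderiv ℝ φ y) * h (graphMap R φ y) := by
  have hemb := measurableEmbedding_graphMap R hφ.continuous
  rw [← hemb.map_comap, hemb.integral_map, comap_graphMap R hφ,
    integral_withDensity_eq_integral_toReal_smul]
  · refine integral_congr_ae (Eventually.of_forall fun y => ?_)
    simp only [smul_eq_mul]
    rw [ENNReal.toReal_ofReal (zero_le_one.trans (one_le_areaDensity _))]
  · have : Measurable fun y => fderiv ℝ φ y := measurable_fderiv ℝ φ
    unfold areaDensity
    fun_prop
  · simp

lemma integrableOn_graph (hφ : LipschitzWith K φ) (h : E3 → ℝ) :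
    IntegrableOn h (range (graphMap R φ)) (μHE[2] : Measure E3) ↔
      Integrable (fun y => areaDensity (fderiv ℝ φ y) * h (graphMap R φ y)) := by
  have hemb := measurableEmbedding_graphMap R hφ.continuous
  have hm : Measurable fun y => ENNReal.ofReal (areaDensity (fderiv ℝ φ y)) := by
    have : Measurable fun y => fderiv ℝ φ y := measurable_fderiv ℝ φ
    unfold areaDensity
    fun_prop
  rw [IntegrableOn, ← hemb.map_comap, hemb.integrable_map_iff, comap_graphMap R hφ,
    integrable_withDensity_iff_integrable_smul' hm (by simp)]
  refine integrable_congr (Eventually.of_forall fun y => ?_)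
  simp only [smul_eq_mul, Function.comp_apply]
  rw [ENNReal.toReal_ofReal (zero_le_one.trans (one_le_areaDensity _))]

end

section

/-! ### The Gauss theorem on a Lipschitz epigraph and the outward normal -/

open scoped NNReal ENNReal Manifold

section Epigraph

variable (R : E3 ≃ₗᵢ[ℝ] E3) {φ : E2 → ℝ} {K : ℝ≥0}

/-- The coordinates `(y, s) ↦ (y, φ(y) + s)`, which flatten the epigraph of `φ` to the half-space
`s > 0`. -/
def flatten (R : E3 ≃ₗᵢ[ℝ] E3) (φ : E2 → ℝ) (hφ : Continuous φ) : E2 × ℝ ≃ₜ E3 where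
  toFun z := pt R (z.1, φ z.1 + z.2)
  invFun x := (hor R x, ver R x - φ (hor R x))
  left_inv z := by simp
  right_inv x := by simp
  continuous_toFun := by fun_prop
  continuous_invFun := by fun_prop

lemma flatten_apply (hφ : Continuous φ) (z : E2 × ℝ) :
    flatten R φ hφ z = pt R (z.1, φ z.1 + z.2) := rfl

lemma flatten_mem_iff (hφ : Continuous φ) (z : E2 × ℝ) :
    flatten R φ hφ z ∈ {x | φ (hor R x) < ver R x} ↔ 0 < z.2 := by
  rw [flatten_apply]; simp

lemma measurePreserving_flatten (hφ : Continuous φ) :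
    MeasurePreserving (flatten R φ hφ) (volume.prod volume) volume := by
  have h1 : MeasurePreserving (fun z : E2 × ℝ => (z.1, φ z.1 + z.2))
      (volume.prod volume) (volume.prod volume) :=
    (MeasurePreserving.id (volume : Measure E2)).skew_product (g := fun y s => φ y + s)
      (by fun_prop) (Eventually.of_forall fun y => map_add_left_eq_self volume (φ y))
  exact (measurePreserving_pt R).comp h1

lemma isOpen_epigraph (hφ : Continuous φ) : IsOpen {x | φ (hor R x) < ver R x} :=
  isOpen_lt (by fun_prop) (by fun_prop)

/-- On an open set, a compactly supported `C¹` function agrees near a closed subset with a Lipschitz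
function. -/
lemma exists_lipschitz_extension {h : E3 → ℝ} (hc : HasCompactSupport h) {D : Set E3}
    (hD : IsOpen D) (hd : ContDiffOn ℝ 1 h D) {A : Set E3} (hA : IsClosed A) (hAD : A ⊆ D) :
    ∃ h' : E3 → ℝ, (∃ C, LipschitzWith C h') ∧ ∀ x ∈ A, h' x = h x := by
  have hk : IsCompact (A ∩ tsupport h) := hc.isCompact.inter_left hA
  obtain ⟨t, ht, hkt, htD⟩ := exists_compact_between hk hD (inter_subset_left.trans hAD)
  obtain ⟨χ, h1, h0, -⟩ := exists_contMDiffMap_one_nhds_of_subset_interior (n := 1) 𝓘(ℝ, E3)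
    hk.isClosed hkt
  have hχ : ContDiff ℝ 1 χ := χ.contMDiff.contDiff
  refine ⟨fun x => χ x * h x, ?_, fun x hx => ?_⟩
  · refine ContDiff.lipschitzWith_of_hasCompactSupport (𝕂 := ℝ) (n := 1) hc.mul_left ?_ one_ne_zero
    refine contDiff_iff_contDiffAt.2 fun x => ?_
    by_cases hx : x ∈ D
    · exact hχ.contDiffAt.mul (hd.contDiffAt (hD.mem_nhds hx))
    · have : (fun x => χ x * h x) =ᶠ[𝓝 x] fun _ => 0 := by
        filter_upwards [ht.isClosed.isOpen_compl.mem_nhds fun h => hx (htD h)] with y hy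
        rw [h0 y hy, zero_mul]
      exact contDiffAt_const.congr_of_eventuallyEq this
  · by_cases hxt : x ∈ tsupport h
    · simp only [h1.self_of_nhdsSet x ⟨hx, hxt⟩, one_mul]
    · simp only [image_eq_zero_of_notMem_tsupport hxt, mul_zero]

lemma hasDerivAt_flatten_line (hφ : Continuous φ) {y a : E2} (hy : DifferentiableAt ℝ φ y) (s : ℝ) :
    HasDerivAt (fun r : ℝ => flatten R φ hφ (y + r • a, s)) (pt R (a, fderiv ℝ φ y a)) 0 := by
  have h1 : HasDerivAt (fun r : ℝ => y + r • a) a 0 := by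
    simpa using ((hasDerivAt_id (0 : ℝ)).smul_const a).const_add y
  have h2 : HasDerivAt (fun r : ℝ => φ (y + r • a)) (fderiv ℝ φ y a) 0 := by
    have : HasFDerivAt φ (fderiv ℝ φ y) (y + (0 : ℝ) • a) := by simpa using hy.hasFDerivAt
    exact this.comp_hasDerivAt 0 h1
  exact (pt R).hasFDerivAt.comp_hasDerivAt 0 (h1.prodMk (h2.add_const s))

/-- Differentiation along the boundary: the integral of a tangential derivative over a translate of
the graph vanishes. -/
lemma integral_tangential_eq_zero (hφ : LipschitzWith K φ) {h : E3 → ℝ} (hc : HasCompactSupport h)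
    (hd : ContDiffOn ℝ 1 h {x | φ (hor R x) < ver R x}) (a : E2) {s : ℝ} (hs : 0 < s) :
    ∫ y, fderiv ℝ h (flatten R φ hφ.continuous (y, s)) (pt R (a, fderiv ℝ φ y a)) = 0 := by
  set Ψ := flatten R φ hφ.continuous
  have hD := isOpen_epigraph R hφ.continuous
  have hA : IsClosed {x | φ (hor R x) + s = ver R x} := by
    have := hφ.continuous
    exact isClosed_eq (by fun_prop) (by fun_prop)
  have hΨA : ∀ y, Ψ (y, s) ∈ {x | φ (hor R x) + s = ver R x} := fun y => by
    simp [Ψ, flatten_apply]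
  obtain ⟨h', ⟨C, hC⟩, hh'⟩ := exists_lipschitz_extension hc hD hd hA
    (fun x (hx : _ = _) => by rw [Set.mem_ofPred_eq, ← hx]; linarith)
  have hlip : ∃ C', LipschitzWith C' fun y => h (Ψ (y, s)) := by
    have h1 : LipschitzWith _ fun y : E2 => pt R (y, φ y + s) :=
      (pt R).lipschitz.comp (LipschitzWith.id.prodMk
        (hφ.add (LipschitzWith.const s)))
    have h2 : (fun y => h (Ψ (y, s))) = h' ∘ fun y : E2 => pt R (y, φ y + s) :=
      funext fun y => (hh' _ (hΨA y)).symm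
    rw [h2]
    exact ⟨_, hC.comp h1⟩
  obtain ⟨C', hC'⟩ := hlip
  have hcs : HasCompactSupport fun y => h (Ψ (y, s)) := by
    refine HasCompactSupport.of_support_subset_isCompact (hc.isCompact.image (hor R).continuous) ?_
    intro y hy
    exact ⟨Ψ (y, s), subset_tsupport _ hy, by simp [Ψ, flatten_apply]⟩
  have h0 := (LipschitzWith.const (α := E2) (1 : ℝ)).integral_lineDeriv_mul_eq (μ := volume)
    hC' hcs (-a)
  have h00 : ∀ x, lineDeriv ℝ (fun _ : E2 => (1 : ℝ)) x (-a) = 0 := fun x => by simp [lineDeriv]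
  simp only [h00, zero_mul, integral_zero, neg_neg, mul_one] at h0
  refine Eq.trans ?_ h0.symm
  refine integral_congr_ae ?_
  filter_upwards [hφ.ae_differentiableAt (μ := volume)] with y hy
  have hmem : Ψ (y, s) ∈ {x | φ (hor R x) < ver R x} :=
    (flatten_mem_iff R hφ.continuous (y, s)).2 hs
  have h1 : HasFDerivAt h (fderiv ℝ h (Ψ (y, s))) (Ψ (y + (0 : ℝ) • a, s)) := by
    rw [zero_smul, add_zero]
    exact ((hd.contDiffAt (hD.mem_nhds hmem)).differentiableAt one_ne_zero).hasFDerivAt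
  exact (h1.comp_hasDerivAt 0 (hasDerivAt_flatten_line R hφ.continuous hy s)).deriv.symm

lemma integrable_comp_flatten (hφ : Continuous φ) {g : E3 → ℝ}
    (hg : IntegrableOn g {x | φ (hor R x) < ver R x}) :
    Integrable (fun z => g (flatten R φ hφ z)) (volume.prod (volume.restrict (Ioi 0))) := by
  have h1 := ((measurePreserving_flatten R hφ).integrableOn_comp_preimage
    (flatten R φ hφ).measurableEmbedding).2 hg
  have h2 : flatten R φ hφ ⁻¹' {x | φ (hor R x) < ver R x} = univ ×ˢ Ioi 0 := by
    ext z; rw [mem_preimage, flatten_mem_iff]; simp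
  rw [h2, IntegrableOn, ← Measure.prod_restrict, Measure.restrict_univ] at h1
  exact h1

lemma setIntegral_epigraph (hφ : Continuous φ) (g : E3 → ℝ) :
    ∫ x in {x | φ (hor R x) < ver R x}, g x =
      ∫ z, g (flatten R φ hφ z) ∂(volume.prod (volume.restrict (Ioi 0))) := by
  have h1 := (measurePreserving_flatten R hφ).setIntegral_preimage_emb
    (flatten R φ hφ).measurableEmbedding g {x | φ (hor R x) < ver R x}
  have h2 : flatten R φ hφ ⁻¹' {x | φ (hor R x) < ver R x} = univ ×ˢ Ioi 0 := by
    ext z; rw [mem_preimage, flatten_mem_iff]; simp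
  rw [h2, ← Measure.prod_restrict, Measure.restrict_univ] at h1
  exact h1.symm

/-- Differentiation across the boundary: the fundamental theorem of calculus on a vertical ray. -/
lemma integral_vertical (hφ : Continuous φ) {h : E3 → ℝ} (hc : HasCompactSupport h)
    (hd : ContDiffOn ℝ 1 h {x | φ (hor R x) < ver R x})
    (hcont : ContinuousOn h {x | φ (hor R x) ≤ ver R x}) (y : E2)
    (hi : IntegrableOn (fun s => fderiv ℝ h (flatten R φ hφ (y, s)) (pt R (0, 1))) (Ioi 0)) :
    ∫ s in Ioi 0, fderiv ℝ h (flatten R φ hφ (y, s)) (pt R (0, 1)) = -h (graphMap R φ y) := by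
  have h0 : flatten R φ hφ (y, 0) = graphMap R φ y := by simp [flatten_apply, graphMap]
  have hline : ∀ s, HasDerivAt (fun s => flatten R φ hφ (y, s)) (pt R (0, 1)) s := fun s =>
    (pt R).hasFDerivAt.comp_hasDerivAt s
      ((hasDerivAt_const s y).prodMk ((hasDerivAt_id s).const_add (φ y)))
  have ht : Tendsto (fun s => h (flatten R φ hφ (y, s))) atTop (𝓝 0) := by
    have h1 : HasCompactSupport fun s => h (flatten R φ hφ (y, s)) := by
      refine HasCompactSupport.of_support_subset_isCompact
        (hc.isCompact.image (f := fun x => ver R x - φ y) (by fun_prop)) ?_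
      intro s hs
      exact ⟨_, subset_tsupport _ hs, by simp [flatten_apply]⟩
    have := (hasCompactSupport_iff_eventuallyEq.1 h1).filter_mono
      (coclosedCompact_eq_cocompact (X := ℝ) ▸ atTop_le_cocompact)
    exact this.tendsto
  have := integral_Ioi_of_hasDerivAt_of_tendsto (a := (0 : ℝ)) (m := 0)
    (f := fun s => h (flatten R φ hφ (y, s))) ?_ ?_ hi ht
  · rw [this, zero_sub, h0]
  · have h1 : ContinuousWithinAt h {x | φ (hor R x) ≤ ver R x} (flatten R φ hφ (y, 0)) :=
      hcont _ (by simp [flatten_apply])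
    refine ContinuousWithinAt.comp (f := fun s : ℝ => flatten R φ hφ (y, s)) h1
      (by have := (flatten R φ hφ).continuous; fun_prop) fun s hs => ?_
    simpa [flatten_apply] using mem_Ici.1 hs
  · intro s hs
    have hmem := (flatten_mem_iff R hφ (y, s)).2 hs
    exact (((hd.contDiffAt ((isOpen_epigraph R hφ).mem_nhds hmem)).differentiableAt
      one_ne_zero).hasFDerivAt).comp_hasDerivAt s (hline s)

/-- The Gauss theorem on the epigraph of a Lipschitz function, for a compactly supported function.
The direction `e` is split into a part tangential to the translates of the graph, which does not
contribute, and a vertical part. -/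
lemma setIntegral_epigraph_fderiv (hφ : LipschitzWith K φ) {h : E3 → ℝ} (hc : HasCompactSupport h)
    (hd : ContDiffOn ℝ 1 h {x | φ (hor R x) < ver R x})
    (hcont : ContinuousOn h {x | φ (hor R x) ≤ ver R x}) {B : ℝ}
    (hB : ∀ x, φ (hor R x) < ver R x → ‖fderiv ℝ h x‖ ≤ B) (e : E3) :
    ∫ x in {x | φ (hor R x) < ver R x}, fderiv ℝ h x e =
      ∫ y, (fderiv ℝ φ y (hor R e) - ver R e) * h (graphMap R φ y) := by
  set D := {x | φ (hor R x) < ver R x} with hD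
  have hDo : IsOpen D := isOpen_epigraph R hφ.continuous
  set Ψ := flatten R φ hφ.continuous
  have hint : ∀ v, IntegrableOn (fun x => fderiv ℝ h x v) D := by
    intro v
    have h1 : IntegrableOn (fun x => fderiv ℝ h x v) (D ∩ tsupport h) := by
      refine Measure.integrableOn_of_bounded (M := B * ‖v‖) ?_ ?_ ?_
      · exact ((measure_mono inter_subset_right).trans_lt hc.isCompact.measure_lt_top).ne
      · exact ((measurable_fderiv_apply_const ℝ h v).aestronglyMeasurable)
      · refine (ae_restrict_mem (hDo.measurableSet.inter (isClosed_tsupport h).measurableSet)).mono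
          fun x hx => ?_
        exact (ContinuousLinearMap.le_opNorm _ _).trans
          (mul_le_mul_of_nonneg_right (hB x hx.1) (norm_nonneg v))
    refine h1.of_forall_sdiff_eq_zero hDo.measurableSet fun x hx => ?_
    rw [fderiv_of_notMem_tsupport (𝕜 := ℝ) fun hx' => hx.2 ⟨hx.1, hx'⟩]; rfl
  set a := hor R e
  set b := ver R e
  have hmφ : Measurable fun y => fderiv ℝ φ y a := measurable_fderiv_apply_const ℝ φ a
  have hA := integrable_comp_flatten R hφ.continuous (hint e)
  have hV := integrable_comp_flatten R hφ.continuous (hint (pt R (0, 1)))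
  have hW : Integrable (fun z : E2 × ℝ => (b - fderiv ℝ φ z.1 a) * fderiv ℝ h (Ψ z) (pt R (0, 1)))
      (volume.prod (volume.restrict (Ioi 0))) := by
    refine hV.bdd_mul (c := |b| + K * ‖a‖)
      (measurable_const.sub (hmφ.comp measurable_fst)).aestronglyMeasurable (Eventually.of_forall fun z => ?_)
    refine (norm_sub_le _ _).trans (add_le_add le_rfl ?_)
    exact (ContinuousLinearMap.le_opNorm _ _).trans
      (mul_le_mul_of_nonneg_right (norm_fderiv_le_of_lipschitz ℝ hφ) (norm_nonneg a))
  have hsplit : ∀ z : E2 × ℝ, fderiv ℝ h (Ψ z) e =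
      fderiv ℝ h (Ψ z) (pt R (a, fderiv ℝ φ z.1 a)) +
        (b - fderiv ℝ φ z.1 a) * fderiv ℝ h (Ψ z) (pt R (0, 1)) := by
    intro z
    rw [← smul_eq_mul (b - _), ← map_smul, ← map_smul, ← map_add, ← map_add]
    congr 1
    rw [← pt_hor_ver R e]
    congr 1
    ext <;> simp [a, b]
  have hT : Integrable (fun z : E2 × ℝ => fderiv ℝ h (Ψ z) (pt R (a, fderiv ℝ φ z.1 a)))
      (volume.prod (volume.restrict (Ioi 0))) :=
    (hA.sub hW).congr (Eventually.of_forall fun z => by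
      simp only [Pi.sub_apply]; rw [sub_eq_iff_eq_add]; exact hsplit z)
  rw [setIntegral_epigraph R hφ.continuous, integral_congr_ae (Eventually.of_forall hsplit),
    integral_add hT hW, integral_prod_symm _ hT, integral_prod _ hW]
  have h1 : ∫ s in Ioi (0 : ℝ), ∫ y, fderiv ℝ h (Ψ (y, s)) (pt R (a, fderiv ℝ φ y a)) = 0 :=
    setIntegral_eq_zero_of_forall_eq_zero fun s hs => integral_tangential_eq_zero R hφ hc hd a hs
  rw [h1, zero_add]
  refine integral_congr_ae ?_
  filter_upwards [hV.prod_right_ae] with y hy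
  rw [integral_const_mul, integral_vertical R hφ.continuous hc hd hcont y hy]
  ring

end Epigraph

section Normal

variable {R : E3 ≃ₗᵢ[ℝ] E3} {φ : E2 → ℝ} {K : ℝ≥0} {Ω : Set E3} {p : E3} {r : ℝ}

/-- If `n ≠ m` were both outward normals, a ray in direction `m - n` would lie both inside and
outside of `Ω` near the boundary point. -/
lemma IsOuterNormal.unique {n m : E3} (hn : IsOuterNormal Ω p n) (hm : IsOuterNormal Ω p m) :
    n = m := by
  by_contra hne
  have hlt : inner ℝ m n < 1 := (inner_lt_one_iff_real_of_norm_eq_one hm.1 hn.1).2 (Ne.symm hne)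
  set c := 1 - inner ℝ m n with hc
  have hc0 : 0 < c := by linarith
  have hw : 0 < ‖m - n‖ := norm_pos_iff.2 (sub_ne_zero.2 (Ne.symm hne))
  have hwn : inner ℝ (m - n) n = -c := by
    rw [inner_sub_left, real_inner_self_eq_norm_sq, hn.1]; linarith
  have hwm : inner ℝ (m - n) m = c := by
    rw [inner_sub_left, real_inner_self_eq_norm_sq, hm.1, real_inner_comm]; linarith
  set ε := c / (2 * ‖m - n‖)
  have hε : 0 < ε := by positivity
  have hεc : ε * ‖m - n‖ = c / 2 := by simp only [ε]; field_simp
  have ht : Tendsto (fun s : ℝ => p + s • (m - n)) (𝓝[>] 0) (𝓝 p) := by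
    have : Continuous fun s : ℝ => p + s • (m - n) := by fun_prop
    have h0 := this.tendsto 0
    rw [zero_smul, add_zero] at h0
    exact h0.mono_left nhdsWithin_le_nhds
  obtain ⟨s, h1, h2, hs⟩ := ((ht.eventually (hn.2 ε hε)).and ((ht.eventually (hm.2 ε hε)).and
    self_mem_nhdsWithin)).exists
  have hs0 : 0 < s := hs
  rw [add_sub_cancel_left, norm_smul, Real.norm_of_nonneg hs0.le, inner_smul_left] at h1 h2
  rw [hwn] at h1
  rw [hwm] at h2
  have e : ε * (s * ‖m - n‖) = s * (c / 2) := by rw [← hεc]; ring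
  rw [e] at h1 h2
  simp only [conj_trivial] at h1 h2
  have hsc : 0 < s * c := mul_pos hs0 hc0
  exact h2.2 (by linarith) (h1.1 (by linarith))

/-- The outward unit normal of a graph, `(∇φ, -1) / √(1 + |∇φ|²)`. -/
def graphNormal (R : E3 ≃ₗᵢ[ℝ] E3) (L : E2 →L[ℝ] ℝ) : E3 :=
  (areaDensity L)⁻¹ • pt R ((InnerProductSpace.toDual ℝ E2).symm L, -1)

lemma areaDensity_mul_inner_graphNormal (L : E2 →L[ℝ] ℝ) (e : E3) :
    areaDensity L * inner ℝ e (graphNormal R L) = L (hor R e) - ver R e := by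
  have hJ : areaDensity L ≠ 0 := (zero_lt_one.trans_le (one_le_areaDensity L)).ne'
  rw [graphNormal, inner_smul_right, mul_inv_cancel_left₀ hJ, inner_eq_hor_ver R, hor_pt, ver_pt,
    real_inner_comm, InnerProductSpace.toDual_symm_apply]
  ring

lemma norm_graphNormal (L : E2 →L[ℝ] ℝ) : ‖graphNormal R L‖ = 1 := by
  have hJ : 0 < areaDensity L := zero_lt_one.trans_le (one_le_areaDensity L)
  have h := norm_sq_eq_hor_ver R (pt R ((InnerProductSpace.toDual ℝ E2).symm L, -1))
  rw [hor_pt, ver_pt, LinearIsometryEquiv.norm_map] at h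
  have h1 : ‖pt R ((InnerProductSpace.toDual ℝ E2).symm L, -1)‖ = areaDensity L := by
    refine (sq_eq_sq₀ (norm_nonneg _) hJ.le).1 ?_
    rw [h, areaDensity_sq]; ring
  rw [graphNormal, norm_smul, h1, Real.norm_of_nonneg (inv_nonneg.2 hJ.le), inv_mul_cancel₀ hJ.ne']

/-- There is an outward normal wherever the chart function is differentiable. -/
lemma IsChart.isOuterNormal (hch : IsChart Ω p R K φ r) {y : E2}
    (hy : graphMap R φ y ∈ Metric.ball p r) (hd : DifferentiableAt ℝ φ y) :
    IsOuterNormal Ω (graphMap R φ y) (graphNormal R (fderiv ℝ φ y)) := by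
  refine ⟨norm_graphNormal _, fun ε hε => ?_⟩
  set q := graphMap R φ y with hq
  have ht : Tendsto (hor R) (𝓝 q) (𝓝 y) := by
    have := (hor R).continuous.tendsto q
    rwa [hq, hor_graphMap] at this
  have hlo := ht.eventually (hd.hasFDerivAt.isLittleO.def hε)
  filter_upwards [hlo, Metric.isOpen_ball.mem_nhds hy] with x hx hxb
  have hJ := one_le_areaDensity (fderiv ℝ φ y)
  have h1 := areaDensity_mul_inner_graphNormal (R := R) (fderiv ℝ φ y) (x - q)
  have hhq : hor R (x - q) = hor R x - y := by rw [map_sub, hq, hor_graphMap]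
  have hvq : ver R (x - q) = ver R x - φ y := by rw [map_sub, hq, graphMap, ver_pt]
  have h2 := norm_hor_le R (x - q)
  rw [hhq] at h1 h2
  rw [hvq] at h1
  rw [Real.norm_eq_abs, abs_le] at hx
  have h3 := mul_le_mul_of_nonneg_left h2 hε.le
  have h4 : 0 ≤ ε * ‖x - q‖ := by positivity
  have h5 := mul_le_mul_of_nonneg_right hJ h4
  set J := areaDensity (fderiv ℝ φ y)
  set N := inner ℝ (x - q) (graphNormal R (fderiv ℝ φ y))
  rw [hch.mem_iff x hxb, not_lt]
  constructor
  · intro h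
    have := mul_lt_mul_of_pos_left h (zero_lt_one.trans_le hJ)
    rw [mul_neg] at this
    linarith [hx.2]
  · intro h
    have := mul_lt_mul_of_pos_left h (zero_lt_one.trans_le hJ)
    linarith [hx.1]

open Classical in
/-- The outward unit normal, with value zero where there is none. -/
def outerNormal (Ω : Set E3) (p : E3) : E3 := if h : ∃ n, IsOuterNormal Ω p n then h.choose else 0

lemma IsOuterNormal.outerNormal_eq {n : E3} (hn : IsOuterNormal Ω p n) : outerNormal Ω p = n := by
  have h : ∃ n, IsOuterNormal Ω p n := ⟨n, hn⟩
  rw [outerNormal, dif_pos h]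
  exact h.choose_spec.unique hn

end Normal

end

section

/-! ### The Gauss theorem on a Lipschitz domain and virtual work -/

section Gauss

open scoped NNReal Manifold

variable {Ω : Set E3}

/-- The Gauss theorem for the function `h`: its derivative in any direction `e` has as integral over
`Ω` the surface integral of `h ⟪e, n⟫`, which is required to converge. -/
def GaussFormula (Ω : Set E3) (h : E3 → ℝ) : Prop :=
  ∀ e : E3,
    IntegrableOn (fun x => h x * inner ℝ e (outerNormal Ω x)) (frontier Ω) (μHE[2] : Measure E3) ∧
    ∫ x in Ω, fderiv ℝ h x e =
      ∫ x in frontier Ω, h x * inner ℝ e (outerNormal Ω x) ∂(μHE[2] : Measure E3)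

lemma IsChart.contDiffOn_of_tsupport {p : E3} {R : E3 ≃ₗᵢ[ℝ] E3} {K : ℝ≥0} {φ : E2 → ℝ} {r : ℝ}
    (hch : IsChart Ω p R K φ r) {h : E3 → ℝ} (hh : ContDiffOn ℝ 1 h (closure Ω))
    (hs : tsupport h ⊆ Metric.ball p r) : ContDiffOn ℝ 1 h {x | φ (hor R x) ≤ ver R x} := by
  intro x hx
  by_cases hxs : x ∈ tsupport h
  · have hxb := hs hxs
    refine (hh x ((hch.mem_closure_iff x hxb).2 hx)).mono_of_mem_nhdsWithin ?_
    filter_upwards [inter_mem_nhdsWithin _ (Metric.isOpen_ball.mem_nhds hxb)] with z hz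
    exact (hch.mem_closure_iff z hz.2).2 hz.1
  · exact (contDiffAt_const (c := (0 : ℝ))).congr_of_eventuallyEq
      (notMem_tsupport_iff_eventuallyEq.1 hxs) |>.contDiffWithinAt

lemma IsLipschitzDomain.exists_bound_fderiv (hΩ : IsLipschitzDomain Ω) {h : E3 → ℝ}
    (hh : ContDiffOn ℝ 1 h (closure Ω)) : ∃ B, ∀ x ∈ Ω, ‖fderiv ℝ h x‖ ≤ B := by
  obtain ⟨B, hB⟩ := hΩ.isCompact_closure.exists_bound_of_continuousOn
    (hh.continuousOn_fderivWithin hΩ.uniqueDiffOn_closure le_rfl)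
  refine ⟨B, fun x hx => ?_⟩
  rw [← fderivWithin_closure_eq hΩ.isOpen h hx]
  exact hB x (subset_closure hx)

lemma IsLipschitzDomain.integrableOn_fderiv (hΩ : IsLipschitzDomain Ω) {h : E3 → ℝ}
    (hh : ContDiffOn ℝ 1 h (closure Ω)) (e : E3) : IntegrableOn (fun x => fderiv ℝ h x e) Ω := by
  have h1 := hΩ.integrableOn
    ((hh.continuousOn_fderivWithin hΩ.uniqueDiffOn_closure le_rfl).clm_apply
      (continuousOn_const (c := e)))
  refine h1.congr_fun (fun x hx => ?_) hΩ.isOpen.measurableSet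
  simp only [fderivWithin_closure_eq hΩ.isOpen h hx]

/-- The Gauss theorem for functions supported in a boundary chart. -/
lemma IsChart.gaussFormula (hΩ : IsLipschitzDomain Ω) {p : E3} {R : E3 ≃ₗᵢ[ℝ] E3} {K : ℝ≥0}
    {φ : E2 → ℝ} {r : ℝ} (hch : IsChart Ω p R K φ r) {h : E3 → ℝ}
    (hh : ContDiffOn ℝ 1 h (closure Ω)) (hc : HasCompactSupport h)
    (hs : tsupport h ⊆ Metric.ball p r) : GaussFormula Ω h := by
  intro e
  have hφ := hch.lipschitz
  have hE := hch.contDiffOn_of_tsupport hh hs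
  set D := {x | φ (hor R x) < ver R x} with hD
  have hDo : IsOpen D := isOpen_epigraph R hφ.continuous
  have hball := Metric.isOpen_ball (x := p) (ε := r)
  have h0 : ∀ x, x ∉ Metric.ball p r → h x = 0 := fun x hx =>
    image_eq_zero_of_notMem_tsupport fun hx' => hx (hs hx')
  have h0' : ∀ x, x ∉ Metric.ball p r → fderiv ℝ h x e = 0 := fun x hx => by
    rw [fderiv_of_notMem_tsupport (𝕜 := ℝ) fun hx' => hx (hs hx')]; rfl
  obtain ⟨B, hB⟩ := hΩ.exists_bound_fderiv hh
  have hBD : ∀ x, φ (hor R x) < ver R x → ‖fderiv ℝ h x‖ ≤ max B 0 := by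
    intro x hx
    by_cases hxb : x ∈ Metric.ball p r
    · exact (hB x ((hch.mem_iff x hxb).2 hx)).trans (le_max_left _ _)
    · rw [fderiv_of_notMem_tsupport (𝕜 := ℝ) fun hx' => hxb (hs hx'), norm_zero]
      exact le_max_right _ _
  have hG := setIntegral_epigraph_fderiv R hφ hc
    (hE.mono fun x hx => le_of_lt (Set.mem_ofPred_eq ▸ hx)) hE.continuousOn hBD e
  have hvol : ∫ x in Ω, fderiv ℝ h x e = ∫ x in D, fderiv ℝ h x e := by
    have hset : Ω ∩ Metric.ball p r = D ∩ Metric.ball p r := by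
      ext x
      exact and_congr_left fun hx => hch.mem_iff x hx
    rw [setIntegral_eq_of_subset_of_forall_sdiff_eq_zero hΩ.isOpen.measurableSet
      (inter_subset_left (t := Metric.ball p r)) fun x hx => h0' x fun hxb => hx.2 ⟨hx.1, hxb⟩,
      hset, ← setIntegral_eq_of_subset_of_forall_sdiff_eq_zero hDo.measurableSet
      (inter_subset_left (t := Metric.ball p r)) fun x hx => h0' x fun hxb => hx.2 ⟨hx.1, hxb⟩]
  set g : E3 → ℝ := fun x => h x * inner ℝ e (outerNormal Ω x) with hg
  have hg0 : ∀ x, x ∉ Metric.ball p r → g x = 0 := fun x hx => by rw [hg]; simp [h0 x hx]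
  have hemb := measurableEmbedding_graphMap R hφ.continuous
  have hsetf : frontier Ω ∩ Metric.ball p r = range (graphMap R φ) ∩ Metric.ball p r := by
    ext x
    refine and_congr_left fun hx => (hch.mem_frontier_iff x hx).trans ⟨fun h => ?_, ?_⟩
    · exact ⟨hor R x, by rw [graphMap, h, pt_hor_ver]⟩
    · rintro ⟨y, rfl⟩
      rw [hor_graphMap, graphMap, ver_pt]
  have hae : (fun y => areaDensity (fderiv ℝ φ y) * g (graphMap R φ y)) =ᵐ[volume]
      fun y => (fderiv ℝ φ y (hor R e) - ver R e) * h (graphMap R φ y) := by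
    filter_upwards [hφ.ae_differentiableAt (μ := volume)] with y hy
    by_cases hyb : graphMap R φ y ∈ Metric.ball p r
    · simp only [hg]
      rw [(hch.isOuterNormal hyb hy).outerNormal_eq, mul_left_comm,
        areaDensity_mul_inner_graphNormal, mul_comm]
    · rw [hg0 _ hyb, h0 _ hyb, mul_zero, mul_zero]
  have hint : Integrable fun y => (fderiv ℝ φ y (hor R e) - ver R e) * h (graphMap R φ y) := by
    have hcont : Continuous fun y => h (graphMap R φ y) :=
      hE.continuousOn.comp_continuous (continuous_graphMap R hφ.continuous) fun y => by
        simp [graphMap]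
    have hcs : HasCompactSupport fun y => h (graphMap R φ y) :=
      hc.comp_isClosedEmbedding (Function.LeftInverse.isClosedEmbedding (f := hor R)
        (hor_graphMap R) (hor R).continuous (continuous_graphMap R hφ.continuous))
    refine (hcont.integrable_of_hasCompactSupport hcs).bdd_mul (c := K * ‖hor R e‖ + |ver R e|)
      ((measurable_fderiv_apply_const ℝ φ _).sub measurable_const).aestronglyMeasurable
      (Eventually.of_forall fun y => (norm_sub_le _ _).trans (add_le_add ?_ le_rfl))
    exact (ContinuousLinearMap.le_opNorm _ _).trans
      (mul_le_mul_of_nonneg_right (norm_fderiv_le_of_lipschitz ℝ hφ) (norm_nonneg _))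
  have hfm : MeasurableSet (frontier Ω) := isClosed_frontier.measurableSet
  constructor
  · have h1 := (integrableOn_graph R hφ g).2 (hint.congr hae.symm)
    have h2 := h1.mono_set (inter_subset_left (t := Metric.ball p r))
    rw [← hsetf] at h2
    exact h2.of_forall_sdiff_eq_zero hfm fun x hx => hg0 x fun hxb => hx.2 ⟨hx.1, hxb⟩
  · rw [hvol, hG, ← integral_congr_ae hae, ← setIntegral_graph R hφ g,
      setIntegral_eq_of_subset_of_forall_sdiff_eq_zero hemb.measurableSet_range
        (inter_subset_left (t := Metric.ball p r)) fun x hx => hg0 x fun hxb => hx.2 ⟨hx.1, hxb⟩,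
      ← hsetf, ← setIntegral_eq_of_subset_of_forall_sdiff_eq_zero hfm
        (inter_subset_left (t := Metric.ball p r)) fun x hx => hg0 x fun hxb => hx.2 ⟨hx.1, hxb⟩]

/-- The Gauss theorem for functions supported in the interior. -/
lemma gaussFormula_of_tsupport_subset (hΩ : IsOpen Ω) {h : E3 → ℝ}
    (hh : ContDiffOn ℝ 1 h (closure Ω)) (hc : HasCompactSupport h) (hs : tsupport h ⊆ Ω) :
    GaussFormula Ω h := by
  intro e
  have h0 : ∀ x ∈ frontier Ω, h x = 0 := fun x hx =>
    image_eq_zero_of_notMem_tsupport fun hx' => (hΩ.frontier_eq ▸ hx).2 (hs hx')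
  have h1 : EqOn (fun x => h x * inner ℝ e (outerNormal Ω x)) 0 (frontier Ω) := fun x hx => by
    simp [h0 x hx]
  have hfm : MeasurableSet (frontier Ω) := isClosed_frontier.measurableSet
  refine ⟨integrableOn_zero.congr_fun h1.symm hfm, ?_⟩
  rw [setIntegral_congr_fun hfm h1]
  have hd : ContDiff ℝ 1 h := by
    refine contDiff_iff_contDiffAt.2 fun x => ?_
    by_cases hx : x ∈ tsupport h
    · exact hh.contDiffAt (mem_of_superset (hΩ.mem_nhds (hs hx)) subset_closure)
    · exact contDiffAt_const.congr_of_eventuallyEq (notMem_tsupport_iff_eventuallyEq.1 hx)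
  obtain ⟨C, hC⟩ := hd.lipschitzWith_of_hasCompactSupport hc one_ne_zero
  have h2 := (LipschitzWith.const (α := E3) (1 : ℝ)).integral_lineDeriv_mul_eq (μ := volume)
    hC hc (-e)
  have h3 : ∀ x, lineDeriv ℝ (fun _ : E3 => (1 : ℝ)) x (-e) = 0 := fun x => by simp [lineDeriv]
  simp only [h3, zero_mul, integral_zero, neg_neg, mul_one] at h2
  rw [setIntegral_eq_integral_of_forall_compl_eq_zero fun x hx => ?_]
  · simp only [Pi.zero_apply, integral_zero]
    rw [h2]
    exact integral_congr_ae (Eventually.of_forall fun x =>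
      ((hd.differentiable one_ne_zero) x).lineDeriv_eq_fderiv.symm)
  · rw [fderiv_of_notMem_tsupport (𝕜 := ℝ) fun hx' => hx (hs hx')]; rfl

/-- The Gauss theorem for functions of class `C¹` up to the boundary, by a partition of unity. -/
lemma IsLipschitzDomain.gaussFormula (hΩ : IsLipschitzDomain Ω) {u : E3 → ℝ}
    (hu : ContDiffOn ℝ 1 u (closure Ω)) : GaussFormula Ω u := by
  have hloc : ∀ p ∈ closure Ω, ∃ U, IsOpen U ∧ p ∈ U ∧ Bornology.IsBounded U ∧
      ∀ h : E3 → ℝ, ContDiffOn ℝ 1 h (closure Ω) → HasCompactSupport h → tsupport h ⊆ U →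
        GaussFormula Ω h := by
    intro p hp
    by_cases hpΩ : p ∈ Ω
    · exact ⟨Ω, hΩ.isOpen, hpΩ, hΩ.isBounded, fun h hh hc hs =>
        gaussFormula_of_tsupport_subset hΩ.isOpen hh hc hs⟩
    · have hpf : p ∈ frontier Ω := by rw [hΩ.isOpen.frontier_eq]; exact ⟨hp, hpΩ⟩
      obtain ⟨R, K, φ, r, hc⟩ := hΩ.exists_chart hpf
      exact ⟨Metric.ball p r, Metric.isOpen_ball, Metric.mem_ball_self hc.pos, Metric.isBounded_ball,
        fun h hh hcs hs => hc.gaussFormula hΩ hh hcs hs⟩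
  choose! U hUo hpU hUb hU using hloc
  obtain ⟨T, hT, hcov⟩ := hΩ.isCompact_closure.elim_nhds_subcover U
    fun p hp => (hUo p hp).mem_nhds (hpU p hp)
  obtain ⟨ρ, hρ⟩ := SmoothPartitionOfUnity.exists_isSubordinate 𝓘(ℝ, E3) isClosed_closure
    (fun i : T => U i) (fun i => hUo i (hT i i.2)) (by
      intro x hx
      obtain ⟨i, hi, hxi⟩ := mem_iUnion₂.1 (hcov hx)
      exact mem_iUnion.2 ⟨⟨i, hi⟩, hxi⟩)
  have hρd : ∀ i, ContDiff ℝ 1 (ρ i) := fun i =>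
    (ρ i).contMDiff.contDiff.of_le (by exact_mod_cast le_top)
  have hhd : ∀ i, ContDiffOn ℝ 1 (fun x => ρ i x * u x) (closure Ω) := fun i =>
    (hρd i).contDiffOn.mul hu
  have hsub : ∀ i, tsupport (fun x => ρ i x * u x) ⊆ U i := fun i =>
    (tsupport_mul_subset_left).trans (hρ i)
  have hcs : ∀ i, HasCompactSupport fun x => ρ i x * u x := fun i =>
    Metric.isCompact_of_isClosed_isBounded (isClosed_tsupport _)
      ((hUb i (hT i i.2)).subset (hsub i))
  have hsum : ∀ x ∈ closure Ω, ∑ i, ρ i x * u x = u x := fun x hx => by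
    rw [← Finset.sum_mul, ← finsum_eq_sum_of_fintype, ρ.sum_eq_one hx, one_mul]
  have hgf := fun i : T => hU i (hT i i.2) _ (hhd i) (hcs i) (hsub i)
  intro e
  have hfm : MeasurableSet (frontier Ω) := isClosed_frontier.measurableSet
  have hbd : EqOn (fun x => ∑ i, (ρ i x * u x) * inner ℝ e (outerNormal Ω x))
      (fun x => u x * inner ℝ e (outerNormal Ω x)) (frontier Ω) := fun x hx => by
    simp only [← Finset.sum_mul]
    rw [Finset.sum_mul, Finset.sum_mul]
    simp only [← Finset.sum_mul]
    rw [Finset.sum_mul, hsum x (frontier_subset_closure hx)]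
  have hin : EqOn (fun x => ∑ i, fderiv ℝ (fun x => ρ i x * u x) x e)
      (fun x => fderiv ℝ u x e) Ω := fun x hx => by
    have h1 : HasFDerivAt (fun x => ∑ i, ρ i x * u x)
        (∑ i, fderiv ℝ (fun x => ρ i x * u x) x) x :=
      HasFDerivAt.fun_sum fun i _ => (((hhd i).contDiffAt (mem_of_superset (hΩ.isOpen.mem_nhds hx)
        subset_closure)).differentiableAt one_ne_zero).hasFDerivAt
    have h2 := h1.congr_of_eventuallyEq (f₁ := u) (by
      filter_upwards [hΩ.isOpen.mem_nhds hx] with z hz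
      exact (hsum z (subset_closure hz)).symm)
    simp only [h2.fderiv, sum_apply]
  constructor
  · exact (integrable_finsetSum _ fun i _ => (hgf i e).1).congr
      ((ae_restrict_mem hfm).mono fun x hx => hbd hx)
  · rw [← setIntegral_congr_fun hΩ.isOpen.measurableSet hin, ← setIntegral_congr_fun hfm hbd,
      integral_finsetSum _ fun i _ => hΩ.integrableOn_fderiv (hhd i) e,
      integral_finsetSum _ fun i _ => (hgf i e).1]
    exact Finset.sum_congr rfl fun i _ => (hgf i e).2

variable {Γu Γt : Set E3} {f t : E3 → E3}

/-- The principle of virtual work: an equilibrated stress does the work of the external forces in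
every variation that vanishes on `Γu`. -/
lemma IsLipschitzDomain.integral_pairing_grad (hΩ : IsLipschitzDomain Ω)
    (hΓ : IsBoundaryDecomposition Ω Γu Γt) {τ : E3 → Tensor} (hτ : τ ∈ StatAdmissible Ω Γt f t)
    {v : E3 → E3} (hv : v ∈ VanishingOn Ω Γu) :
    IntegrableOn (fun x => pairing (τ x) (grad Ω v x)) Ω ∧
      ∫ x in Ω, pairing (τ x) (grad Ω v x) = externalEnergy Ω Γt f t v := by
  obtain ⟨hτ1, hτf, hτt⟩ := hτ
  obtain ⟨hv1, hv0⟩ := hv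
  have hvi := contDiffOn_apply hv1
  set w : Fin 3 → E3 → ℝ := fun j x => ∑ i, v x i * τ x i j with hw
  have hwd : ∀ j, ContDiffOn ℝ 1 (w j) (closure Ω) := fun j =>
    ContDiffOn.sum fun i _ => (hvi i).mul (hτ1 i j)
  have hpw : ∀ j, ∀ x ∈ Ω, fderiv ℝ (w j) x (EuclideanSpace.single j 1) =
      ∑ i, (v x i * partialD Ω (fun y => τ y i j) j x +
        τ x i j * partialD Ω (fun y => v y i) j x) := by
    intro j x hx
    have hxc := subset_closure hx
    have h1 : HasFDerivWithinAt (w j) _ (closure Ω) x := HasFDerivWithinAt.fun_sum fun i _ =>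
      ((differentiableWithinAt_of_contDiffOn (hvi i) hxc).hasFDerivWithinAt.mul
        (differentiableWithinAt_of_contDiffOn (hτ1 i j) hxc).hasFDerivWithinAt)
    rw [← partialD_eq_fderiv hΩ.isOpen _ _ hx, hΩ.partialD_eq hxc h1 j,
      sum_apply]
    rfl
  have hdiv : ∀ x ∈ Ω, ∑ j, fderiv ℝ (w j) x (EuclideanSpace.single j 1) =
      pairing (τ x) (grad Ω v x) - inner ℝ (v x) (f x) := by
    intro x hx
    rw [← hτf x hx, pairing_apply, Finset.sum_congr rfl fun j _ => hpw j x hx]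
    simp only [PiLp.inner_apply, div, grad, Fin.sum_univ_three, Matrix.of_apply, PiLp.neg_apply,
      RCLike.inner_apply, conj_trivial]
    ring
  have hpi : IntegrableOn (fun x => pairing (τ x) (grad Ω v x)) Ω := by
    refine hΩ.integrableOn ?_
    simp only [pairing_apply]
    refine continuousOn_finsetSum _ fun i _ => continuousOn_finsetSum _ fun j _ => ?_
    exact (hτ1 i j).continuousOn.mul (hΩ.continuousOn_partialD (hvi i) j)
  have hsi : IntegrableOn (fun x => ∑ j, fderiv ℝ (w j) x (EuclideanSpace.single j 1)) Ω :=
    integrable_finsetSum _ fun j _ => hΩ.integrableOn_fderiv (hwd j) _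
  have hfi : IntegrableOn (fun x => inner ℝ (v x) (f x)) Ω :=
    (hpi.sub hsi).congr_fun (fun x hx => by simp only [Pi.sub_apply, hdiv x hx]; ring)
      hΩ.isOpen.measurableSet
  refine ⟨hpi, ?_⟩
  set G : E3 → ℝ := fun x => ∑ j, w j x * inner ℝ (EuclideanSpace.single j 1) (outerNormal Ω x)
    with hG
  have hgauss : ∫ x in Ω, ∑ j, fderiv ℝ (w j) x (EuclideanSpace.single j 1) =
      ∫ x in frontier Ω, G x ∂(μHE[2] : Measure E3) := by
    rw [integral_finsetSum _ fun j _ => hΩ.integrableOn_fderiv (hwd j) _,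
      integral_finsetSum _ fun j _ => (hΩ.gaussFormula (hwd j) _).1]
    exact Finset.sum_congr rfl fun j _ => (hΩ.gaussFormula (hwd j) _).2
  obtain ⟨O, hO, hOt⟩ := hΓ.relOpen_right
  have hsub : Γt ⊆ frontier Ω := hOt ▸ inter_subset_right
  have hfm : MeasurableSet (frontier Ω) := isClosed_frontier.measurableSet
  have hΓm : MeasurableSet Γt := hOt ▸ hO.measurableSet.inter hfm
  have hbd : ∫ x in frontier Ω, G x ∂(μHE[2] : Measure E3) =
      ∫ x in Γt, inner ℝ (v x) (t x) ∂(μHE[2] : Measure E3) := by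
    rw [setIntegral_eq_of_subset_of_ae_sdiff_eq_zero hfm.nullMeasurableSet hsub]
    · refine integral_congr_ae (hτt.mono ?_)
      rintro x ⟨n, hn, hnt⟩
      simp only [hG, hw, hn.outerNormal_eq, PiLp.inner_apply, RCLike.inner_apply, conj_trivial,
        ← hnt, Fin.sum_univ_three]
      simp
      ring
    · filter_upwards [measure_eq_zero_iff_ae_notMem.1 hΓ.cover] with x hx hxf
      have hxu : x ∈ Γu := by
        by_contra hxu
        exact hx ⟨hxf.1, fun h => h.elim hxu hxf.2⟩
      simp [hG, hw, hv0 x hxu]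
  rw [externalEnergy, ← hbd, ← hgauss, setIntegral_congr_fun hΩ.isOpen.measurableSet hdiv,
    integral_sub hpi hfi]
  ring

end Gauss

end

section

/-! ### The deformation recovered from a stationary point -/

variable {Ω Γu Γt : Set E3} {f t : E3 → E3} {V : Tensor → ℝ} {S τ : E3 → Tensor}

/-- A row of a tensor field, as a vector field. -/
def rowField (F : E3 → Tensor) (i : Fin 3) (x : E3) : E3 := WithLp.toLp 2 fun j => F x i j

/-- The deformation gradient `½ τ S⁻¹` determined by the stresses `S` and `τ`. -/
def dualGrad (S τ : E3 → Tensor) (x : E3) : Tensor := (1 / 2 : ℝ) • (τ x * (S x)⁻¹)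

lemma continuousOn_rowField {F : E3 → Tensor} (hF : ContinuousOn F (closure Ω)) (i : Fin 3) :
    ContinuousOn (rowField F i) (closure Ω) := by
  refine (PiLp.continuous_toLp 2 _).comp_continuousOn (continuousOn_pi.2 fun j => ?_)
  exact (continuous_apply_apply i j).comp_continuousOn hF

lemma inner_rowField (F : E3 → Tensor) (i : Fin 3) (x y : E3) :
    inner ℝ (rowField F i x) y = ∑ j, F x i j * y j := by
  simp [rowField, PiLp.inner_apply, mul_comm]

lemma IsDualStationary.continuousOn_dualGrad (h : IsDualStationary V Ω Γt f t S τ) :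
    ContinuousOn (dualGrad S τ) (closure Ω) :=
  ContinuousOn.const_smul (g := fun x => τ x * (S x)⁻¹) (continuousOn_mul h.mem_stat.1.continuousOn
    (continuousOn_inv h.mem_dual.1 h.mem_dual.2.1)) (1 / 2 : ℝ)

/-- A stationary point yields weakly conservative rows: test tensors with a single nonzero row. -/
lemma IsDualStationary.annihilatesSolenoidal (hΩ : IsLipschitzDomain Ω)
    (hΓ : IsBoundaryDecomposition Ω Γu Γt) (h : IsDualStationary V Ω Γt f t S τ) (i : Fin 3) :
    AnnihilatesSolenoidal Ω Γt (rowField (dualGrad S τ) i) := by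
  intro θ hθ hdiv h0
  set Θ : E3 → Tensor := fun x => Matrix.of fun k j => if k = i then θ x j else 0 with hΘ
  have hmem : Θ ∈ StatAdmissible Ω Γt 0 0 := by
    refine mem_statAdmissible_zero h.mem_stat hΓ.relOpen_right (fun k j => ?_) (fun x hx => ?_)
      fun x hx => ?_
    · by_cases hk : k = i
      · simp only [hΘ, Matrix.of_apply, if_pos hk]
        exact contDiffOn_apply hθ.contDiffOn j
      · simp only [hΘ, Matrix.of_apply, if_neg hk]
        exact contDiffOn_const
    · ext k
      simp only [div, PiLp.zero_apply]
      by_cases hk : k = i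
      · simp only [hΘ, Matrix.of_apply, if_pos hk]
        rw [← hdiv x hx, vdiv]
        refine Finset.sum_congr rfl fun j _ => ?_
        rw [partialD_eq_fderiv hΩ.isOpen _ _ hx]
        have h1 := (EuclideanSpace.proj (𝕜 := ℝ) j).hasFDerivAt.comp x
          (hθ.differentiable one_ne_zero x).hasFDerivAt
        exact congrArg (fun L : E3 →L[ℝ] ℝ => L (EuclideanSpace.single j 1)) h1.fderiv
      · simp only [hΘ, Matrix.of_apply, if_neg hk]
        refine Finset.sum_eq_zero fun j _ => ?_
        rw [partialD_eq_fderiv hΩ.isOpen _ _ hx]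
        simp
    · ext k j
      simp [hΘ, h0 x hx]
  have h1 := h.integral_pairing_eq_zero hΩ hmem
  have h2 : ∀ x, inner ℝ (rowField (dualGrad S τ) i x) (θ x) =
      (1 / 2 : ℝ) * pairing (τ x * (S x)⁻¹) (Θ x) := fun x => by
    rw [inner_rowField, pairing_apply, Finset.sum_comm, Finset.mul_sum]
    refine Finset.sum_congr rfl fun j _ => ?_
    simp only [dualGrad, hΘ, Matrix.of_apply, Matrix.smul_apply, smul_eq_mul, mul_ite, mul_zero,
      Finset.sum_ite_eq', Finset.mem_univ, if_true]
    ring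
  simp only [h2]
  rw [integral_const_mul, h1, mul_zero]

/-- The potential of the rows of `½ τ S⁻¹` that vanishes on `Γu`. -/
lemma IsDualStationary.exists_deformation (hΩ : IsLipschitzDomain Ω)
    (hΓ : IsBoundaryDecomposition Ω Γu Γt) (h : IsDualStationary V Ω Γt f t S τ) {x₀ : E3}
    (hx₀ : x₀ ∈ Γu) :
    ∃ χ : E3 → E3, (∀ x ∈ Γu, χ x = 0) ∧ ∀ i, ∀ x ∈ closure Ω, HasFDerivWithinAt (fun y => χ y i)
      (innerSL ℝ (rowField (dualGrad S τ) i x)) (closure Ω) x := by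
  have hc := fun i => continuousOn_rowField h.continuousOn_dualGrad i
  have hΓt : Γt ⊆ frontier Ω := by
    obtain ⟨O, -, hO⟩ := hΓ.relOpen_right
    exact hO ▸ inter_subset_right
  choose u hu huW using fun i =>
    exists_isPotential hΩ (hc i) hΓt (h.annihilatesSolenoidal hΩ hΓ i)
  refine ⟨fun x => WithLp.toLp 2 fun i => extendFrom Ω (u i) x - extendFrom Ω (u i) x₀,
    fun x hx => ?_, fun i x hx => ?_⟩
  · ext i
    have := (hu i).extendFrom_eq hΩ hΓ (hc i) (h.annihilatesSolenoidal hΩ hΓ i) (huW i) hx hx₀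
    simp [this]
  · exact ((hu i).hasFDerivWithinAt hΩ (hc i) hx).sub_const _

section Gradient

variable {F : E3 → Tensor} {χ : E3 → E3}

lemma IsLipschitzDomain.grad_eq (hΩ : IsLipschitzDomain Ω)
    (hχ : ∀ i, ∀ x ∈ closure Ω, HasFDerivWithinAt (fun y => χ y i) (innerSL ℝ (rowField F i x))
      (closure Ω) x) {x : E3} (hx : x ∈ closure Ω) : grad Ω χ x = F x := by
  ext i j
  have h1 := hΩ.partialD_eq hx (hχ i x hx) j
  rw [innerSL_apply_apply, inner_rowField] at h1
  simpa [grad] using h1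

lemma IsLipschitzDomain.contDiffOn_of_grad (hΩ : IsLipschitzDomain Ω)
    (hF : ContinuousOn F (closure Ω))
    (hχ : ∀ i, ∀ x ∈ closure Ω, HasFDerivWithinAt (fun y => χ y i) (innerSL ℝ (rowField F i x))
      (closure Ω) x) : ContDiffOn ℝ 1 χ (closure Ω) := by
  refine contDiffOn_euclidean.2 fun i => ?_
  refine (contDiffOn_succ_iff_fderivWithin (n := 0) hΩ.uniqueDiffOn_closure).2
    ⟨fun x hx => (hχ i x hx).differentiableWithinAt, by simp, contDiffOn_zero.2 ?_⟩
  refine ((innerSL ℝ).continuous.comp_continuousOn (continuousOn_rowField hF i)).congr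
    fun x hx => ?_
  exact (hχ i x hx).fderivWithin (hΩ.uniqueDiffOn_closure x hx)

lemma IsPath.eq_half_smul_lineIntegral {G : E3 → Tensor} {x₀ x : E3} {γ : ℝ → E3}
    (hγ : IsPath (closure Ω) x₀ x γ) (hG : ContinuousOn (fun y => (1 / 2 : ℝ) • G y) (closure Ω))
    (hχ : ∀ i, ∀ x ∈ closure Ω, HasFDerivWithinAt (fun y => χ y i)
      (innerSL ℝ (rowField (fun y => (1 / 2 : ℝ) • G y) i x)) (closure Ω) x) (h0 : χ x₀ = 0) :
    χ x = (1 / 2 : ℝ) • lineIntegral G γ := by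
  ext i
  have h1 := hγ.integral_eq (continuousOn_rowField hG i) (hχ i)
  simp only [inner_rowField, h0, PiLp.zero_apply, sub_zero] at h1
  rw [← h1]
  simp only [lineIntegral, PiLp.smul_apply, smul_eq_mul, Matrix.smul_apply]
  rw [← intervalIntegral.integral_const_mul]
  simp only [Finset.mul_sum, mul_assoc]

end Gradient

/-! ### The recovered deformation is a critical point -/

/-- The constitutive relation at a point between the deformation gradient `F`, the stress
`S = ∇V(FᵀF)` and the Piola-Kirchhoff stress `τ = 2 F S = ∇U(F)`. -/
structure IsStressState (V : Tensor → ℝ) (F S τ : Tensor) : Prop where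
  mem_symPos : F.transpose * F ∈ SymPos
  hasStrainGradient : HasStrainGradient V S (F.transpose * F)
  strainOf_eq : strainOf V S = F.transpose * F
  stress_eq : τ = (2 : ℝ) • (F * S)

lemma IsStressState.hasFDerivAt {F S τ : Tensor} (h : IsStressState V F S τ) :
    HasFDerivAt (storedEnergy V) (pairing τ) F := by
  rw [h.stress_eq]
  exact h.hasStrainGradient.hasFDerivAt_storedEnergy h.mem_symPos

lemma pairing_two_smul_mul (F S H : Tensor) :
    pairing ((2 : ℝ) • (F * S)) H = 2 * pairing S (F.transpose * H) := by
  rw [pairing_eq_trace, pairing_eq_trace, Matrix.transpose_smul, Matrix.transpose_mul,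
    Matrix.smul_mul, Matrix.trace_smul, Matrix.mul_assoc, smul_eq_mul]

lemma IsStressState.pairing_eq {F S τ : Tensor} (h : IsStressState V F S τ) :
    pairing τ F = 2 * pairing S (F.transpose * F) := by
  rw [h.stress_eq, pairing_two_smul_mul]

lemma IsStressState.storedEnergy_eq {F S τ : Tensor} (h : IsStressState V F S τ) :
    storedEnergy V F = pairing S (F.transpose * F) - legendre V S := by
  rw [legendre, h.strainOf_eq, storedEnergy]; ring

lemma IsStressState.trace_eq {F S τ : Tensor} (h : IsStressState V F S τ) (hS : S.det ≠ 0) :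
    (1 / 4 : ℝ) * (τ * S⁻¹ * τ.transpose).trace = pairing S (F.transpose * F) := by
  have h1 : τ * S⁻¹ = (2 : ℝ) • F := by
    rw [h.stress_eq, Matrix.smul_mul, Matrix.mul_nonsing_inv_cancel_right _ _ hS.isUnit]
  rw [h1, h.stress_eq, pairing_eq_trace, Matrix.transpose_smul, Matrix.transpose_mul,
    Matrix.smul_mul, Matrix.mul_smul, Matrix.trace_smul, Matrix.trace_smul, ← Matrix.mul_assoc,
    ← Matrix.mul_assoc, ← Matrix.trace_mul_cycle, Matrix.mul_assoc]
  simp only [smul_eq_mul]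
  ring

/-- The stored energy lies above its tangents, in the directions in which the quadratic remainder
`S : (F' - F)ᵀ(F' - F)` is nonnegative. -/
lemma IsStressState.le_storedEnergy (hV : ConvexOn ℝ SymPos V) {F F' S τ : Tensor}
    (h : IsStressState V F S τ) (hS : S.PosDef) (hF' : F'.transpose * F' ∈ SymPos) :
    storedEnergy V F + pairing τ (F' - F) ≤ storedEnergy V F' := by
  have h1 := h.hasStrainGradient.le hV h.mem_symPos hF'
  have hsymm : S.transpose = S := h.hasStrainGradient.1
  have h2 : 0 ≤ pairing S ((F' - F).transpose * (F' - F)) := by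
    have h3 := (hS.posSemidef.mul_mul_conjTranspose_same (F' - F)).trace_nonneg
    rw [Matrix.conjTranspose_eq_transpose_of_trivial] at h3
    rw [pairing_eq_trace, hsymm, ← Matrix.mul_assoc, Matrix.trace_mul_cycle]
    exact h3
  have h3 : pairing S (F'.transpose * F' - F.transpose * F) =
      pairing S ((F' - F).transpose * (F' - F)) + pairing τ (F' - F) := by
    set D := F' - F with hD
    have e : F' = F + D := by rw [hD]; abel
    have e1 : pairing S (D.transpose * F) = pairing S (F.transpose * D) := by
      rw [pairing_eq_trace, pairing_eq_trace, ← Matrix.trace_transpose, hsymm,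
        Matrix.transpose_mul, Matrix.transpose_mul, Matrix.transpose_transpose, hsymm,
        Matrix.trace_mul_comm]
    have e2 : pairing τ D = 2 * pairing S (F.transpose * D) := by
      rw [h.stress_eq, pairing_two_smul_mul]
    have e3 : F'.transpose * F' - F.transpose * F =
        D.transpose * D + (D.transpose * F + F.transpose * D) := by
      rw [e, Matrix.transpose_add]; noncomm_ring
    rw [e3, map_add, map_add, e1, e2]; ring
  rw [h3] at h1
  simp only [storedEnergy]
  linarith

variable {χ : E3 → E3}

lemma IsLipschitzDomain.integrableOn_pairing_gram (hΩ : IsLipschitzDomain Ω)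
    (hχ : ContDiffOn ℝ 1 χ (closure Ω)) (hS : ContinuousOn S (closure Ω)) :
    IntegrableOn (fun x => pairing (S x) ((grad Ω χ x).transpose * grad Ω χ x)) Ω := by
  have h1 := hΩ.continuousOn_grad hχ
  have h2 : ContinuousOn (fun x => (grad Ω χ x).transpose) (closure Ω) :=
    (continuous_id.matrix_transpose).comp_continuousOn h1
  exact hΩ.integrableOn (continuousOn_pairing hS (continuousOn_mul h2 h1))

/-- There is no duality gap: both energies equal `∫ V(C) - 2 S : C`. -/
lemma IsDualStationary.totalPotential_eq (hΩ : IsLipschitzDomain Ω)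
    (hΓ : IsBoundaryDecomposition Ω Γu Γt) (h : IsDualStationary V Ω Γt f t S τ)
    (hχ : χ ∈ KinAdmissible V Ω Γu) (hs : ∀ x ∈ Ω, IsStressState V (grad Ω χ x) (S x) (τ x)) :
    totalPotential V Ω Γt f t χ = pureComplementary V Ω S τ := by
  obtain ⟨hi, he⟩ := hΩ.integral_pairing_grad hΓ h.mem_stat hχ.1
  have hm := hΩ.isOpen.measurableSet
  rw [totalPotential, pureComplementary, ← he, ← integral_sub hχ.2.2 hi, ← integral_neg]
  refine setIntegral_congr_fun hm fun x hx => ?_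
  simp only [(hs x hx).pairing_eq, (hs x hx).storedEnergy_eq,
    (hs x hx).trace_eq (h.mem_dual.2.1 x (subset_closure hx))]
  ring

/-- For positive definite `S` the tangent inequality of the stored energy, integrated with the
principle of virtual work, shows that the deformation is a global minimizer. -/
lemma IsDualStationary.isMinOn (hΩ : IsLipschitzDomain Ω)
    (hΓ : IsBoundaryDecomposition Ω Γu Γt) (hV : IsConvexCanonical V)
    (h : IsDualStationary V Ω Γt f t S τ)
    (hχ : χ ∈ KinAdmissible V Ω Γu) (hs : ∀ x ∈ Ω, IsStressState V (grad Ω χ x) (S x) (τ x))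
    (hS : ∀ x ∈ Ω, (S x).PosDef) :
    IsMinOn (totalPotential V Ω Γt f t) (KinAdmissible V Ω Γu) χ := by
  intro χ' hχ'
  rw [Set.mem_ofPred_eq]
  obtain ⟨hi, he⟩ := hΩ.integral_pairing_grad hΓ h.mem_stat hχ.1
  obtain ⟨hi', he'⟩ := hΩ.integral_pairing_grad hΓ h.mem_stat hχ'.1
  rw [totalPotential, totalPotential, ← he, ← he', ← integral_sub hχ.2.2 hi,
    ← integral_sub hχ'.2.2 hi']
  refine setIntegral_mono_on (hχ.2.2.sub hi) (hχ'.2.2.sub hi') hΩ.isOpen.measurableSet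
    fun x hx => ?_
  have := (hs x hx).le_storedEnergy hV.convexOn (hS x hx) (hχ'.2.1 x hx)
  rw [map_sub] at this
  linarith

section Line

-- The entrywise maximum norm induces the product topology, so the statement does not depend on it.
attribute [local instance] Matrix.normedAddCommGroup Matrix.normedSpace

lemma hasDerivAt_line {U : Tensor → ℝ} {L : Tensor →L[ℝ] ℝ} {F A : Tensor} {ε : ℝ}
    (h : HasFDerivAt U L (F + ε • A)) : HasDerivAt (fun e => U (F + e • A)) (L A) ε := by
  have hline : HasDerivAt (fun e : ℝ => F + e • A) A ε := by
    have := ((hasDerivAt_id ε).smul_const A).const_add F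
    rwa [one_smul] at this
  exact h.comp_hasDerivAt ε hline

end Line

lemma abs_pairing_le {G : Tensor} {B : ℝ} (h : ∀ i j, |G i j| ≤ B) (H : Tensor) :
    |pairing G H| ≤ |B| * ∑ i, ∑ j, |H i j| := by
  rw [pairing_apply, Finset.mul_sum]
  refine (Finset.abs_sum_le_sum_abs _ _).trans (Finset.sum_le_sum fun i _ => ?_)
  rw [Finset.mul_sum]
  refine (Finset.abs_sum_le_sum_abs _ _).trans (Finset.sum_le_sum fun j _ => ?_)
  rw [abs_mul]
  exact mul_le_mul_of_nonneg_right ((h i j).trans (le_abs_self B)) (abs_nonneg _)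

/-- The bound that dominates the differentiation under the integral sign: near a compact family of
nonsingular tensors the derivative of the stored energy is bounded. -/
lemma exists_bound_deriv_storedEnergy (hV : IsConvexCanonical V) {K : Set E3} (hK : IsCompact K)
    {F A : E3 → Tensor} (hF : ContinuousOn F K) (hA : ContinuousOn A K)
    (hdet : ∀ x ∈ K, (F x).det ≠ 0) :
    ∃ δ > 0, ∃ B, ∀ x ∈ K, ∀ ε ∈ Metric.ball (0 : ℝ) δ, (F x + ε • A x).det ≠ 0 ∧
      ∃ d, HasDerivAt (fun e : ℝ => storedEnergy V (F x + e • A x)) d ε ∧ |d| ≤ B := by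
  have hev := eventually_forall_mem_of_continuousOn hK hF hA
    (g := fun M : Tensor => M.det) continuous_id.matrix_det (U := {0}ᶜ)
    fun x hx => isOpen_compl_singleton.mem_nhds (hdet x hx)
  obtain ⟨δ, hδ, hball⟩ := Metric.eventually_nhds_iff_ball.1 hev
  have hδ2 : 0 < δ / 2 := by linarith
  set Q : Set (ℝ × E3) := Metric.closedBall 0 (δ / 2) ×ˢ K with hQ
  have hQc : IsCompact Q := (isCompact_closedBall 0 _).prod hK
  have hdetQ : ∀ z ∈ Q, (F z.2 + z.1 • A z.2).det ≠ 0 := fun z hz =>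
    hball z.1 (Metric.closedBall_subset_ball (by linarith) hz.1) z.2 hz.2
  have hM : ContinuousOn (fun z : ℝ × E3 => F z.2 + z.1 • A z.2) Q :=
    (hF.comp continuousOn_snd fun z hz => hz.2).add
      (continuousOn_fst.smul (hA.comp continuousOn_snd fun z hz => hz.2))
  have hMt : ContinuousOn (fun z : ℝ × E3 => (F z.2 + z.1 • A z.2).transpose) Q :=
    (continuous_id.matrix_transpose).comp_continuousOn hM
  have hG : ContinuousOn
      (fun z : ℝ × E3 => (F z.2 + z.1 • A z.2).transpose * (F z.2 + z.1 • A z.2)) Q :=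
    continuousOn_mul hMt hM
  obtain ⟨B, hB⟩ := exists_bound_strainGradient hV (hQc.image_of_continuousOn hG) (by
    rintro _ ⟨z, hz, rfl⟩
    exact gram_mem_symPos (hdetQ z hz))
  have hN : ContinuousOn (fun z : ℝ × E3 => (F z.2 + z.1 • A z.2).transpose * A z.2) Q :=
    continuousOn_mul hMt (hA.comp continuousOn_snd fun z hz => hz.2)
  have hNs : ContinuousOn (fun z : ℝ × E3 => ∑ i, ∑ j,
      |((F z.2 + z.1 • A z.2).transpose * A z.2) i j|) Q :=
    continuousOn_finsetSum _ fun i _ => continuousOn_finsetSum _ fun j _ =>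
      ((continuous_apply_apply i j).comp_continuousOn hN).abs
  obtain ⟨D, hD⟩ := hQc.exists_bound_of_continuousOn hNs
  refine ⟨δ / 2, hδ2, 2 * (|B| * D), fun x hx ε hε => ?_⟩
  have hz : (ε, x) ∈ Q := ⟨Metric.ball_subset_closedBall hε, hx⟩
  have hd : (F x + ε • A x).det ≠ 0 := hdetQ _ hz
  have hC := gram_mem_symPos hd
  obtain ⟨S', hS'⟩ := hV.differentiable _ hC
  have h1 : HasFDerivAt (storedEnergy V) (pairing ((2 : ℝ) • ((F x + ε • A x) * S')))
      (F x + ε • A x) := hS'.hasFDerivAt_storedEnergy hC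
  have h2 : |pairing S' ((F x + ε • A x).transpose * A x)| ≤
      |B| * ∑ i, ∑ j, |((F x + ε • A x).transpose * A x) i j| :=
    abs_pairing_le (hB _ ⟨(ε, x), hz, rfl⟩ S' hS') _
  refine ⟨hd, _, hasDerivAt_line h1, ?_⟩
  rw [pairing_two_smul_mul, abs_mul, abs_two]
  refine mul_le_mul_of_nonneg_left (h2.trans (mul_le_mul_of_nonneg_left ?_ (abs_nonneg B)))
    zero_le_two
  exact (Real.le_norm_self _).trans (hD (ε, x) hz)

lemma grad_eq_zero_of_notMem_tsupport (hΩ : IsOpen Ω) {v : E3 → E3} {x : E3} (hx : x ∈ Ω)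
    (hv : x ∉ tsupport v) : grad Ω v x = 0 := by
  ext i j
  have h1 : (fun y => v y i) =ᶠ[𝓝 x] fun _ => 0 :=
    (notMem_tsupport_iff_eventuallyEq.1 hv).mono fun y hy => by simp [hy]
  simp only [grad, Matrix.of_apply, Matrix.zero_apply]
  rw [partialD_eq_fderiv hΩ _ _ hx, h1.fderiv_eq]
  simp

/-- The deformation is a critical point. For the Gateaux derivative the variation is supported in a
compact set of nonsingular deformation gradients, where the derivative of the energy density is
bounded; elsewhere the density does not change. -/
lemma IsDualStationary.isCriticalPoint (hΩ : IsLipschitzDomain Ω)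
    (hΓ : IsBoundaryDecomposition Ω Γu Γt) (hV : IsConvexCanonical V)
    (h : IsDualStationary V Ω Γt f t S τ)
    (hχ : χ ∈ KinAdmissible V Ω Γu) (hs : ∀ x ∈ Ω, IsStressState V (grad Ω χ x) (S x) (τ x)) :
    IsCriticalPoint V Ω Γu Γt f t χ := by
  refine ⟨hχ, ⟨τ, fun x hx => (hs x hx).hasFDerivAt, fun v hv => ?_⟩, fun v hv hsupp => ?_⟩
  · obtain ⟨hi, he⟩ := hΩ.integral_pairing_grad hΓ h.mem_stat hv
    exact ⟨hi, by rw [he, sub_self]⟩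
  have hm := hΩ.isOpen.measurableSet
  have hFc := hΩ.continuousOn_grad hχ.1.1
  have hAc := hΩ.continuousOn_grad hv.1
  have hτc := h.mem_stat.1.continuousOn
  set F := grad Ω χ
  set A := grad Ω v with hA
  obtain ⟨hi, -⟩ := hΩ.integral_pairing_grad hΓ h.mem_stat hχ.1
  obtain ⟨hiv, -⟩ := hΩ.integral_pairing_grad hΓ h.mem_stat hv
  -- the external energy of the varied deformation is the virtual work of `τ`
  have hP : ∀ ε : ℝ, totalPotential V Ω Γt f t (χ + ε • v) =
      (∫ x in Ω, storedEnergy V (F x + ε • A x)) -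
        ((∫ x in Ω, pairing (τ x) (F x)) + ε * ∫ x in Ω, pairing (τ x) (A x)) := by
    intro ε
    have hmem : χ + ε • v ∈ VanishingOn Ω Γu :=
      ⟨hχ.1.1.add (hv.1.const_smul ε), fun x hx => by simp [hχ.1.2 x hx, hv.2 x hx]⟩
    have hg : ∀ x ∈ Ω, grad Ω (χ + ε • v) x = F x + ε • A x := fun x hx =>
      hΩ.grad_add_smul hχ.1.1 hv.1 ε (subset_closure hx)
    rw [totalPotential, ← (hΩ.integral_pairing_grad hΓ h.mem_stat hmem).2,
      ← integral_const_mul, ← integral_add hi (hiv.const_mul ε)]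
    congr 1
    · exact setIntegral_congr_fun hm fun x hx => by simp only [hg x hx]
    · exact setIntegral_congr_fun hm fun x hx => by
        simp only [hg x hx, map_add, map_smul, smul_eq_mul]; rfl
  obtain ⟨δ, hδ, B, hB⟩ := exists_bound_deriv_storedEnergy hV
    (hΩ.isCompact_closure.inter_left (isClosed_tsupport v))
    (hFc.mono inter_subset_right) (hAc.mono inter_subset_right)
    fun x hx => det_ne_zero_of_gram_mem (hsupp x hx)
  have hdx : ∀ x ∈ Ω, ∀ ε ∈ Metric.ball (0 : ℝ) δ, (F x + ε • A x).det ≠ 0 ∧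
      ∃ d, HasDerivAt (fun e : ℝ => storedEnergy V (F x + e • A x)) d ε ∧ |d| ≤ max B 0 := by
    intro x hx ε hε
    by_cases hxs : x ∈ tsupport v
    · obtain ⟨h1, d, h2, h3⟩ := hB x ⟨hxs, subset_closure hx⟩ ε hε
      exact ⟨h1, d, h2, h3.trans (le_max_left _ _)⟩
    · have h0 : A x = 0 := grad_eq_zero_of_notMem_tsupport hΩ.isOpen hx hxs
      simp only [h0, smul_zero, add_zero]
      exact ⟨det_ne_zero_of_gram_mem (hχ.2.1 x hx), 0, hasDerivAt_const _ _,
        by simp⟩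
  have hd0 : ∀ x ∈ Ω, HasDerivAt (fun e : ℝ => storedEnergy V (F x + e • A x))
      (pairing (τ x) (A x)) 0 := by
    intro x hx
    have h1 : HasFDerivAt (storedEnergy V) (pairing (τ x)) (F x + (0 : ℝ) • A x) := by
      rw [zero_smul, add_zero]; exact (hs x hx).hasFDerivAt
    exact hasDerivAt_line h1
  have hmain := hΩ.hasDerivAt_integral (F := fun ε x => storedEnergy V (F x + ε • A x))
    (F' := fun ε x => deriv (fun e : ℝ => storedEnergy V (F x + e • A x)) ε) (B := max B 0) hδ
    (fun ε hε => by
      refine ContinuousOn.aestronglyMeasurable ?_ hm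
      have h1 : ContinuousOn (fun x => F x + ε • A x) Ω :=
        (hFc.add (hAc.const_smul ε)).mono subset_closure
      have h2 : ContinuousOn (fun x => (F x + ε • A x).transpose) Ω :=
        (continuous_id.matrix_transpose).comp_continuousOn h1
      exact hV.continuousOn.comp (continuousOn_mul h2 h1) fun x hx =>
        gram_mem_symPos (hdx x hx ε hε).1)
    (by simpa using hχ.2.2)
    (by
      refine AEStronglyMeasurable.congr
        (((continuousOn_pairing hτc hAc).mono subset_closure).aestronglyMeasurable hm) ?_
      exact (ae_restrict_mem hm).mono fun x hx => (hd0 x hx).deriv.symm)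
    (fun x hx ε hε => by
      obtain ⟨-, d, h2, -⟩ := hdx x hx ε hε
      exact h2.differentiableAt.hasDerivAt)
    (fun x hx ε hε => by
      obtain ⟨-, d, h2, h3⟩ := hdx x hx ε hε
      rw [h2.deriv]; exact h3)
  have hval : ∫ x in Ω, deriv (fun e : ℝ => storedEnergy V (F x + e • A x)) 0 =
      ∫ x in Ω, pairing (τ x) (A x) := setIntegral_congr_fun hm fun x hx => (hd0 x hx).deriv
  rw [funext hP]
  have h3 := hmain.sub (((hasDerivAt_id (0 : ℝ)).mul_const
    (∫ x in Ω, pairing (τ x) (A x))).const_add (∫ x in Ω, pairing (τ x) (F x)))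
  rw [hval, one_mul, sub_self] at h3
  exact h3

end

end Hyperelastic

end

theorem mainTheorem1
    (Ω Γu Γt : Set Hyperelastic.E3)
    (hΩ : Hyperelastic.IsLipschitzDomain Ω)
    (hΓ : Hyperelastic.IsBoundaryDecomposition Ω Γu Γt)
    (f t : Hyperelastic.E3 → Hyperelastic.E3)
    (V : Hyperelastic.Tensor → ℝ) (hV : Hyperelastic.IsConvexCanonical V)
    (S τ : Hyperelastic.E3 → Hyperelastic.Tensor)
    (hstat : Hyperelastic.IsDualStationary V Ω Γt f t S τ)
    (x₀ : Hyperelastic.E3) (hx₀ : x₀ ∈ Γu) :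
    ∃ χ : Hyperelastic.E3 → Hyperelastic.E3,
      -- the line integral from `x₀` does not depend on the path and defines `χ` on the closed body
      (∀ x ∈ closure Ω,
        (∃ γ, Hyperelastic.IsPath (closure Ω) x₀ x γ) ∧
        ∀ γ, Hyperelastic.IsPath (closure Ω) x₀ x γ →
          χ x = (1 / 2 : ℝ) • Hyperelastic.lineIntegral (fun y => τ y * (S y)⁻¹) γ) ∧
      -- `χ` is a critical point of the total potential, with positive Jacobian
      Hyperelastic.IsCriticalPoint V Ω Γu Γt f t χ ∧
      (∀ x ∈ Ω, 0 < (Hyperelastic.grad Ω χ x).det) ∧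
      -- there is no duality gap
      Hyperelastic.totalPotential V Ω Γt f t χ = Hyperelastic.pureComplementary V Ω S τ ∧
      -- `χ` is a global minimizer when `S` is positive definite
      ((∀ x ∈ Ω, (S x).PosDef) →
        IsMinOn (Hyperelastic.totalPotential V Ω Γt f t)
          (Hyperelastic.KinAdmissible V Ω Γu) χ) ∧
      -- `χ` solves the boundary-value problem under the compatibility condition
      (Hyperelastic.CurlFree Ω (fun y => τ y * (S y)⁻¹) →
        Hyperelastic.SolvesBVP V Ω Γu Γt f t χ) := by
  obtain ⟨χ, hχ0, hχ⟩ := hstat.exists_deformation hΩ hΓ hx₀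
  have hFc := hstat.continuousOn_dualGrad
  have hgrad : ∀ x ∈ closure Ω, Hyperelastic.grad Ω χ x = Hyperelastic.dualGrad S τ x :=
    fun x hx => hΩ.grad_eq hχ hx
  have hχC := hΩ.contDiffOn_of_grad hFc hχ
  have hdet : ∀ x ∈ Ω, 0 < (Hyperelastic.grad Ω χ x).det := fun x hx => by
    rw [hgrad x (subset_closure hx), Hyperelastic.dualGrad, Matrix.det_smul]
    exact mul_pos (by positivity) (hstat.mem_dual.2.2.2.2 x hx)
  have hs : ∀ x ∈ Ω, Hyperelastic.IsStressState V (Hyperelastic.grad Ω χ x) (S x) (τ x) := by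
    intro x hx
    have h1 := hstat.strainOf_eq hΩ hV hΓ.relOpen_right hx
    have h2 := Hyperelastic.strainOf_spec (hstat.mem_dual.2.2.1 x hx)
    have h3 : Hyperelastic.grad Ω χ x = (1 / 2 : ℝ) • (τ x * (S x)⁻¹) :=
      hgrad x (subset_closure hx)
    rw [← h3] at h1
    rw [h1] at h2
    refine ⟨h2.1, h2.2, h1, ?_⟩
    rw [h3, Matrix.smul_mul, smul_smul, Matrix.nonsing_inv_mul_cancel_right _ _
      (hstat.mem_dual.2.1 x (subset_closure hx)).isUnit]
    norm_num
  have hKin : χ ∈ Hyperelastic.KinAdmissible V Ω Γu := by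
    refine ⟨⟨hχC, hχ0⟩, fun x hx => (hs x hx).mem_symPos, ?_⟩
    refine ((hΩ.integrableOn_pairing_gram hχC hstat.mem_dual.1).sub
      hstat.mem_dual.2.2.2.1).congr_fun (fun x hx => ?_) hΩ.isOpen.measurableSet
    exact (hs x hx).storedEnergy_eq.symm
  have hx₀c : x₀ ∈ closure Ω := by
    obtain ⟨O, -, hO⟩ := hΓ.relOpen_left
    rw [hO] at hx₀
    exact frontier_subset_closure hx₀.2
  refine ⟨χ, fun x hx => ⟨hΩ.exists_isPath hx₀c hx, fun γ hγ =>
    hγ.eq_half_smul_lineIntegral hFc hχ (hχ0 x₀ hx₀)⟩,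
    hstat.isCriticalPoint hΩ hΓ hV hKin hs, hdet, hstat.totalPotential_eq hΩ hΓ hKin hs,
    hstat.isMinOn hΩ hΓ hV hKin hs, fun _ => ⟨hKin.1, τ, hstat.mem_stat,
      fun x hx => (hs x hx).hasFDerivAt⟩⟩
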